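/- Let $H_1,H_2,H_3$ be real separable Hilbert spaces, and let $\mathcal A_1$ on $H_2\oplus H_1$ and $\mathcal A_2$ on $H_3\oplus H_2$ be continuous positive operators (symmetric, with $\langle \mathcal A_i x,x\rangle>0$ for all $x\neq0$) such that $\mathcal A_1-I$ and $\mathcal A_2-I$ are trace class. Notation. Write $\mathcal A_1=\begin{bmatrix}A&B\\B^t&D\end{bmatrix}$, $\mathcal A_2=\begin{bmatrix}K&L\\L^t&M\end{bmatrix}$ and $$\mathcal A_2\circ\mathcal A_1=\begin{bmatrix}K-L(A+M)^{-1}L^t&-L(A+M)^{-1}B\\-B^t(A+M)^{-1}L^t&D-B^t(A+M)^{-1}B\end{bmatrix}\quad\text{on }H_3\oplus H_1 .$$ For a positive operator $\mathcal A$ let $C(\mathcal A)=(I-\mathcal A)(I+\mathcal A)^{-1}$. For a real Hilbert space $H$ let $\operatorname{Sym}^*(H^\vee)=\bigoplus_{n\ge0}\operatorname{Sym}^n(H^\vee)$ be the Bosonic Fock space (Hilbert space direct sum, $\operatorname{Sym}^n(H^\vee)\subset (H^\vee)^{\otimes n}$ the symmetric tensors), with the commutative product normalised by $h_1\cdots h_n=\frac1{\sqrt{n!}}\sum_{\sigma\in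 S_n}h_{\sigma(1)}\otimes\cdots\otimes h_{\sigma(n)}$. For a symmetric Hilbert–Schmidt operator $T$ on $H$ with $\|T\|<1$ let $\mathcal E(T)=\sum_{n\ge0}\frac1{n!}\bigl(\tfrac12S(T)\bigr)^n\in\operatorname{Sym}^*(H^\vee)$, where $S(T)=\sum_{i,j}\langle Te_i,e_j\rangle\,e_i\cdot e_j\in\operatorname{Sym}^2(H^\vee)$ is the quadratic polynomial $x\mapsto\langle Tx,x\rangle$ ($(e_i)$ an orthonormal basis, $e_i$ identified with $\langle e_i,\cdot\rangle$). A vector of $\operatorname{Sym}^*(H_2^\vee\oplus H_1^\vee)=\operatorname{Sym}^*(H_2^\vee)\otimes\operatorname{Sym}^*(H_1^\vee)$ is identified with a bounded operator $\operatorname{Sym}^*(H_1^\vee)\to\operatorname{Sym}^*(H_2^\vee)$, $\psi\otimes\varphi$ corresponding to $f\mapsto\langle\varphi,f\rangle\psi$; similarly for the other pairs. Claim. The operator $A+M$ is invertible, $\mathcal A_2\circ\mathcal A_1$ is positive with $\mathcal A_2\circ\mathcal A_1-I$ trace class, the Cayley transforms, the vectors $\mathcal E(C(\cdot))$ of $\mathcal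 A_1,\mathcal A_2,\mathcal A_2\circ\mathcal A_1$ and the corresponding operators, and the Fredholm determinants below are well defined, the determinants are positive, and as operators $\operatorname{Sym}^*(H_1^\vee)\to\operatorname{Sym}^*(H_3^\vee)$ $$\mathcal E(C(\mathcal A_2))\circ\mathcal E(C(\mathcal A_1))=c(\mathcal A_2,\mathcal A_1)\,\mathcal E(C(\mathcal A_2\circ\mathcal A_1)),$$ $$c(\mathcal A_2,\mathcal A_1)=\frac{\det(\mathcal A_1)^{1/4}\det(\mathcal A_2)^{1/4}}{\det\bigl(\frac{A+M}2\bigr)^{1/2}\det(\mathcal A_2\circ\mathcal A_1)^{1/4}}\cdot\frac{\|\mathcal E(C(\mathcal A_1))\|\,\|\mathcal E(C(\mathcal A_2))\|}{\|\mathcal E(C(\mathcal A_2\circ\mathcal A_1))\|},$$ where $\det$ is the Fredholm determinant and the norms are those of the Fock spaces. -/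

import Mathlib

open scoped InnerProductSpace

noncomputable section

namespace FreeField

/-! ## Positive operators, trace class operators, Fredholm determinants, Cayley transform -/

section Operators

variable {H : Type*} [NormedAddCommGroup H] [InnerProductSpace ℝ H]

/-- A continuous operator on a real Hilbert space is positive if it is symmetric and
`⟪A x, x⟫ > 0` for all `x ≠ 0`. -/
def IsPositiveOperator (A : H →L[ℝ] H) : Prop :=
  (∀ x y : H, ⟪A x, y⟫_ℝ = ⟪x, A y⟫_ℝ) ∧ ∀ x : H, x ≠ 0 → 0 < ⟪A x, x⟫_ℝ

/-- Trace class operators, as the operators `x ↦ ∑ₙ ⟪uₙ, x⟫ vₙ` with `∑ₙ ‖uₙ‖ ‖vₙ‖ < ∞`. -/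
def IsTraceClass (K : H →L[ℝ] H) : Prop :=
  ∃ u v : ℕ → H, (Summable fun n => ‖u n‖ * ‖v n‖) ∧
    ∀ x : H, HasSum (fun n => ⟪u n, x⟫_ℝ • v n) (K x)

/-- The determinant of the compression `P_F A|_F` of `A` to a finite dimensional subspace `F`. -/
def compressionDet (A : H →L[ℝ] H) (F : {F : Submodule ℝ H // FiniteDimensional ℝ F}) : ℝ :=
  haveI : FiniteDimensional ℝ F.1 := F.2
  LinearMap.det
    ((F.1.orthogonalProjectionOnto ∘L A ∘L F.1.subtypeL : F.1 →L[ℝ] F.1) : F.1 →ₗ[ℝ] F.1)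

/-- `A` has Fredholm determinant `d`: the determinants of its compressions to finite dimensional
subspaces `F` converge to `d` along the directed set of all such `F`. If `A - I` is trace class,
`P_F (A - I) P_F` tends to `A - I` in the trace norm, and the limit is the value at `A` of the
unique trace norm continuous extension of the determinant of finite rank perturbations of `I`. -/
def HasFredholmDet (A : H →L[ℝ] H) (d : ℝ) : Prop :=
  Filter.Tendsto (compressionDet A) Filter.atTop (nhds d)

/-- The Fredholm determinant of an operator `A` such that `A - I` is trace class. -/
def fredholmDet (A : H →L[ℝ] H) : ℝ :=
  Filter.limUnder Filter.atTop (compressionDet A)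

/-- The Cayley transform `C(A) = (I - A)(I + A)⁻¹`. -/
def cayley (A : H →L[ℝ] H) : H →L[ℝ] H :=
  (1 - A) * Ring.inverse (1 + A)

end Operators

/-! ## Block operators on orthogonal direct sums and their composition -/

section Blocks

/-- The Hilbert space direct sum `E ⊕ F`. -/
abbrev DirSum (E F : Type*) : Type _ := WithLp 2 (E × F)

variable {E F : Type*} [NormedAddCommGroup E] [InnerProductSpace ℝ E]
  [NormedAddCommGroup F] [InnerProductSpace ℝ F]

/-- The inclusion `E → E ⊕ F`. -/
def incl₁ (E F : Type*) [NormedAddCommGroup E] [InnerProductSpace ℝ E]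
    [NormedAddCommGroup F] [InnerProductSpace ℝ F] : E →L[ℝ] DirSum E F :=
  ((WithLp.prodContinuousLinearEquiv 2 ℝ E F).symm : E × F →L[ℝ] DirSum E F) ∘L
    ContinuousLinearMap.inl ℝ E F

/-- The inclusion `F → E ⊕ F`. -/
def incl₂ (E F : Type*) [NormedAddCommGroup E] [InnerProductSpace ℝ E]
    [NormedAddCommGroup F] [InnerProductSpace ℝ F] : F →L[ℝ] DirSum E F :=
  ((WithLp.prodContinuousLinearEquiv 2 ℝ E F).symm : E × F →L[ℝ] DirSum E F) ∘L
    ContinuousLinearMap.inr ℝ E F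

/-- The upper left block of an operator on `E ⊕ F`. -/
def block₁₁ (A : DirSum E F →L[ℝ] DirSum E F) : E →L[ℝ] E :=
  WithLp.fstL 2 ℝ E F ∘L A ∘L incl₁ E F

/-- The upper right block of an operator on `E ⊕ F`. -/
def block₁₂ (A : DirSum E F →L[ℝ] DirSum E F) : F →L[ℝ] E :=
  WithLp.fstL 2 ℝ E F ∘L A ∘L incl₂ E F

/-- The lower left block of an operator on `E ⊕ F`. -/
def block₂₁ (A : DirSum E F →L[ℝ] DirSum E F) : E →L[ℝ] F :=
  WithLp.sndL 2 ℝ E F ∘L A ∘L incl₁ E F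

/-- The lower right block of an operator on `E ⊕ F`. -/
def block₂₂ (A : DirSum E F →L[ℝ] DirSum E F) : F →L[ℝ] F :=
  WithLp.sndL 2 ℝ E F ∘L A ∘L incl₂ E F

/-- The operator on `E ⊕ F` with the given blocks. -/
def ofBlocks (a : E →L[ℝ] E) (b : F →L[ℝ] E) (c : E →L[ℝ] F) (d : F →L[ℝ] F) :
    DirSum E F →L[ℝ] DirSum E F :=
  incl₁ E F ∘L (a ∘L WithLp.fstL 2 ℝ E F + b ∘L WithLp.sndL 2 ℝ E F) +
    incl₂ E F ∘L (c ∘L WithLp.fstL 2 ℝ E F + d ∘L WithLp.sndL 2 ℝ E F)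

variable {H₁ H₂ H₃ : Type*} [NormedAddCommGroup H₁] [InnerProductSpace ℝ H₁]
  [NormedAddCommGroup H₂] [InnerProductSpace ℝ H₂]
  [NormedAddCommGroup H₃] [InnerProductSpace ℝ H₃]

/-- The operator `A + M` on `H₂`, for `𝒜₁ = [A B; Bᵗ D]` and `𝒜₂ = [K L; Lᵗ M]`. -/
def gluing (𝒜₂ : DirSum H₃ H₂ →L[ℝ] DirSum H₃ H₂) (𝒜₁ : DirSum H₂ H₁ →L[ℝ] DirSum H₂ H₁) :
    H₂ →L[ℝ] H₂ :=
  block₁₁ 𝒜₁ + block₂₂ 𝒜₂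

/-- The composition `𝒜₂ ∘ 𝒜₁` of `𝒜₁ = [A B; Bᵗ D]` and `𝒜₂ = [K L; Lᵗ M]`, the operator
`[K - L(A+M)⁻¹Lᵗ, -L(A+M)⁻¹B; -Bᵗ(A+M)⁻¹Lᵗ, D - Bᵗ(A+M)⁻¹B]` on `H₃ ⊕ H₁`. -/
def blockComp (𝒜₂ : DirSum H₃ H₂ →L[ℝ] DirSum H₃ H₂)
    (𝒜₁ : DirSum H₂ H₁ →L[ℝ] DirSum H₂ H₁) : DirSum H₃ H₁ →L[ℝ] DirSum H₃ H₁ :=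
  ofBlocks
    (block₁₁ 𝒜₂ - block₁₂ 𝒜₂ ∘L Ring.inverse (gluing 𝒜₂ 𝒜₁) ∘L block₂₁ 𝒜₂)
    (-(block₁₂ 𝒜₂ ∘L Ring.inverse (gluing 𝒜₂ 𝒜₁) ∘L block₁₂ 𝒜₁))
    (-(block₂₁ 𝒜₁ ∘L Ring.inverse (gluing 𝒜₂ 𝒜₁) ∘L block₂₁ 𝒜₂))
    (block₂₂ 𝒜₁ - block₂₁ 𝒜₁ ∘L Ring.inverse (gluing 𝒜₂ 𝒜₁) ∘L block₁₂ 𝒜₁)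

end Blocks

/-! ## The Bosonic Fock space

`(H^∨)^{⊗n}` is realised as the space of Hilbert-Schmidt `n`-linear forms on `H`, and
`Sym^n(H^∨)` as its subspace of symmetric forms. -/

section Fock

/-- Continuous `n`-linear forms on `H`. -/
abbrev MForm (H : Type*) [NormedAddCommGroup H] [InnerProductSpace ℝ H] (n : ℕ) : Type _ :=
  ContinuousMultilinearMap ℝ (fun _ : Fin n => H) ℝ

section Basis

variable (H : Type*) [NormedAddCommGroup H] [InnerProductSpace ℝ H] [CompleteSpace H]

/-- The index set of a Hilbert basis of `H`. -/
def onbSet : Set H := (exists_hilbertBasis ℝ H).choose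

/-- A Hilbert basis of `H`. Nothing below depends on its choice, see `hsSq_eq` and
`SymPow.norm_sq_eq`. -/
def onb : HilbertBasis (onbSet H) ℝ H := (exists_hilbertBasis ℝ H).choose_spec.choose

end Basis

variable {H : Type*} [NormedAddCommGroup H] [InnerProductSpace ℝ H]

/-- The squared Hilbert-Schmidt norm of a form, computed in a Hilbert basis. -/
def hsSq {ι : Type*} (b : HilbertBasis ι ℝ H) {n : ℕ} (α : MForm H n) : ENNReal :=
  ∑' i : Fin n → ι, ENNReal.ofReal ((α fun k => b (i k)) ^ 2)

lemma parseval [CompleteSpace H] {ι : Type*} (b : HilbertBasis ι ℝ H) (f : H →L[ℝ] ℝ) :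
    ∑' i, ENNReal.ofReal ((f (b i)) ^ 2) = ENNReal.ofReal (‖f‖ ^ 2) := by
  obtain ⟨y, rfl⟩ := (InnerProductSpace.toDual ℝ H).surjective f
  have h := b.hasSum_inner_mul_inner y y
  have h' : HasSum (fun i => ⟪y, b i⟫_ℝ ^ 2) (‖y‖ ^ 2) := by
    rw [← real_inner_self_eq_norm_sq]
    refine h.congr_fun ?_
    intro i
    rw [real_inner_comm y (b i), sq]
  simp only [InnerProductSpace.toDual_apply_apply, LinearIsometryEquiv.norm_map]
  rw [← ENNReal.ofReal_tsum_of_nonneg (fun i => sq_nonneg _) h'.summable, h'.tsum_eq]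

lemma hsSq_succ {ι : Type*} (b : HilbertBasis ι ℝ H) {n : ℕ} (α : MForm H (n + 1)) :
    hsSq b α = ∑' i, hsSq b (α.curryLeft (b i)) := by
  unfold hsSq
  rw [← (Fin.consEquiv fun _ : Fin (n + 1) => ι).tsum_eq, ENNReal.tsum_prod']
  refine tsum_congr fun i => tsum_congr fun j => ?_
  rw [ContinuousMultilinearMap.curryLeft_apply]
  congr 3
  funext k
  refine Fin.cases ?_ (fun k => ?_) k <;> simp [Fin.consEquiv]

/-- The Hilbert-Schmidt norm does not depend on the basis. -/
lemma hsSq_eq [CompleteSpace H] {ι ι' : Type*} (b : HilbertBasis ι ℝ H)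
    (b' : HilbertBasis ι' ℝ H) {n : ℕ} (α : MForm H n) : hsSq b α = hsSq b' α := by
  induction n with
  | zero =>
    unfold hsSq
    rw [tsum_eq_single (default : Fin 0 → ι) (fun i hi => (hi (Subsingleton.elim _ _)).elim),
      tsum_eq_single (default : Fin 0 → ι') (fun i hi => (hi (Subsingleton.elim _ _)).elim)]
    congr 3
    exact Subsingleton.elim _ _
  | succ n ih =>
    rw [hsSq_succ, hsSq_succ]
    simp_rw [ih]
    unfold hsSq
    rw [ENNReal.tsum_comm, ENNReal.tsum_comm (α := ι')]
    refine tsum_congr fun j => ?_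
    exact (parseval b ((ContinuousMultilinearMap.apply ℝ (fun _ : Fin n => H) ℝ
      fun k => b' (j k)) ∘L α.curryLeft)).trans (parseval b' _).symm

/-- A continuous multilinear form that vanishes on the tuples of basis vectors is zero. -/
lemma form_ext [CompleteSpace H] {ι : Type*} (b : HilbertBasis ι ℝ H) {n : ℕ} (α : MForm H n)
    (h : ∀ i : Fin n → ι, (α fun k => b (i k)) = 0) : α = 0 := by
  induction n with
  | zero =>
    ext x
    rw [Subsingleton.elim x fun k => b (Fin.elim0 k)]
    exact h _
  | succ n ih =>
    have h0 : α.curryLeft = 0 := by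
      refine ContinuousLinearMap.ext_on (s := Set.range b) ?_ ?_
      · have := b.dense_span
        rw [Submodule.dense_iff_topologicalClosure_eq_top]
        exact this
      · rintro _ ⟨i, rfl⟩
        refine ih _ fun j => ?_
        rw [ContinuousMultilinearMap.curryLeft_apply, ← h (Fin.cons i j)]
        congr 1
        funext k
        refine Fin.cases ?_ (fun k => ?_) k <;> simp
    ext x
    have := congrArg (fun f => f (x 0) (Fin.tail x)) h0
    simpa using this

variable (H) in
/-- The symmetric Hilbert-Schmidt `n`-linear forms on `H`, as a vector space. -/
def symForms [CompleteSpace H] (n : ℕ) : Submodule ℝ (MForm H n) where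
  carrier := {α | (∀ (σ : Equiv.Perm (Fin n)) (x : Fin n → H), α (fun k => x (σ k)) = α x) ∧
    Memℓp (fun i : Fin n → onbSet H => α fun k => onb H (i k)) 2}
  add_mem' := fun ha hb => ⟨fun σ x => by simp [ha.1 σ x, hb.1 σ x], ha.2.add hb.2⟩
  zero_mem' := ⟨fun _ _ => rfl, zero_memℓp⟩
  smul_mem' := fun c _ ha => ⟨fun σ x => by simp [ha.1 σ x], ha.2.const_smul c⟩

variable (H) in
/-- The Hilbert space `Sym^n(H^∨)`: symmetric Hilbert-Schmidt `n`-linear forms on `H`, with the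
Hilbert-Schmidt inner product `⟪α, β⟫ = ∑ᵢ α(e_{i₁}, …, e_{iₙ}) β(e_{i₁}, …, e_{iₙ})`, which is the
inner product of `(H^∨)^{⊗n}`. -/
def SymPow [CompleteSpace H] (n : ℕ) : Type _ := symForms H n

namespace SymPow

variable [CompleteSpace H] {n : ℕ}

instance : AddCommGroup (SymPow H n) := inferInstanceAs (AddCommGroup (symForms H n))

instance : Module ℝ (SymPow H n) := inferInstanceAs (Module ℝ (symForms H n))

/-- The underlying form of an element of `Sym^n(H^∨)`. -/
def form (α : SymPow H n) : MForm H n := Subtype.val (p := (· ∈ symForms H n)) α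

variable (H n) in
/-- The coefficients of a form in a Hilbert basis. -/
def coeffs : SymPow H n →ₗ[ℝ] lp (fun _ : Fin n → onbSet H => ℝ) 2 where
  toFun α := ⟨fun i => form α fun k => onb H (i k),
    (Subtype.property (p := (· ∈ symForms H n)) α).2⟩
  map_add' _ _ := rfl
  map_smul' _ _ := rfl

lemma coeffs_injective : Function.Injective (coeffs H n) := by
  rw [← LinearMap.ker_eq_bot, LinearMap.ker_eq_bot']
  intro α h
  refine Subtype.ext (form_ext (onb H) (form α) fun i => ?_)
  exact congrArg (fun f : lp (fun _ : Fin n → onbSet H => ℝ) 2 => f i) h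

instance : NormedAddCommGroup (SymPow H n) :=
  NormedAddCommGroup.induced (SymPow H n) (lp (fun _ : Fin n → onbSet H => ℝ) 2) (coeffs H n)
    coeffs_injective

instance : InnerProductSpace ℝ (SymPow H n) where
  norm_smul_le r α := by
    change ‖coeffs H n (r • α)‖ ≤ ‖r‖ * ‖coeffs H n α‖
    rw [map_smul]
    exact norm_smul_le _ _
  inner α β := ⟪coeffs H n α, coeffs H n β⟫_ℝ
  norm_sq_eq_re_inner α := norm_sq_eq_re_inner (𝕜 := ℝ) (coeffs H n α)
  conj_inner_symm α β := inner_conj_symm (𝕜 := ℝ) (coeffs H n α) (coeffs H n β)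
  add_left α β γ := by rw [map_add, inner_add_left]
  smul_left α β r := by rw [map_smul, inner_smul_left]

/-- The squared norm is the squared Hilbert-Schmidt norm, in any Hilbert basis. -/
lemma norm_sq_eq {ι : Type*} (b : HilbertBasis ι ℝ H) (α : SymPow H n) :
    ENNReal.ofReal (‖α‖ ^ 2) = hsSq b α.form := by
  rw [hsSq_eq b (onb H)]
  have h := lp.norm_rpow_eq_tsum (p := 2) (by simp) (coeffs H n α)
  have hm := (memℓp_gen_iff (p := 2) (by simp)).1 (coeffs H n α).2
  simp only [ENNReal.toReal_ofNat, Real.rpow_ofNat, Real.norm_eq_abs, sq_abs] at h hm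
  change ENNReal.ofReal (‖coeffs H n α‖ ^ 2) = _
  rw [h, ENNReal.ofReal_tsum_of_nonneg (fun _ => sq_nonneg _) hm]
  rfl

end SymPow

variable (H) in
/-- The Bosonic Fock space `Sym^*(H^∨)`, the Hilbert space direct sum of all `Sym^n(H^∨)`. -/
abbrev Fock [CompleteSpace H] : Type _ := lp (fun n : ℕ => SymPow H n) 2

/-- The form `x ↦ ⟪h₁, x₁⟫ ⋯ ⟪hₙ, xₙ⟫`, i.e. the tensor `h₁ ⊗ ⋯ ⊗ hₙ`. -/
def tensorForm {n : ℕ} (h : Fin n → H) : MForm H n :=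
  (ContinuousMultilinearMap.mkPiAlgebra ℝ (Fin n) ℝ).compContinuousLinearMap
    fun k => innerSL ℝ (h k)

lemma tensorForm_apply {n : ℕ} (h x : Fin n → H) :
    tensorForm h x = ∏ k, ⟪h k, x k⟫_ℝ := by
  simp [tensorForm]

lemma tensorForm_memlp [CompleteSpace H] {n : ℕ} (h : Fin n → H) :
    Memℓp (fun i : Fin n → onbSet H => tensorForm h fun k => onb H (i k)) 2 := by
  rw [memℓp_gen_iff (by simp)]
  simp only [tensorForm_apply, ENNReal.toReal_ofNat, Real.rpow_ofNat, Real.norm_eq_abs, sq_abs]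
  induction n with
  | zero => exact Summable.of_finite
  | succ n ih =>
    rw [← (Fin.consEquiv fun _ : Fin (n + 1) => onbSet H).summable_iff]
    have h0 : Summable fun i => ⟪h 0, onb H i⟫_ℝ ^ 2 := by
      refine ((onb H).summable_inner_mul_inner (h 0) (h 0)).congr fun i => ?_
      rw [real_inner_comm (h 0) (onb H i), sq]
    refine (h0.mul_of_nonneg (ih fun k => h k.succ) (fun _ => sq_nonneg _)
      (fun _ => sq_nonneg _)).congr fun i => ?_
    simp [Fin.consEquiv, Fin.prod_univ_succ, mul_pow]

/-- The symmetric product `h₁ ⋯ hₙ = (n!)^{-1/2} ∑_σ h_{σ(1)} ⊗ ⋯ ⊗ h_{σ(n)}` in `Sym^n(H^∨)`,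
where `h ∈ H` stands for `⟪h, ·⟫ ∈ H^∨`. -/
def symProd [CompleteSpace H] {n : ℕ} (h : Fin n → H) : SymPow H n :=
  ⟨(√(n.factorial : ℝ))⁻¹ • ∑ σ : Equiv.Perm (Fin n), tensorForm fun k => h (σ k), by
    refine Submodule.smul_mem _ _ ⟨fun τ x => ?_, ?_⟩
    · simp only [_root_.sum_apply, tensorForm_apply]
      refine Fintype.sum_equiv (Equiv.mulRight τ⁻¹) _ _ fun σ => ?_
      exact Fintype.prod_equiv τ _ _ fun k => by simp
    · have := Memℓp.finsetSum (p := 2) (s := (Finset.univ : Finset (Equiv.Perm (Fin n))))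
        (f := fun σ (i : Fin n → onbSet H) => tensorForm (fun k => h (σ k)) fun k => onb H (i k))
        fun σ _ => tensorForm_memlp _
      simpa only [_root_.sum_apply] using this⟩

/-- The symmetric product `h₁ ⋯ hₙ` as a vector of the Fock space. -/
def symVec [CompleteSpace H] {n : ℕ} (h : Fin n → H) : Fock H := lp.single 2 n (symProd h)

/-! ### The symmetric product of forms and the vectors `Exp(½ S(T))` -/

lemma update_castAdd {X : Type*} {p q : ℕ} [DecidableEq (Fin (p + q))] (x : Fin (p + q) → X)
    (i : Fin p) (u : X) :
    (fun k => Function.update x (Fin.castAdd q i) u (Fin.castAdd q k)) =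
      Function.update (fun k => x (Fin.castAdd q k)) i u ∧
    (fun k => Function.update x (Fin.castAdd q i) u (Fin.natAdd p k)) =
      fun k => x (Fin.natAdd p k) := by
  constructor
  · exact Function.update_comp_eq_of_injective x (Fin.castAdd_injective p q) i u
  · funext k
    exact Function.update_of_ne (by simp [Fin.ext_iff]; omega) _ _

lemma update_natAdd {X : Type*} {p q : ℕ} [DecidableEq (Fin (p + q))] (x : Fin (p + q) → X)
    (j : Fin q) (u : X) :
    (fun k => Function.update x (Fin.natAdd p j) u (Fin.castAdd q k)) =
      (fun k => x (Fin.castAdd q k)) ∧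
    (fun k => Function.update x (Fin.natAdd p j) u (Fin.natAdd p k)) =
      Function.update (fun k => x (Fin.natAdd p k)) j u := by
  constructor
  · funext k
    exact Function.update_of_ne (by simp [Fin.ext_iff]; omega) _ _
  · exact Function.update_comp_eq_of_injective x (Fin.natAdd_injective q p) j u

/-- The form `α ⊗ β`. -/
def tensorMul {p q : ℕ} (α : MForm H p) (β : MForm H q) : MForm H (p + q) where
  toFun x := α (fun i => x (Fin.castAdd q i)) * β (fun j => x (Fin.natAdd p j))
  map_update_add' := by
    intro _ x i u v
    refine Fin.addCases (fun i => ?_) (fun j => ?_) i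
    · simp only [(update_castAdd x i _).1, (update_castAdd x i _).2,
        ContinuousMultilinearMap.map_update_add, add_mul]
    · simp only [(update_natAdd x j _).1, (update_natAdd x j _).2,
        ContinuousMultilinearMap.map_update_add, mul_add]
  map_update_smul' := by
    intro _ x i u v
    refine Fin.addCases (fun i => ?_) (fun j => ?_) i
    · simp only [(update_castAdd x i _).1, (update_castAdd x i _).2,
        ContinuousMultilinearMap.map_update_smul, smul_eq_mul, mul_assoc]
    · simp only [(update_natAdd x j _).1, (update_natAdd x j _).2,
        ContinuousMultilinearMap.map_update_smul, smul_eq_mul, mul_left_comm]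
  cont := by fun_prop

/-- The product `Sym^p(H^∨) × Sym^q(H^∨) → Sym^{p+q}(H^∨)` with
`(h₁ ⋯ h_p) · (k₁ ⋯ k_q) = h₁ ⋯ h_p k₁ ⋯ k_q`: if `n = p + q`, the form `α · β` is
`√(n! / (p! q!))` times the symmetrisation `(1 / n!) ∑_σ σ(α ⊗ β)`. -/
def symMul {p q : ℕ} (α : MForm H p) (β : MForm H q) : MForm H (p + q) :=
  (√((p + q).factorial / (p.factorial * q.factorial) : ℝ) * ((p + q).factorial : ℝ)⁻¹) •
    ∑ σ : Equiv.Perm (Fin (p + q)), (tensorMul α β).domDomCongr σ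

/-- The element `S(T) = ∑ᵢⱼ ⟪T eᵢ, eⱼ⟫ eᵢ · eⱼ` of `Sym^2(H^∨)` (the quadratic polynomial
`x ↦ ⟪T x, x⟫`) for a symmetric operator `T`. As
`eᵢ · eⱼ = (eᵢ ⊗ eⱼ + eⱼ ⊗ eᵢ) / √2`, the corresponding form is `√2 ⟪T u, v⟫`. -/
def quadForm (T : H →L[ℝ] H) : MForm H 2 where
  toFun x := √2 * ⟪T (x 0), x 1⟫_ℝ
  map_update_add' := by
    intro _ x i u v
    fin_cases i <;> simp [inner_add_left, inner_add_right, mul_add]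
  map_update_smul' := by
    intro _ x i u v
    fin_cases i <;> simp [inner_smul_left, inner_smul_right] <;> ring
  cont := by fun_prop

/-- The powers of an element of `Sym^2(H^∨)`. -/
def quadPow (α : MForm H 2) : (n : ℕ) → MForm H (2 * n)
  | 0 => ContinuousMultilinearMap.constOfIsEmpty ℝ (fun _ : Fin 0 => H) (1 : ℝ)
  | n + 1 => symMul (quadPow α n) α

/-- The component of degree `N` of `Exp(½ S(T)) = ∑ₙ (½ S(T))^n / n!`: it is
`(½ S(T))^n / n!` if `N = 2 n`, and zero if `N` is odd. -/
def expForm (T : H →L[ℝ] H) (N : ℕ) : MForm H N :=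
  if h : 2 * (N / 2) = N then
    (((N / 2).factorial : ℝ)⁻¹ • quadPow ((1 / 2 : ℝ) • quadForm T) (N / 2)).domDomCongr
      (finCongr h)
  else 0

/-- `Φ` is the vector `ℰ(T) = Exp(½ S(T))` of the Fock space. -/
def IsExpVector [CompleteSpace H] (T : H →L[ℝ] H) (Φ : Fock H) : Prop :=
  ∀ N : ℕ, (Φ N).form = expForm T N

open Classical in
/-- The vector `ℰ(T) = Exp(½ S(T))` of the Fock space (zero if the series is not in the Fock
space). -/
def expVector [CompleteSpace H] (T : H →L[ℝ] H) : Fock H :=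
  if h : ∃ Φ : Fock H, IsExpVector T Φ then h.choose else 0

/-! ### Vectors of `Sym^*((H₂ ⊕ H₁)^∨)` as operators -/

variable {H₁ H₂ : Type*} [NormedAddCommGroup H₁] [InnerProductSpace ℝ H₁] [CompleteSpace H₁]
  [NormedAddCommGroup H₂] [InnerProductSpace ℝ H₂] [CompleteSpace H₂]

/-- `T` is the operator identified with the vector `Φ` under
`Sym^*(H₂^∨ ⊕ H₁^∨) = Sym^*(H₂^∨) ⊗ Sym^*(H₁^∨)`, where the product
`u₁ ⋯ u_p · v₁ ⋯ v_q` with `uᵢ ∈ H₂`, `vⱼ ∈ H₁` is identified with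
`(u₁ ⋯ u_p) ⊗ (v₁ ⋯ v_q)`, and `ψ ⊗ φ` with the operator `f ↦ ⟪φ, f⟫ ψ`. In other words
`⟪g, T f⟫ = ⟪g ⊗ f, Φ⟫` for all products of vectors `g` and `f`, which span dense subspaces. -/
def IsOperatorOf (Φ : Fock (DirSum H₂ H₁)) (T : Fock H₁ →L[ℝ] Fock H₂) : Prop :=
  ∀ (p q : ℕ) (u : Fin p → H₂) (v : Fin q → H₁),
    ⟪symVec u, T (symVec v)⟫_ℝ =
      ⟪symVec (Fin.append (fun i => incl₁ H₂ H₁ (u i)) (fun j => incl₂ H₂ H₁ (v j))), Φ⟫_ℝ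

open Classical in
/-- The operator `Sym^*(H₁^∨) → Sym^*(H₂^∨)` identified with a vector of
`Sym^*(H₂^∨ ⊕ H₁^∨)`. -/
def fockOperator (Φ : Fock (DirSum H₂ H₁)) : Fock H₁ →L[ℝ] Fock H₂ :=
  if h : ∃ T : Fock H₁ →L[ℝ] Fock H₂, IsOperatorOf Φ T then h.choose else 0

end Fock

end FreeField

end

/-! Everything is tested on the coherent vectors `expo x = ∑ xⁿ / n!`. They satisfy `⟪expo x, expo
y⟫ = exp ⟪x, y⟫`, they are total, and pairing with them turns `ℰ(T)` into the Gaussian `exp (½ ⟪T x,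
x⟫)`. Because `exp` turns orthogonal sums into products, a vector `Φ` over `H₂ ⊕ H₁` is the same
thing as the operator with kernel `⟪expo x, T (expo y)⟫ = ⟪expo (x + y), Φ⟫`. The composition law is
therefore an identity between kernels.

The kernel of the product at `(u, v)` is the inner product of the adjoint of `ℰ(C(𝒜₂))` applied to
`expo u` with `ℰ(C(𝒜₁))` applied to `expo v`. Up to scalars, both are Gaussian vectors, with
generating functions `exp (½ ⟪Z x, x⟫ + ⟪a, x⟫)` and `exp (½ ⟪P x, x⟫ + ⟪b, x⟫)`. `IsGaussian.inner`
evaluates their inner product as `det (1 - Z P)^(-1/2) exp (½ (⟪a, s⟫ + ⟪b, t⟫))`, where `t = a + Z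
s` and `s = b + P t`. On a finite-dimensional subspace this is a Gaussian integral in `L²`, carried
to the Fock space by comparing Gram matrices; the general case is the limit over all
finite-dimensional subspaces.

The exponent is the right one because the Cayley transform linearises gluing
(`exists_cayley_blockComp_pair`): if `𝒜₂ (x, h) = (k, m)` and `𝒜₁ (h, y) = (-m, n)`, then `s = h +
m` and `t = h - m` solve exactly these two equations.

For the constant, `‖ℰ(C(𝒜))‖² = det (1 - C(𝒜)²)^(-1/2) = det ((1 + 𝒜)/2) / det(𝒜)^(1/2)`, so the
fourth roots in `c` cancel. What remains is `fredholmDet_composition`, an identity obtained from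
Schur complements and Jacobi's complementary minor formula. The required determinant calculus rests
on expanding `det (1 + K)` in principal minors of `⟪uᵢ, vⱼ⟫`, which a Hadamard bound makes
absolutely convergent. Finally, a strictly positive nuclear perturbation of the identity is
coercive, by the Fredholm alternative; this supplies all inverses and makes the Cayley transforms
strict contractions. -/

open scoped InnerProductSpace

noncomputable section

namespace FreeField

/-! ### Evaluation of forms by elementary tensors; completeness of the symmetric powers. -/

section Reproducing

variable {H : Type*} [NormedAddCommGroup H] [InnerProductSpace ℝ H]

/-- Pairing with an elementary tensor evaluates a form with square summable coefficients. -/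
lemma hasSum_tensorForm_mul {ι : Type*} (b : HilbertBasis ι ℝ H) {n : ℕ} (α : MForm H n)
    (hα : Summable fun i : Fin n → ι => (α fun k => b (i k)) ^ 2) (u : Fin n → H)
    (hu : Summable fun i : Fin n → ι => (tensorForm u fun k => b (i k)) ^ 2) :
    HasSum (fun i : Fin n → ι => (tensorForm u fun k => b (i k)) * α fun k => b (i k)) (α u) := by
  have hs : Summable fun i : Fin n → ι =>
      (tensorForm u fun k => b (i k)) * α fun k => b (i k) := by
    refine Summable.of_norm_bounded (hu.add hα) fun i => ?_
    rw [Real.norm_eq_abs, abs_le]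
    constructor <;>
    nlinarith [sq_nonneg ((tensorForm u fun k => b (i k)) + α fun k => b (i k)),
      sq_nonneg ((tensorForm u fun k => b (i k)) - α fun k => b (i k))]
  induction n with
  | zero =>
    have := hasSum_fintype fun i : Fin 0 → ι => (tensorForm u fun k => b (i k)) * α fun k => b (i k)
    convert this using 1
    simp only [tensorForm_apply, Finset.univ_eq_empty, Finset.prod_empty, one_mul,
      Finset.univ_unique, Finset.sum_singleton]
    congr 1
    exact Subsingleton.elim _ _
  | succ n ih =>
    have e1 : ∀ p : ι × (Fin n → ι),
        (fun k => b ((Fin.consEquiv fun _ : Fin (n + 1) => ι) p k)) =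
          Fin.cons (b p.1) (fun k => b (p.2 k)) := by
      intro p
      funext k
      refine Fin.cases ?_ (fun k => ?_) k <;> simp [Fin.consEquiv]
    have e2 : ∀ p : ι × (Fin n → ι),
        (tensorForm u (Fin.cons (b p.1) (fun k => b (p.2 k))) : ℝ) =
          ⟪u 0, b p.1⟫_ℝ * tensorForm (Fin.tail u) (fun k => b (p.2 k)) := by
      intro p
      simp [tensorForm_apply, Fin.prod_univ_succ, Fin.tail]
    have hs' := (Fin.consEquiv fun _ : Fin (n + 1) => ι).summable_iff.2 hs
    have hα' := (Fin.consEquiv fun _ : Fin (n + 1) => ι).summable_iff.2 hα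
    rw [← (Fin.consEquiv fun _ : Fin (n + 1) => ι).hasSum_iff]
    simp only [Function.comp_def, e1, e2] at hs' hα' ⊢
    -- Square summability of the tail cannot be read off from `hu`, since `u 0` may vanish; it is
    -- proved directly for all elementary tensors.
    have hu' : ∀ v : Fin n → H, Summable fun i : Fin n → ι =>
        (tensorForm v fun k => b (i k)) ^ 2 := by
      intro v
      have hv : Summable fun i : Fin n → ι => ∏ k, ⟪v k, b (i k)⟫_ℝ ^ 2 := by
        clear * -
        induction n with
        | zero => exact Summable.of_finite
        | succ n ih =>
          rw [← (Fin.consEquiv fun _ : Fin (n + 1) => ι).summable_iff]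
          have h0 : Summable fun i => ⟪v 0, b i⟫_ℝ ^ 2 := by
            refine (b.summable_inner_mul_inner (v 0) (v 0)).congr fun i => ?_
            rw [real_inner_comm (v 0) (b i), sq]
          refine (h0.mul_of_nonneg (ih fun k => v k.succ) (fun _ => sq_nonneg _)
            (fun _ => Finset.prod_nonneg fun _ _ => sq_nonneg _)).congr fun i => ?_
          simp [Fin.consEquiv, Fin.prod_univ_succ]
      refine hv.congr fun i => ?_
      rw [tensorForm_apply, Finset.prod_pow]
    have inner : ∀ i, HasSum (fun j : Fin n → ι => ⟪u 0, b i⟫_ℝ *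
        tensorForm (Fin.tail u) (fun k => b (j k)) * α (Fin.cons (b i) fun k => b (j k)))
        (⟪u 0, b i⟫_ℝ * α (Fin.cons (b i) (Fin.tail u))) := by
      intro i
      have h1 : Summable fun j : Fin n → ι => ((α.curryLeft (b i)) fun k => b (j k)) ^ 2 := by
        simpa using hα'.prod_factor i
      have h2 := ih (α.curryLeft (b i)) h1 (Fin.tail u) (hu' _) (by
        refine Summable.of_norm_bounded ((hu' (Fin.tail u)).add h1) fun i => ?_
        rw [Real.norm_eq_abs, abs_le]
        constructor <;>
        nlinarith [sq_nonneg ((tensorForm (Fin.tail u) fun k => b (i k)) +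
          (α.curryLeft (b ‹_›)) fun k => b (i k)),
          sq_nonneg ((tensorForm (Fin.tail u) fun k => b (i k)) -
          (α.curryLeft (b ‹_›)) fun k => b (i k))])
      have h3 := h2.mul_left ⟪u 0, b i⟫_ℝ
      simpa only [ContinuousMultilinearMap.curryLeft_apply, mul_assoc] using h3
    have outer : HasSum (fun i => ⟪u 0, b i⟫_ℝ * α (Fin.cons (b i) (Fin.tail u))) (α u) := by
      have := (b.hasSum_repr (u 0)).mapL
        ((ContinuousMultilinearMap.apply ℝ (fun _ : Fin n => H) ℝ (Fin.tail u)) ∘L α.curryLeft)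
      simpa [b.repr_apply_apply, real_inner_comm] using this
    -- The double series converges absolutely, so it may be summed row by row: the rows give the
    -- inductive evaluation and their sum expands `u 0` in the basis.
    have := hs'.hasSum
    have h := this.prod_fiberwise inner
    rwa [h.unique outer] at this

variable [CompleteSpace H]

namespace SymPow

variable {n : ℕ}

lemma summable_sq_form (α : SymPow H n) :
    Summable fun i : Fin n → onbSet H => (α.form fun k => onb H (i k)) ^ 2 := by
  have hm := (memℓp_gen_iff (p := 2) (by simp)).1 (coeffs H n α).2
  simp only [ENNReal.toReal_ofNat, Real.rpow_ofNat, Real.norm_eq_abs, sq_abs] at hm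
  exact hm

end SymPow

lemma summable_sq_tensorForm {n : ℕ} (u : Fin n → H) :
    Summable fun i : Fin n → onbSet H => (tensorForm u fun k => onb H (i k)) ^ 2 := by
  have hm := (memℓp_gen_iff (p := 2) (by simp)).1 (tensorForm_memlp u)
  simpa only [ENNReal.toReal_ofNat, Real.rpow_ofNat, Real.norm_eq_abs, sq_abs] using hm

lemma SymPow.form_perm {n : ℕ} (α : SymPow H n) (σ : Equiv.Perm (Fin n)) (x : Fin n → H) :
    α.form (fun k => x (σ k)) = α.form x :=
  (Subtype.property (p := (· ∈ symForms H n)) α).1 σ x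

lemma SymPow.ext_form {n : ℕ} {α β : SymPow H n} (h : α.form = β.form) : α = β :=
  Subtype.ext h

@[simp] lemma SymPow.form_smul {n : ℕ} (c : ℝ) (α : SymPow H n) : (c • α).form = c • α.form := rfl

@[simp] lemma SymPow.form_sub {n : ℕ} (α β : SymPow H n) : (α - β).form = α.form - β.form := rfl

lemma SymPow.inner_eq_tsum {n : ℕ} (α β : SymPow H n) :
    HasSum (fun i : Fin n → onbSet H => (α.form fun k => onb H (i k)) *
      β.form fun k => onb H (i k)) ⟪α, β⟫_ℝ := by
  have := lp.hasSum_inner (𝕜 := ℝ) (coeffs H n α) (coeffs H n β)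
  refine this.congr_fun fun i => ?_
  exact mul_comm _ _

lemma symProd_form {n : ℕ} (h : Fin n → H) : (symProd h).form =
    (√(n.factorial : ℝ))⁻¹ • ∑ σ : Equiv.Perm (Fin n), tensorForm fun k => h (σ k) := rfl

/-- Each of the `n!` permuted tensors evaluates the symmetric form `α` to the same number, and `n! /
√n! = √n!`. -/
lemma inner_symProd {n : ℕ} (u : Fin n → H) (α : SymPow H n) :
    ⟪symProd u, α⟫_ℝ = √(n.factorial : ℝ) * α.form u := by
  refine (SymPow.inner_eq_tsum (symProd u) α).unique ?_
  have h1 : ∀ σ : Equiv.Perm (Fin n), HasSum (fun i : Fin n → onbSet H =>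
      (tensorForm (fun k => u (σ k)) fun k => onb H (i k)) * α.form fun k => onb H (i k))
      (α.form u) := by
    intro σ
    have := hasSum_tensorForm_mul (onb H) α.form α.summable_sq_form (fun k => u (σ k))
      (summable_sq_tensorForm _)
    rwa [α.form_perm] at this
  have h2 := (hasSum_sum (s := (Finset.univ : Finset (Equiv.Perm (Fin n))))
    fun σ _ => h1 σ).mul_left (√(n.factorial : ℝ))⁻¹
  have h3 : (√(n.factorial : ℝ))⁻¹ * ∑ σ : Equiv.Perm (Fin n), α.form u =
      √(n.factorial : ℝ) * α.form u := by
    have : (0 : ℝ) < n.factorial := by positivity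
    rw [Finset.sum_const, Finset.card_univ, Fintype.card_perm, Fintype.card_fin, nsmul_eq_mul]
    have h4 := Real.mul_self_sqrt this.le
    have h5 : √(n.factorial : ℝ) ≠ 0 := by positivity
    field_simp
    rw [sq, h4]
  rw [h3] at h2
  refine h2.congr_fun fun i => ?_
  rw [symProd_form]
  simp [Finset.sum_mul, mul_assoc]

/-- Cauchy–Schwarz against the elementary tensor of `x`, whose Hilbert–Schmidt norm is exactly `∏ ‖x
k‖`. Hilbert–Schmidt convergence thus implies convergence in operator norm. -/
lemma SymPow.abs_form_le {n : ℕ} (α : SymPow H n) (x : Fin n → H) :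
    |α.form x| ≤ ‖α‖ * ∏ k, ‖x k‖ := by
  let t : lp (fun _ : Fin n → onbSet H => ℝ) 2 := ⟨_, tensorForm_memlp x⟩
  have h1 : ⟪t, SymPow.coeffs H n α⟫_ℝ = α.form x := by
    refine (lp.hasSum_inner (𝕜 := ℝ) t (SymPow.coeffs H n α)).unique ?_
    refine (hasSum_tensorForm_mul (onb H) α.form α.summable_sq_form x
      (summable_sq_tensorForm _)).congr_fun fun i => ?_
    exact mul_comm _ _
  have h2 : ‖t‖ = ∏ k, ‖x k‖ := by
    have : ⟪t, t⟫_ℝ = (∏ k, ‖x k‖) ^ 2 := by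
      refine (lp.hasSum_inner (𝕜 := ℝ) t t).unique ?_
      have := hasSum_tensorForm_mul (onb H) (tensorForm x) (summable_sq_tensorForm _) x
        (summable_sq_tensorForm _)
      rw [tensorForm_apply] at this
      simp only [real_inner_self_eq_norm_sq, Finset.prod_pow] at this
      exact this
    rw [real_inner_self_eq_norm_sq] at this
    exact (sq_eq_sq₀ (norm_nonneg _) (Finset.prod_nonneg fun _ _ => norm_nonneg _)).1 this
  rw [← h1, ← h2, mul_comm]
  exact abs_real_inner_le_norm t (SymPow.coeffs H n α)

/-- A Cauchy sequence converges both as coefficients in `ℓ²` and as forms in operator norm;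
evaluation at basis vectors identifies the two limits. Completeness of the Fock space, hence
adjoints, Riesz representation and projections, depends on this. -/
instance SymPow.instCompleteSpace {n : ℕ} : CompleteSpace (SymPow H n) := by
  refine Metric.complete_of_cauchySeq_tendsto fun a ha => ?_
  have hiso : Isometry (SymPow.coeffs H n) := AddMonoidHomClass.isometry_of_norm _ fun _ => rfl
  obtain ⟨c, hc⟩ := cauchySeq_tendsto_of_complete (hiso.uniformContinuous.comp_cauchySeq ha)
  have hform : CauchySeq fun k => (a k).form := by
    rw [Metric.cauchySeq_iff] at ha ⊢
    intro ε hε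
    obtain ⟨N, hN⟩ := ha ε hε
    refine ⟨N, fun m hm k hk => lt_of_le_of_lt ?_ (hN m hm k hk)⟩
    rw [dist_eq_norm, dist_eq_norm, ← SymPow.form_sub]
    refine ContinuousMultilinearMap.opNorm_le_bound (norm_nonneg _) fun x => ?_
    exact SymPow.abs_form_le _ x
  obtain ⟨α, hα⟩ := cauchySeq_tendsto_of_complete hform
  have hev : ∀ x, Filter.Tendsto (fun k => (a k).form x) Filter.atTop (nhds (α x)) := by
    intro x
    exact ((ContinuousMultilinearMap.apply ℝ (fun _ : Fin n => H) ℝ x).continuous.tendsto α).comp hα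
  have hcoef : (fun i : Fin n → onbSet H => α fun k => onb H (i k)) = c := by
    funext i
    refine tendsto_nhds_unique (hev _) ?_
    exact ((lp.evalCLM ℝ (fun _ : Fin n → onbSet H => ℝ) 2 i).continuous.tendsto c).comp hc
  let β : SymPow H n := ⟨α, fun σ x => tendsto_nhds_unique (hev _) <| by
    simpa only [SymPow.form_perm] using hev x, by rw [hcoef]; exact c.2⟩
  refine ⟨β, ?_⟩
  rw [hiso.isEmbedding.tendsto_nhds_iff]
  have : SymPow.coeffs H n β = c := Subtype.ext hcoef
  rw [this]
  exact hc

end Reproducing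

/-! ### Uniqueness of power series coefficients and polarisation. -/

/-- The coefficients of an everywhere convergent real power series with sum zero vanish. -/
lemma coeff_eq_zero_of_hasSum_zero {c : ℕ → ℝ} (h : ∀ s : ℝ, HasSum (fun n => c n * s ^ n) 0)
    (n : ℕ) : c n = 0 := by
  have hp : HasFPowerSeriesAt (0 : ℝ → ℝ) (FormalMultilinearSeries.ofScalars ℝ c) 0 := by
    refine ⟨1, ?_, by norm_num, ?_⟩
    · refine FormalMultilinearSeries.le_radius_of_summable _ (r := 1) ?_
      have := (h 1).summable.norm
      simpa [FormalMultilinearSeries.ofScalars_norm] using this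
    · intro y _
      simpa [FormalMultilinearSeries.ofScalars_apply_eq, smul_eq_mul, mul_comm] using h y
  have h0 := hp.eq_zero
  have := congrArg (fun p => p.coeff n) h0
  rw [FormalMultilinearSeries.coeff_ofScalars] at this
  exact this

lemma coeff_eq_of_hasSum {c d : ℕ → ℝ} {f : ℝ → ℝ} (hc : ∀ s : ℝ, HasSum (fun n => c n * s ^ n) (f s))
    (hd : ∀ s : ℝ, HasSum (fun n => d n * s ^ n) (f s)) (n : ℕ) : c n = d n := by
  refine sub_eq_zero.1 (coeff_eq_zero_of_hasSum_zero (c := fun n => c n - d n) (fun s => ?_) n)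
  simpa [sub_mul] using (hc s).sub (hd s)

section Polarization

variable {H : Type*} [NormedAddCommGroup H] [InnerProductSpace ℝ H]

/-- A symmetric form that vanishes on the diagonal is zero. -/
lemma form_eq_zero_of_diag {n : ℕ} (α : MForm H n)
    (hs : ∀ (σ : Equiv.Perm (Fin n)) (x : Fin n → H), α (fun k => x (σ k)) = α x)
    (hd : ∀ x : H, α (fun _ => x) = 0) : α = 0 := by
  induction n with
  | zero =>
    ext x
    rw [Subsingleton.elim x fun _ => 0]
    exact hd 0
  | succ n ih =>
    have h1 : ∀ y : H, α.curryLeft y = 0 := by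
      intro y
      refine ih _ (fun σ x => ?_) (fun x => ?_)
      · rw [ContinuousMultilinearMap.curryLeft_apply, ContinuousMultilinearMap.curryLeft_apply,
          ← hs (Equiv.Perm.decomposeFin.symm (0, σ)) (Fin.cons y x)]
        congr 1
        funext k
        refine Fin.cases ?_ (fun k => ?_) k <;> simp
      · rw [ContinuousMultilinearMap.curryLeft_apply]
        -- The function `t ↦ α (x + t y, …, x + t y)` is identically zero; by symmetry its
        -- derivative at `0` is `(n + 1) α (y, x, …, x)`.
        have hder : HasDerivAt (fun t : ℝ => α (fun _ : Fin (n + 1) => x + t • y))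
            (α.linearDeriv (fun _ => x + (0 : ℝ) • y) fun _ => y) 0 := by
          refine (α.hasFDerivAt (fun _ => x + (0 : ℝ) • y)).comp_hasDerivAt (0 : ℝ)
            (hasDerivAt_pi.2 fun i => ?_)
          simpa using ((hasDerivAt_id (0 : ℝ)).smul_const y).const_add x
        have h0 : (fun t : ℝ => α (fun _ : Fin (n + 1) => x + t • y)) = fun _ => 0 := by
          funext t
          exact hd _
        rw [h0] at hder
        have h2 := hder.unique (hasDerivAt_const (0 : ℝ) (0 : ℝ))
        rw [ContinuousMultilinearMap.linearDeriv_apply] at h2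
        have h3 : ∀ i : Fin (n + 1), α (Function.update (fun _ => x + (0 : ℝ) • y) i y) =
            α (Fin.cons y fun _ => x) := by
          intro i
          rw [← hs (Equiv.swap 0 i) (Fin.cons y fun _ => x)]
          congr 1
          funext k
          by_cases hk : k = i
          · subst hk
            simp
          · rw [Function.update_of_ne hk]
            have : Equiv.swap 0 i k ≠ 0 := by
              intro h
              apply hk
              have := congrArg (Equiv.swap 0 i) h
              simpa using this
            obtain ⟨m, hm⟩ := Fin.exists_succ_eq.2 this
            rw [← hm]
            simp
        rw [Finset.sum_congr rfl fun i _ => h3 i, Finset.sum_const, Finset.card_univ,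
          Fintype.card_fin, nsmul_eq_mul] at h2
        have : ((n + 1 : ℕ) : ℝ) ≠ 0 := by positivity
        exact (mul_eq_zero.1 h2).resolve_left this
    ext x
    have := congrArg (fun f => f (Fin.tail x)) (h1 (x 0))
    simpa using this

lemma form_eq_of_diag {n : ℕ} (α β : MForm H n)
    (hα : ∀ (σ : Equiv.Perm (Fin n)) (x : Fin n → H), α (fun k => x (σ k)) = α x)
    (hβ : ∀ (σ : Equiv.Perm (Fin n)) (x : Fin n → H), β (fun k => x (σ k)) = β x)
    (hd : ∀ x : H, α (fun _ => x) = β (fun _ => x)) : α = β :=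
  sub_eq_zero.1 <| form_eq_zero_of_diag _ (fun σ x => by simp [hα σ x, hβ σ x])
    fun x => by simp [hd]

lemma form_const_smul {n : ℕ} (α : MForm H n) (s : ℝ) (x : H) :
    α (fun _ => s • x) = α (fun _ => x) * s ^ n := by
  have := α.map_smul_univ (fun _ => s) (fun _ => x)
  simpa [mul_comm] using this

end Polarization

/-! ### Coherent vectors. -/

section Coherent

variable {H : Type*} [NormedAddCommGroup H] [InnerProductSpace ℝ H] [CompleteSpace H]

lemma inner_symVec {n : ℕ} (u : Fin n → H) (Φ : Fock H) :
    ⟪symVec u, Φ⟫_ℝ = √(n.factorial : ℝ) * (Φ n).form u := by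
  rw [symVec, lp.inner_single_left, inner_symProd]

lemma symProd_form_diag {n : ℕ} (x : H) (y : Fin n → H) :
    (symProd fun _ : Fin n => x).form y = √(n.factorial : ℝ) * ∏ k, ⟪x, y k⟫_ℝ := by
  have h4 := Real.mul_self_sqrt (Nat.cast_nonneg (α := ℝ) n.factorial)
  have h5 : √(n.factorial : ℝ) ≠ 0 := by positivity
  rw [symProd_form]
  simp only [_root_.smul_apply, tensorForm_apply,
    Finset.sum_const, Finset.card_univ, Fintype.card_perm, Fintype.card_fin, nsmul_eq_mul,
    smul_eq_mul]
  field_simp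
  rw [sq, h4]

lemma sq_norm_symProd_diag (n : ℕ) (x : H) :
    ‖(n.factorial : ℝ)⁻¹ • symProd fun _ : Fin n => x‖ ^ 2 = (‖x‖ ^ 2) ^ n / n.factorial := by
  have h4 := Real.mul_self_sqrt (Nat.cast_nonneg (α := ℝ) n.factorial)
  have h5 : (n.factorial : ℝ) ≠ 0 := by positivity
  rw [norm_smul, mul_pow, ← real_inner_self_eq_norm_sq (symProd _), inner_symProd,
    symProd_form_diag, ← mul_assoc √(n.factorial : ℝ), h4]
  simp only [real_inner_self_eq_norm_sq, Finset.prod_const, Finset.card_univ, Fintype.card_fin,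
    Real.norm_eq_abs, sq_abs]
  field_simp

/-- The exponential (coherent) vector `∑ₙ xⁿ / n!`. -/
def expo (x : H) : Fock H :=
  ⟨fun n => (n.factorial : ℝ)⁻¹ • symProd fun _ : Fin n => x, by
    refine (memℓp_gen_iff (p := 2) (by simp)).2 ?_
    simp only [ENNReal.toReal_ofNat, Real.rpow_ofNat, sq_norm_symProd_diag]
    exact Real.summable_pow_div_factorial _⟩

lemma hasSum_inner_expo (x : H) (Φ : Fock H) :
    HasSum (fun n => (√(n.factorial : ℝ))⁻¹ * (Φ n).form (fun _ => x)) ⟪expo x, Φ⟫_ℝ := by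
  refine (lp.hasSum_inner (𝕜 := ℝ) (expo x) Φ).congr_fun fun n => ?_
  symm
  change ⟪(n.factorial : ℝ)⁻¹ • symProd fun _ : Fin n => x, Φ n⟫_ℝ = _
  rw [real_inner_smul_left, inner_symProd, ← mul_assoc]
  congr 1
  have h4 := Real.mul_self_sqrt (Nat.cast_nonneg (α := ℝ) n.factorial)
  have h5 : √(n.factorial : ℝ) ≠ 0 := by positivity
  rw [← h4]
  field_simp
  rw [Real.sqrt_sq (by positivity)]

lemma hasSum_inner_expo_symVec (x : H) (Φ : Fock H) :
    HasSum (fun n => (n.factorial : ℝ)⁻¹ * ⟪symVec fun _ : Fin n => x, Φ⟫_ℝ) ⟪expo x, Φ⟫_ℝ := by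
  refine (hasSum_inner_expo x Φ).congr_fun fun n => ?_
  rw [inner_symVec, ← mul_assoc]
  congr 1
  have h4 := Real.mul_self_sqrt (Nat.cast_nonneg (α := ℝ) n.factorial)
  have h5 : √(n.factorial : ℝ) ≠ 0 := by positivity
  rw [← h4]
  field_simp
  rw [Real.sqrt_sq (by positivity)]

lemma inner_expo_expo (x y : H) : ⟪expo x, expo y⟫_ℝ = Real.exp ⟪x, y⟫_ℝ := by
  refine (hasSum_inner_expo x (expo y)).unique ?_
  have := NormedSpace.expSeries_div_hasSum_exp (𝔸 := ℝ) ⟪x, y⟫_ℝ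
  rw [← Real.exp_eq_exp_ℝ] at this
  refine this.congr_fun fun n => ?_
  change (√(n.factorial : ℝ))⁻¹ * (((n.factorial : ℝ)⁻¹ • symProd fun _ : Fin n => y).form _) = _
  rw [SymPow.form_smul, _root_.smul_apply, symProd_form_diag]
  have h5 : √(n.factorial : ℝ) ≠ 0 := by positivity
  simp only [real_inner_comm x y, Finset.prod_const, Finset.card_univ, Fintype.card_fin,
    smul_eq_mul]
  field_simp

lemma hasSum_inner_expo_smul (x : H) (Φ : Fock H) (s : ℝ) :
    HasSum (fun n => ((√(n.factorial : ℝ))⁻¹ * (Φ n).form (fun _ => x)) * s ^ n)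
      ⟪expo (s • x), Φ⟫_ℝ := by
  refine (hasSum_inner_expo (s • x) Φ).congr_fun fun n => ?_
  rw [form_const_smul, mul_assoc]

/-- The exponential vectors are total. -/
lemma eq_zero_of_inner_expo {Φ : Fock H} (h : ∀ x, ⟪expo x, Φ⟫_ℝ = 0) : Φ = 0 := by
  refine lp.ext (funext fun n => SymPow.ext_form ?_)
  refine form_eq_zero_of_diag _ (Φ n).form_perm fun x => ?_
  -- Scaling `x` by `s` separates the degrees: the pairing becomes a power series in `s` whose
  -- `n`-th coefficient is the diagonal value of the degree `n` part.
  have := coeff_eq_zero_of_hasSum_zero (fun s => by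
    have := hasSum_inner_expo_smul x Φ s
    rwa [h] at this) n
  have h5 : (√(n.factorial : ℝ))⁻¹ ≠ 0 := by positivity
  exact (mul_eq_zero.1 this).resolve_left h5

end Coherent

/-! ### The generating function of `Exp(½ S(T))`. -/

section ExpForm

variable {H : Type*} [NormedAddCommGroup H] [InnerProductSpace ℝ H]

lemma symMul_perm {p q : ℕ} (α : MForm H p) (β : MForm H q) (τ : Equiv.Perm (Fin (p + q)))
    (x : Fin (p + q) → H) : symMul α β (fun k => x (τ k)) = symMul α β x := by
  simp only [symMul, _root_.smul_apply, _root_.sum_apply,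
    ContinuousMultilinearMap.domDomCongr_apply]
  congr 1
  exact Fintype.sum_equiv (Equiv.mulLeft τ) _ _ fun σ => by simp

/-- Symmetrisation acts trivially on the diagonal, so only the normalising square root survives.
Combined with polarisation, this replaces computations with symmetric products by scalar identities.
-/
lemma symMul_diag {p q : ℕ} (α : MForm H p) (β : MForm H q) (x : H) :
    symMul α β (fun _ => x) = √((p + q).factorial / (p.factorial * q.factorial) : ℝ) *
      (α (fun _ => x) * β (fun _ => x)) := by
  simp only [symMul, _root_.smul_apply, _root_.sum_apply,
    ContinuousMultilinearMap.domDomCongr_apply, Finset.sum_const, Finset.card_univ,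
    Fintype.card_perm, Fintype.card_fin, nsmul_eq_mul, smul_eq_mul]
  have h5 : ((p + q).factorial : ℝ) ≠ 0 := by positivity
  rw [mul_assoc, inv_mul_cancel_left₀ h5]
  rfl

lemma quadPow_perm (α : MForm H 2) (n : ℕ) (τ : Equiv.Perm (Fin (2 * n)))
    (x : Fin (2 * n) → H) : quadPow α n (fun k => x (τ k)) = quadPow α n x := by
  cases n with
  | zero => rfl
  | succ n => exact symMul_perm _ _ τ x

/-- The factors `√((2n + 2)! / ((2n)! 2!))` of the successive products and the `√2` in `quadForm`
telescope to `√((2n)!)`. -/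
lemma quadPow_quadForm_diag (T : H →L[ℝ] H) (n : ℕ) (x : H) :
    quadPow ((1 / 2 : ℝ) • quadForm T) n (fun _ => x) =
      √((2 * n).factorial : ℝ) * ((1 / 2) * ⟪T x, x⟫_ℝ) ^ n := by
  induction n with
  | zero => simp [quadPow]
  | succ n ih =>
    refine (symMul_diag (quadPow ((1 / 2 : ℝ) • quadForm T) n) _ x).trans ?_
    rw [ih]
    have h2 : ((1 / 2 : ℝ) • quadForm T) (fun _ => x) = √2 * ((1 / 2) * ⟪T x, x⟫_ℝ) := by
      change (1 / 2 : ℝ) * (√2 * ⟪T x, x⟫_ℝ) = _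
      ring
    rw [h2, pow_succ, show 2 * (n + 1) = 2 * n + 2 from rfl, Real.sqrt_div (by positivity),
      Real.sqrt_mul (by positivity), Nat.factorial_two]
    have h5 : √((2 * n).factorial : ℝ) ≠ 0 := by positivity
    have h6 : √(2 : ℝ) ≠ 0 := by positivity
    push_cast
    field_simp

lemma expForm_perm (T : H →L[ℝ] H) (N : ℕ) (τ : Equiv.Perm (Fin N))
    (x : Fin N → H) : expForm T N (fun k => x (τ k)) = expForm T N x := by
  unfold expForm
  split_ifs with h
  · simp only [ContinuousMultilinearMap.domDomCongr_apply, _root_.smul_apply]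
    congr 1
    have := quadPow_perm ((1 / 2 : ℝ) • quadForm T) (N / 2)
      (((finCongr h).trans τ).trans (finCongr h).symm) (fun i => x (finCongr h i))
    simpa using this
  · rfl

lemma expForm_even_diag (T : H →L[ℝ] H) (n : ℕ) (x : H) :
    expForm T (2 * n) (fun _ => x) =
      √((2 * n).factorial : ℝ) * (((1 / 2) * ⟪T x, x⟫_ℝ) ^ n / n.factorial) := by
  unfold expForm
  have h : 2 * (2 * n / 2) = 2 * n := by omega
  have h' : 2 * n / 2 = n := by omega
  rw [dif_pos h]
  simp only [ContinuousMultilinearMap.domDomCongr_apply, _root_.smul_apply]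
  rw [quadPow_quadForm_diag, h', smul_eq_mul]
  ring

lemma expForm_odd (T : H →L[ℝ] H) (N : ℕ) (hN : N ∉ Set.range fun n : ℕ => 2 * n) :
    expForm T N = 0 := by
  unfold expForm
  rw [dif_neg]
  exact fun h => hN ⟨_, h⟩

/-- The weight `1 / √N!` coming from the coherent vector cancels the `√((2n)!)` of
`expForm_even_diag`, leaving the exponential series in the even degrees. -/
lemma hasSum_expForm_diag (T : H →L[ℝ] H) (x : H) :
    HasSum (fun N => (√(N.factorial : ℝ))⁻¹ * expForm T N (fun _ => x))
      (Real.exp ((1 / 2) * ⟪T x, x⟫_ℝ)) := by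
  have hinj : Function.Injective fun n : ℕ => 2 * n := fun a b h => by simpa using h
  rw [← hinj.hasSum_iff]
  · have := NormedSpace.expSeries_div_hasSum_exp (𝔸 := ℝ) ((1 / 2) * ⟪T x, x⟫_ℝ)
    rw [← Real.exp_eq_exp_ℝ] at this
    refine this.congr_fun fun n => ?_
    have h5 : √((2 * n).factorial : ℝ) ≠ 0 := by positivity
    simp only [Function.comp_def]
    rw [expForm_even_diag]
    field_simp
  · intro N hN
    simp [expForm_odd T N hN]

variable [CompleteSpace H]

/-- A vector whose pairings with the exponential vectors are those of `Exp(½ S(T))` is the vector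
`Exp(½ S(T))`. -/
lemma isExpVector_of_inner_expo (T : H →L[ℝ] H) (Φ : Fock H)
    (h : ∀ x, ⟪expo x, Φ⟫_ℝ = Real.exp ((1 / 2) * ⟪T x, x⟫_ℝ)) : IsExpVector T Φ := by
  intro N
  refine form_eq_of_diag _ _ (Φ N).form_perm (expForm_perm T N) fun x => ?_
  have := coeff_eq_of_hasSum (hasSum_inner_expo_smul x Φ)
    (d := fun N => (√(N.factorial : ℝ))⁻¹ * expForm T N (fun _ => x)) (fun s => by
      rw [h]
      refine (hasSum_expForm_diag T (s • x)).congr_fun fun n => ?_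
      rw [form_const_smul, mul_assoc]) N
  have h5 : (√(N.factorial : ℝ))⁻¹ ≠ 0 := by positivity
  exact mul_left_cancel₀ h5 this

lemma IsExpVector.inner_expo {T : H →L[ℝ] H} {Φ : Fock H} (h : IsExpVector T Φ) (x : H) :
    ⟪expo x, Φ⟫_ℝ = Real.exp ((1 / 2) * ⟪T x, x⟫_ℝ) := by
  refine (hasSum_inner_expo x Φ).unique ?_
  simp_rw [h _]
  exact hasSum_expForm_diag T x

lemma isExpVector_expVector {T : H →L[ℝ] H} {Φ : Fock H}
    (h : ∀ x, ⟪expo x, Φ⟫_ℝ = Real.exp ((1 / 2) * ⟪T x, x⟫_ℝ)) :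
    IsExpVector T (expVector T) := by
  have hex : ∃ Φ : Fock H, IsExpVector T Φ := ⟨Φ, isExpVector_of_inner_expo T Φ h⟩
  rw [expVector, dif_pos hex]
  exact hex.choose_spec

end ExpForm

/-! ### Binomial expansion of symmetric forms. -/

section Binomial

variable {H : Type*} [NormedAddCommGroup H] [InnerProductSpace ℝ H]

/-- The value of an `N`-form on `p` copies of `x` followed by copies of `y`. -/
def mixedValue {N : ℕ} (α : MForm H N) (x y : H) (p : ℕ) : ℝ :=
  α fun k => if (k : ℕ) < p then x else y

lemma form_piecewise_eq_mixedValue {N : ℕ} (α : MForm H N)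
    (hs : ∀ (σ : Equiv.Perm (Fin N)) (x : Fin N → H), α (fun k => x (σ k)) = α x)
    (x y : H) (S : Finset (Fin N)) :
    α (S.piecewise (fun _ => x) (fun _ => y)) = mixedValue α x y S.card := by
  have hcard : Fintype.card {k // k ∈ S} = Fintype.card {k : Fin N // (k : ℕ) < S.card} := by
    have hle : S.card ≤ N := by simpa using S.card_le_univ
    rw [Fintype.card_coe, Fintype.card_subtype, Fin.card_filter_val_lt, min_eq_right hle]
  let e := Fintype.equivOfCardEq hcard
  -- Only the number of slots holding `x` matters: this permutation moves `S` onto the first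
  -- `S.card` indices.
  let σ : Equiv.Perm (Fin N) := e.extendSubtype
  rw [mixedValue, ← hs σ (fun k => if (k : ℕ) < S.card then x else y)]
  congr 1
  funext k
  by_cases hk : k ∈ S
  · have : ((σ k : Fin N) : ℕ) < S.card := e.extendSubtype_mem k hk
    simp [hk, this]
  · have : ¬ ((σ k : Fin N) : ℕ) < S.card := e.extendSubtype_not_mem k hk
    rw [Finset.piecewise_eq_of_notMem _ _ _ hk, if_neg this]

lemma mixedValue_smul {N : ℕ} (α : MForm H N) (x y : H) (s t : ℝ) (p : ℕ) (hp : p ≤ N) :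
    mixedValue α (s • x) (t • y) p = s ^ p * t ^ (N - p) * mixedValue α x y p := by
  unfold mixedValue
  have h1 : (fun k : Fin N => if (k : ℕ) < p then s • x else t • y) =
      fun k : Fin N => (if (k : ℕ) < p then s else t) • (if (k : ℕ) < p then x else y) := by
    funext k
    split_ifs <;> rfl
  rw [h1, α.map_smul_univ, smul_eq_mul, Finset.prod_ite, Finset.prod_const, Finset.prod_const,
    Fin.card_filter_val_lt, min_eq_right hp]
  congr 3
  rw [← Finset.compl_filter, Finset.card_compl, Fintype.card_fin, Fin.card_filter_val_lt,
    min_eq_right hp]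

lemma form_add_diag {N : ℕ} (α : MForm H N)
    (hs : ∀ (σ : Equiv.Perm (Fin N)) (x : Fin N → H), α (fun k => x (σ k)) = α x) (x y : H) :
    α (fun _ => x + y) =
      ∑ pq ∈ Finset.HasAntidiagonal.antidiagonal N, (N.choose pq.1 : ℝ) * mixedValue α x y pq.1 := by
  have h1 := α.toMultilinearMap.map_add_univ (fun _ => x) (fun _ => y)
  have h2 : α (fun _ => x + y) = ∑ S : Finset (Fin N), mixedValue α x y S.card := by
    refine h1.trans (Finset.sum_congr rfl fun S _ => ?_)
    exact form_piecewise_eq_mixedValue α hs x y S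
  rw [h2, ← Finset.powerset_univ, Finset.sum_powerset_apply_card, Finset.card_univ,
    Fintype.card_fin, Finset.Nat.sum_antidiagonal_eq_sum_range_succ_mk]
  simp

end Binomial

/-! ### Operators determined by their kernels on coherent vectors. -/

section Operator

variable {H₁ H₂ : Type*} [NormedAddCommGroup H₁] [InnerProductSpace ℝ H₁] [CompleteSpace H₁]
  [NormedAddCommGroup H₂] [InnerProductSpace ℝ H₂] [CompleteSpace H₂]

lemma SymPow.abs_mixedValue_le {H : Type*} [NormedAddCommGroup H] [InnerProductSpace ℝ H]
    [CompleteSpace H] {N : ℕ} (α : SymPow H N) (x y : H) (p : ℕ) (hp : p ≤ N) :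
    |mixedValue α.form x y p| ≤ ‖α‖ * (‖x‖ ^ p * ‖y‖ ^ (N - p)) := by
  refine (α.abs_form_le _).trans (le_of_eq ?_)
  congr 1
  have h1 : ∀ k : Fin N, ‖if (k : ℕ) < p then x else y‖ = if (k : ℕ) < p then ‖x‖ else ‖y‖ := by
    intro k
    split_ifs <;> rfl
  simp_rw [h1]
  rw [Finset.prod_ite, Finset.prod_const, Finset.prod_const,
    Fin.card_filter_val_lt, min_eq_right hp]
  congr 2
  rw [← Finset.compl_filter, Finset.card_compl, Fintype.card_fin, Fin.card_filter_val_lt,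
    min_eq_right hp]

/-- Both `‖Φ N‖²` and `(a²)^N / N!` are summable, and their sum dominates the product of the square
roots. -/
lemma summable_norm_mul_pow {H : Type*} [NormedAddCommGroup H] [InnerProductSpace ℝ H]
    [CompleteSpace H] (Φ : Fock H) (a : ℝ) (ha : 0 ≤ a) :
    Summable fun N : ℕ => (√(N.factorial : ℝ))⁻¹ * (‖Φ N‖ * a ^ N) := by
  have h1 : Summable fun N => ‖Φ N‖ ^ 2 := by
    have hm := (memℓp_gen_iff (p := 2) (by simp)).1 Φ.2
    simpa using hm
  have h2 := Real.summable_pow_div_factorial (a ^ 2)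
  refine Summable.of_nonneg_of_le (fun N => by positivity) (fun N => ?_) (h1.add h2)
  have h3 : (a ^ 2) ^ N / N.factorial = ((√(N.factorial : ℝ))⁻¹ * a ^ N) ^ 2 := by
    rw [mul_pow, inv_pow, Real.sq_sqrt (by positivity), ← pow_mul, ← pow_mul, mul_comm 2 N]
    field_simp
  rw [h3]
  have h4 : 0 ≤ (√(N.factorial : ℝ))⁻¹ * a ^ N := by positivity
  nlinarith [sq_nonneg (‖Φ N‖ - (√(N.factorial : ℝ))⁻¹ * a ^ N), norm_nonneg (Φ N), sq_nonneg ‖Φ N‖]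

/-- The expansion of the pairing with `expo (s x + t y)` in powers of `s` and `t`. -/
lemma hasSum_inner_expo_add {H : Type*} [NormedAddCommGroup H] [InnerProductSpace ℝ H]
    [CompleteSpace H] (Φ : Fock H) (x y : H) (s t : ℝ) :
    HasSum (fun pq : ℕ × ℕ => ((√((pq.1 + pq.2).factorial : ℝ))⁻¹ *
      (((pq.1 + pq.2).choose pq.1 : ℝ) * mixedValue (Φ (pq.1 + pq.2)).form x y pq.1)) *
        (s ^ pq.1 * t ^ pq.2)) ⟪expo (s • x + t • y), Φ⟫_ℝ := by
  set g : (Σ n : ℕ, Finset.HasAntidiagonal.antidiagonal n) → ℝ := fun i =>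
    (√(i.1.factorial : ℝ))⁻¹ * ((i.1.choose i.2.1.1 : ℝ) *
      mixedValue (Φ i.1).form (s • x) (t • y) i.2.1.1) with hg
  have hle : ∀ (n : ℕ) (i : Finset.HasAntidiagonal.antidiagonal n), i.1.1 ≤ n := fun n i =>
    by
    have := Finset.HasAntidiagonal.mem_antidiagonal.1 i.2
    omega
  have hfib : ∀ n : ℕ, HasSum (fun i : Finset.HasAntidiagonal.antidiagonal n => g ⟨n, i⟩)
      ((√(n.factorial : ℝ))⁻¹ * (Φ n).form (fun _ => s • x + t • y)) := by
    intro n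
    rw [form_add_diag _ (Φ n).form_perm, Finset.mul_sum, ← Finset.sum_coe_sort]
    exact hasSum_fintype _
  -- Within degree `n` the binomial theorem bounds the terms by `‖Φ n‖ (‖s x‖ + ‖t y‖)ⁿ / √n!`.
  -- Absolute summability then allows the sum over degrees to be rearranged as a sum over bidegrees.
  have habs : Summable g := by
    refine Summable.of_norm ?_
    refine (summable_sigma_of_nonneg fun _ => norm_nonneg _).2 ⟨fun n => Summable.of_finite, ?_⟩
    refine Summable.of_nonneg_of_le (fun n => tsum_nonneg fun _ => norm_nonneg _) (fun n => ?_)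
      (summable_norm_mul_pow Φ (‖s • x‖ + ‖t • y‖) (by positivity))
    rw [tsum_fintype, add_pow, Finset.mul_sum, Finset.mul_sum,
      ← Finset.Nat.sum_antidiagonal_eq_sum_range_succ_mk (fun pq : ℕ × ℕ =>
        (√(n.factorial : ℝ))⁻¹ * (‖Φ n‖ * (‖s • x‖ ^ pq.1 * ‖t • y‖ ^ (n - pq.1) *
          (n.choose pq.1 : ℝ)))), ← Finset.sum_coe_sort (Finset.HasAntidiagonal.antidiagonal n)]
    refine Finset.sum_le_sum fun i _ => ?_
    rw [hg]
    simp only [norm_mul, norm_inv, Real.norm_eq_abs, abs_of_nonneg (Real.sqrt_nonneg _),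
      Nat.abs_cast]
    have := (Φ n).abs_mixedValue_le (s • x) (t • y) i.1.1 (hle n i)
    calc (√(n.factorial : ℝ))⁻¹ * ((n.choose i.1.1 : ℝ) *
          |mixedValue (Φ n).form (s • x) (t • y) i.1.1|)
        ≤ (√(n.factorial : ℝ))⁻¹ * ((n.choose i.1.1 : ℝ) *
          (‖Φ n‖ * (‖s • x‖ ^ i.1.1 * ‖t • y‖ ^ (n - i.1.1)))) := by gcongr
      _ = _ := by ring
  have hsum := habs.hasSum
  rw [(hsum.sigma hfib).unique (hasSum_inner_expo (s • x + t • y) Φ)] at hsum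
  rw [← Finset.HasAntidiagonal.sigmaAntidiagonalEquivProd.hasSum_iff]
  refine hsum.congr_fun fun i => ?_
  obtain ⟨n, ⟨p, q⟩, hpq⟩ := i
  have hpq' : p + q = n := by simpa using hpq
  subst hpq'
  change ((√((p + q).factorial : ℝ))⁻¹ * (((p + q).choose p : ℝ) *
    mixedValue (Φ (p + q)).form x y p)) * (s ^ p * t ^ q) = (√((p + q).factorial : ℝ))⁻¹ *
      (((p + q).choose p : ℝ) * mixedValue (Φ (p + q)).form (s • x) (t • y) p)
  rw [mixedValue_smul _ _ _ _ _ _ (by omega), Nat.add_sub_cancel_left]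
  ring

lemma append_const_eq {X : Type*} (p q : ℕ) (x y : X) :
    (Fin.append (fun _ : Fin p => x) (fun _ : Fin q => y)) =
      fun k : Fin (p + q) => if (k : ℕ) < p then x else y := by
  funext k
  refine Fin.addCases (fun i => ?_) (fun j => ?_) k
  · simp
  · simp

lemma append_update_left {X : Type*} {p q : ℕ} (u : Fin p → X) (v : Fin q → X) (i : Fin p) (z : X)
    [DecidableEq (Fin p)] :
    Fin.append (Function.update u i z) v =
      Function.update (Fin.append u v) (Fin.castAdd q i) z := by
  funext k
  refine Fin.addCases (fun j => ?_) (fun j => ?_) k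
  · by_cases h : j = i
    · subst h
      simp
    · rw [Fin.append_left, Function.update_of_ne h, Function.update_of_ne (by simpa using h),
        Fin.append_left]
  · rw [Fin.append_right, Function.update_of_ne (by simp [Fin.ext_iff]; omega), Fin.append_right]

lemma append_update_right {X : Type*} {p q : ℕ} (u : Fin p → X) (v : Fin q → X) (i : Fin q) (z : X)
    [DecidableEq (Fin q)] :
    Fin.append u (Function.update v i z) =
      Function.update (Fin.append u v) (Fin.natAdd p i) z := by
  funext k
  refine Fin.addCases (fun j => ?_) (fun j => ?_) k
  · rw [Fin.append_left, Function.update_of_ne (by simp [Fin.ext_iff]; omega), Fin.append_left]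
  · by_cases h : j = i
    · subst h
      simp
    · rw [Fin.append_right, Function.update_of_ne h, Function.update_of_ne (by simpa using h),
        Fin.append_right]

/-- The form `u ↦ α(u, v)` for fixed `v`. -/
def fixRight {E H : Type*} [NormedAddCommGroup E] [InnerProductSpace ℝ E] [NormedAddCommGroup H]
    [InnerProductSpace ℝ H] {p q : ℕ} (α : MForm H (p + q)) (f : E →L[ℝ] H) (v : Fin q → H) :
    MForm E p where
  toFun u := α (Fin.append (fun i => f (u i)) v)
  map_update_add' := by
    intro _ u i y z
    have h : ∀ w, (fun j => f (Function.update u i w j)) =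
        Function.update (fun j => f (u j)) i (f w) := fun w =>
      (Function.comp_update f u i w)
    simp only [h, append_update_left, map_add, ContinuousMultilinearMap.map_update_add]
  map_update_smul' := by
    intro _ u i y z
    have h : ∀ w, (fun j => f (Function.update u i w j)) =
        Function.update (fun j => f (u j)) i (f w) := fun w =>
      (Function.comp_update f u i w)
    simp only [h, append_update_left, map_smul, ContinuousMultilinearMap.map_update_smul]
  cont := by
    refine α.cont.comp (continuous_pi fun k => ?_)
    refine Fin.addCases (fun j => ?_) (fun j => ?_) k
    · simp only [Fin.append_left]
      fun_prop
    · simp only [Fin.append_right]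
      fun_prop

/-- The form `v ↦ α(u, v)` for fixed `u`. -/
def fixLeft {E H : Type*} [NormedAddCommGroup E] [InnerProductSpace ℝ E] [NormedAddCommGroup H]
    [InnerProductSpace ℝ H] {p q : ℕ} (α : MForm H (p + q)) (f : E →L[ℝ] H) (u : Fin p → H) :
    MForm E q where
  toFun v := α (Fin.append u (fun i => f (v i)))
  map_update_add' := by
    intro _ v i y z
    have h : ∀ w, (fun j => f (Function.update v i w j)) =
        Function.update (fun j => f (v j)) i (f w) := fun w =>
      (Function.comp_update f v i w)
    simp only [h, append_update_right, map_add, ContinuousMultilinearMap.map_update_add]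
  map_update_smul' := by
    intro _ v i y z
    have h : ∀ w, (fun j => f (Function.update v i w j)) =
        Function.update (fun j => f (v j)) i (f w) := fun w =>
      (Function.comp_update f v i w)
    simp only [h, append_update_right, map_smul, ContinuousMultilinearMap.map_update_smul]
  cont := by
    refine α.cont.comp (continuous_pi fun k => ?_)
    refine Fin.addCases (fun j => ?_) (fun j => ?_) k
    · simp only [Fin.append_left]
      fun_prop
    · simp only [Fin.append_right]
      fun_prop

lemma SymPow.form_append_perm {H : Type*} [NormedAddCommGroup H] [InnerProductSpace ℝ H]
    [CompleteSpace H] {p q : ℕ} (α : SymPow H (p + q)) (u : Fin p → H) (v : Fin q → H)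
    (σ : Equiv.Perm (Fin p)) (τ : Equiv.Perm (Fin q)) :
    α.form (Fin.append (fun i => u (σ i)) (fun j => v (τ j))) = α.form (Fin.append u v) := by
  rw [← α.form_perm (finSumFinEquiv.permCongr (Equiv.sumCongr σ τ)) (Fin.append u v)]
  congr 1
  funext k
  refine Fin.addCases (fun i => ?_) (fun j => ?_) k <;>
    simp [Equiv.permCongr_apply]

/-- An operator corresponds to a vector as soon as this holds for the pairings with exponential
vectors. -/
lemma isOperatorOf_of_expo {Φ : Fock (DirSum H₂ H₁)} {T : Fock H₁ →L[ℝ] Fock H₂}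
    (h : ∀ (x : H₂) (y : H₁), ⟪expo x, T (expo y)⟫_ℝ =
      ⟪expo (incl₁ H₂ H₁ x + incl₂ H₂ H₁ y), Φ⟫_ℝ) : IsOperatorOf Φ T := by
  have hdiag : ∀ (p q : ℕ) (x : H₂) (y : H₁),
      ⟪symVec fun _ : Fin p => x, T (symVec fun _ : Fin q => y)⟫_ℝ =
        ⟪symVec (Fin.append (fun _ : Fin p => incl₁ H₂ H₁ x) (fun _ : Fin q => incl₂ H₂ H₁ y)),
          Φ⟫_ℝ := by
    intro p q x y
    set d : ℕ × ℕ → ℝ := fun pq => (√((pq.1 + pq.2).factorial : ℝ))⁻¹ *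
      (((pq.1 + pq.2).choose pq.1 : ℝ) *
        mixedValue (Φ (pq.1 + pq.2)).form (incl₁ H₂ H₁ x) (incl₂ H₂ H₁ y) pq.1) with hd
    have hR : ∀ s t : ℝ, HasSum (fun pq : ℕ × ℕ => d pq * (s ^ pq.1 * t ^ pq.2))
        ⟪expo (s • x), T (expo (t • y))⟫_ℝ := by
      intro s t
      rw [h, map_smul, map_smul]
      exact hasSum_inner_expo_add Φ (incl₁ H₂ H₁ x) (incl₂ H₂ H₁ y) s t
    have hq : ∀ (t : ℝ) (p : ℕ), Summable fun q : ℕ => d (p, q) * t ^ q := by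
      intro t p
      simpa using (hR 1 t).summable.prod_factor p
    -- The coefficients of `s ^ p * t ^ q` are compared one variable at a time: first in `s` with
    -- `t` fixed, then in `t` after moving `T` to the other side by its adjoint.
    have h1 : ∀ (t : ℝ) (p : ℕ), (√(p.factorial : ℝ))⁻¹ *
        (T (expo (t • y)) p).form (fun _ => x) = ∑' q, d (p, q) * t ^ q := by
      intro t p
      refine coeff_eq_of_hasSum (f := fun s => ⟪expo (s • x), T (expo (t • y))⟫_ℝ)
        (d := fun p => ∑' q, d (p, q) * t ^ q)
        (hasSum_inner_expo_smul x (T (expo (t • y)))) (fun s => ?_) p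
      have h2 := (hR s t).prod_fiberwise (g := fun p => (∑' q, d (p, q) * t ^ q) * s ^ p)
        (fun p => by
          refine ((hq t p).hasSum.mul_right (s ^ p)).congr_fun fun q => ?_
          ring)
      exact h2
    have h3 : ∀ (t : ℝ) (p : ℕ), (p.factorial : ℝ)⁻¹ *
        ⟪symVec (fun _ : Fin p => x), T (expo (t • y))⟫_ℝ = ∑' q, d (p, q) * t ^ q := by
      intro t p
      rw [← h1 t p, inner_symVec, ← mul_assoc]
      congr 1
      have h4 := Real.mul_self_sqrt (Nat.cast_nonneg (α := ℝ) p.factorial)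
      have h5 : √(p.factorial : ℝ) ≠ 0 := by positivity
      rw [← h4]
      field_simp
      rw [Real.sqrt_sq (by positivity)]
    have hc : (p.factorial : ℝ)⁻¹ * ((q.factorial : ℝ)⁻¹ *
        ⟪symVec (fun _ : Fin p => x), T (symVec fun _ : Fin q => y)⟫_ℝ) = d (p, q) := by
      refine coeff_eq_of_hasSum
        (c := fun q => (p.factorial : ℝ)⁻¹ * ((q.factorial : ℝ)⁻¹ *
          ⟪symVec (fun _ : Fin p => x), T (symVec fun _ : Fin q => y)⟫_ℝ))
        (d := fun q => d (p, q)) (f := fun t => ∑' q, d (p, q) * t ^ q)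
        (fun t => ?_) (fun t => (hq t p).hasSum) q
      rw [← h3 t p]
      have h4 := (hasSum_inner_expo_symVec (t • y)
        (ContinuousLinearMap.adjoint T (symVec fun _ : Fin p => x))).mul_left (p.factorial : ℝ)⁻¹
      rw [ContinuousLinearMap.adjoint_inner_right, real_inner_comm] at h4
      refine h4.congr_fun fun n => ?_
      have h5 : ⟪symVec fun _ : Fin n => t • y,
          ContinuousLinearMap.adjoint T (symVec fun _ : Fin p => x)⟫_ℝ =
          ⟪symVec fun _ : Fin n => y,
          ContinuousLinearMap.adjoint T (symVec fun _ : Fin p => x)⟫_ℝ * t ^ n := by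
        rw [inner_symVec, inner_symVec, form_const_smul, mul_assoc]
      rw [h5, ContinuousLinearMap.adjoint_inner_right, real_inner_comm]
      ring
    rw [append_const_eq, inner_symVec _ Φ]
    have hch : ((p + q).choose p : ℝ) * p.factorial * q.factorial = (p + q).factorial := by
      have := Nat.add_choose_mul_factorial_mul_factorial p q
      rw [← Nat.choose_symm_add] at this
      exact_mod_cast this
    have hp : (p.factorial : ℝ) ≠ 0 := by positivity
    have hq' : (q.factorial : ℝ) ≠ 0 := by positivity
    have h4 := Real.mul_self_sqrt (Nat.cast_nonneg (α := ℝ) (p + q).factorial)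
    have h5 : √((p + q).factorial : ℝ) ≠ 0 := by positivity
    have h6 : ⟪symVec (fun _ : Fin p => x), T (symVec fun _ : Fin q => y)⟫_ℝ =
        p.factorial * q.factorial * d (p, q) := by
      rw [← hc]
      field_simp
    rw [h6, hd]
    simp only
    change _ = √((p + q).factorial : ℝ) *
      mixedValue (Φ (p + q)).form (incl₁ H₂ H₁ x) (incl₂ H₂ H₁ y) p
    calc _ = (((p + q).choose p : ℝ) * p.factorial * q.factorial) * (√((p + q).factorial : ℝ))⁻¹ *
        mixedValue (Φ (p + q)).form (incl₁ H₂ H₁ x) (incl₂ H₂ H₁ y) p := by ring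
      _ = _ := by
        rw [hch, ← h4]
        field_simp
        rw [Real.sqrt_sq (by positivity)]
  -- Polarisation frees the arguments one group at a time: the `H₂` slots with `y` still repeated,
  -- and afterwards the `H₁` slots through the adjoint.
  have hleft : ∀ (p q : ℕ) (u : Fin p → H₂) (y : H₁),
      ⟪symVec u, T (symVec fun _ : Fin q => y)⟫_ℝ =
        ⟪symVec (Fin.append (fun i => incl₁ H₂ H₁ (u i)) (fun _ : Fin q => incl₂ H₂ H₁ y)),
          Φ⟫_ℝ := by
    intro p q u y
    have key := form_eq_of_diag (√(p.factorial : ℝ) • (T (symVec fun _ : Fin q => y) p).form)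
      (√((p + q).factorial : ℝ) • fixRight (Φ (p + q)).form (incl₁ H₂ H₁)
        (fun _ : Fin q => incl₂ H₂ H₁ y))
      (fun σ x => by simp [SymPow.form_perm])
      (fun σ x => by
        rw [_root_.smul_apply, _root_.smul_apply]
        congr 1
        exact (Φ (p + q)).form_append_perm (fun i => incl₁ H₂ H₁ (x i))
          (fun _ : Fin q => incl₂ H₂ H₁ y) σ 1)
      (fun x => by
        have := hdiag p q x y
        rw [inner_symVec, inner_symVec] at this
        exact this)
    rw [inner_symVec, inner_symVec]
    exact congrArg (fun f => f u) key
  intro p q u v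
  have key := form_eq_of_diag
    (√(q.factorial : ℝ) • ((ContinuousLinearMap.adjoint T (symVec u)) q).form)
    (√((p + q).factorial : ℝ) • fixLeft (Φ (p + q)).form (incl₂ H₂ H₁)
      (fun i => incl₁ H₂ H₁ (u i)))
    (fun σ x => by simp [SymPow.form_perm])
    (fun σ x => by
      rw [_root_.smul_apply, _root_.smul_apply]
      congr 1
      exact (Φ (p + q)).form_append_perm (fun i => incl₁ H₂ H₁ (u i))
        (fun i => incl₂ H₂ H₁ (x i)) 1 σ)
    (fun y => by
      have := hleft p q u y
      rw [real_inner_comm, ← ContinuousLinearMap.adjoint_inner_right,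
        inner_symVec, inner_symVec] at this
      exact this)
  rw [real_inner_comm, ← ContinuousLinearMap.adjoint_inner_right, inner_symVec, inner_symVec]
  exact congrArg (fun f => f v) key

/-- An operator between Fock spaces is determined by the vector it corresponds to. -/
lemma IsOperatorOf.unique {Φ : Fock (DirSum H₂ H₁)} {T T' : Fock H₁ →L[ℝ] Fock H₂}
    (h : IsOperatorOf Φ T) (h' : IsOperatorOf Φ T') : T = T' := by
  have h1 : ∀ (q : ℕ) (v : Fin q → H₁), T (symVec v) = T' (symVec v) := by
    intro q v
    refine sub_eq_zero.1 (eq_zero_of_inner_expo fun x => ?_)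
    refine (hasSum_inner_expo_symVec x _).unique ?_
    refine hasSum_zero.congr_fun fun n => ?_
    rw [inner_sub_right, h, h', sub_self, mul_zero]
  have h2 : ∀ g : Fock H₂, ContinuousLinearMap.adjoint T g = ContinuousLinearMap.adjoint T' g := by
    intro g
    refine sub_eq_zero.1 (eq_zero_of_inner_expo fun x => ?_)
    refine (hasSum_inner_expo_symVec x _).unique ?_
    refine hasSum_zero.congr_fun fun n => ?_
    rw [inner_sub_right, ContinuousLinearMap.adjoint_inner_right,
      ContinuousLinearMap.adjoint_inner_right, h1, sub_self, mul_zero]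
  exact ContinuousLinearMap.adjoint.injective (ContinuousLinearMap.ext h2)

end Operator

/-! ### Total families and Gram matrices. -/

section Total

variable {ι 𝓗 𝓚 : Type*} [NormedAddCommGroup 𝓗] [InnerProductSpace ℝ 𝓗]
  [NormedAddCommGroup 𝓚] [InnerProductSpace ℝ 𝓚]

/-- A family of vectors is total if only zero is orthogonal to all of them. -/
def IsTotal (E : ι → 𝓗) : Prop := ∀ x, (∀ i, ⟪E i, x⟫_ℝ = 0) → x = 0

lemma sq_norm_linearCombination (E : ι → 𝓗) (c : ι →₀ ℝ) :
    ‖Finsupp.linearCombination ℝ E c‖ ^ 2 =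
      ∑ i ∈ c.support, ∑ j ∈ c.support, c i * (c j * ⟪E i, E j⟫_ℝ) := by
  rw [← real_inner_self_eq_norm_sq, Finsupp.linearCombination_apply, Finsupp.sum, sum_inner]
  refine Finset.sum_congr rfl fun i _ => ?_
  rw [real_inner_smul_left, inner_sum, Finset.mul_sum]
  refine Finset.sum_congr rfl fun j _ => ?_
  rw [real_inner_smul_right]

lemma norm_linearCombination_eq (E : ι → 𝓗) (Ψ : ι → 𝓚)
    (h : ∀ i j, ⟪E i, E j⟫_ℝ = ⟪Ψ i, Ψ j⟫_ℝ) (c : ι →₀ ℝ) :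
    ‖Finsupp.linearCombination ℝ E c‖ = ‖Finsupp.linearCombination ℝ Ψ c‖ := by
  rw [← sq_eq_sq₀ (norm_nonneg _) (norm_nonneg _), sq_norm_linearCombination,
    sq_norm_linearCombination]
  simp_rw [h]

lemma inner_linearCombination_left (E : ι → 𝓗) (c : ι →₀ ℝ) (x : 𝓗) :
    ⟪Finsupp.linearCombination ℝ E c, x⟫_ℝ =
      Finsupp.linearCombination ℝ (fun i => ⟪E i, x⟫_ℝ) c := by
  rw [Finsupp.linearCombination_apply, Finsupp.linearCombination_apply, Finsupp.sum, Finsupp.sum,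
    sum_inner]
  simp [real_inner_smul_left]

variable [CompleteSpace 𝓗] [CompleteSpace 𝓚]

lemma IsTotal.denseRange {E : ι → 𝓗} (hE : IsTotal E) :
    DenseRange (Finsupp.linearCombination ℝ E) := by
  rw [DenseRange, ← LinearMap.coe_range, Finsupp.range_linearCombination,
    Submodule.dense_iff_topologicalClosure_eq_top, Submodule.topologicalClosure_eq_top_iff,
    Submodule.eq_bot_iff]
  intro x hx
  refine hE x fun i => ?_
  exact (Submodule.mem_orthogonal _ _).1 hx _ (Submodule.subset_span ⟨i, rfl⟩)

/-- Extension of a bounded assignment from a total family. -/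
lemma IsTotal.exists_clm {E : ι → 𝓗} (hE : IsTotal E) (L : ι → 𝓚) (C : ℝ)
    (h : ∀ c : ι →₀ ℝ, ‖Finsupp.linearCombination ℝ L c‖ ≤
      C * ‖Finsupp.linearCombination ℝ E c‖) :
    ∃ T : 𝓗 →L[ℝ] 𝓚, ∀ i, T (E i) = L i := by
  refine ⟨(Finsupp.linearCombination ℝ L).extendOfNorm (Finsupp.linearCombination ℝ E),
    fun i => ?_⟩
  have := LinearMap.extendOfNorm_eq (f := Finsupp.linearCombination ℝ L) hE.denseRange ⟨C, h⟩
    (Finsupp.single i 1)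
  simpa using this

/-- A bounded assignment of scalars to a total family is given by pairing with a vector. -/
lemma IsTotal.exists_vector {E : ι → 𝓗} (hE : IsTotal E) (f : ι → ℝ) (C : ℝ)
    (h : ∀ c : ι →₀ ℝ, |Finsupp.linearCombination ℝ f c| ≤
      C * ‖Finsupp.linearCombination ℝ E c‖) :
    ∃ G : 𝓗, ∀ i, ⟪E i, G⟫_ℝ = f i := by
  obtain ⟨T, hT⟩ := hE.exists_clm f C h
  refine ⟨(InnerProductSpace.toDual ℝ 𝓗).symm T, fun i => ?_⟩
  rw [real_inner_comm, InnerProductSpace.toDual_symm_apply, hT]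

/-- If two families have the same Gram matrix and the second one is total, inner products of
projections to the closed span of the first one can be computed in the second space. -/
lemma inner_starProjection_eq {E : ι → 𝓗} {Ψ : ι → 𝓚} (hΨ : IsTotal Ψ)
    (h : ∀ i j, ⟪E i, E j⟫_ℝ = ⟪Ψ i, Ψ j⟫_ℝ) {G G' : 𝓗} {g g' : 𝓚}
    (hG : ∀ i, ⟪E i, G⟫_ℝ = ⟪Ψ i, g⟫_ℝ) (hG' : ∀ i, ⟪E i, G'⟫_ℝ = ⟪Ψ i, g'⟫_ℝ) :
    ⟪(Submodule.span ℝ (Set.range E)).topologicalClosure.starProjection G,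
      (Submodule.span ℝ (Set.range E)).topologicalClosure.starProjection G'⟫_ℝ = ⟪g, g'⟫_ℝ := by
  set S := (Submodule.span ℝ (Set.range E)).topologicalClosure with hS
  -- Equality of Gram matrices makes `Ψ i ↦ E i` extend to an isometry `T` into the closed span of
  -- `E`. The vectors `T g` and `G` have the same pairings with every `E i`, so `T g` is the
  -- projection of `G`.
  obtain ⟨T, hT⟩ := hΨ.exists_clm E 1 fun c => by
    rw [one_mul, norm_linearCombination_eq E Ψ h]
  have hTlin : ∀ c, T (Finsupp.linearCombination ℝ Ψ c) = Finsupp.linearCombination ℝ E c := by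
    intro c
    rw [Finsupp.linearCombination_apply, Finsupp.linearCombination_apply, Finsupp.sum,
      Finsupp.sum, map_sum]
    simp [hT]
  have hnorm : ∀ x, ‖T x‖ = ‖x‖ := by
    intro x
    refine hΨ.denseRange.induction_on (p := fun x => ‖T x‖ = ‖x‖) x
      (isClosed_eq (by fun_prop) (by fun_prop)) fun c => ?_
    rw [hTlin, norm_linearCombination_eq E Ψ h]
  have hinner : ∀ x y, ⟪T x, T y⟫_ℝ = ⟪x, y⟫_ℝ := by
    let T' : 𝓚 →ₗᵢ[ℝ] 𝓗 := ⟨T.toLinearMap, hnorm⟩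
    exact T'.inner_map_map
  have hmem : ∀ x, T x ∈ S := by
    intro x
    refine hΨ.denseRange.induction_on (p := fun x => T x ∈ S) x
      ((Submodule.isClosed_topologicalClosure _).preimage T.continuous) fun c => ?_
    rw [hTlin]
    refine Submodule.le_topologicalClosure _ ?_
    rw [← Finsupp.range_linearCombination]
    exact ⟨c, rfl⟩
  have hproj : ∀ {G : 𝓗} {g : 𝓚}, (∀ i, ⟪E i, G⟫_ℝ = ⟪Ψ i, g⟫_ℝ) → S.starProjection G = T g := by
    intro G g hGg
    refine Submodule.eq_starProjection_of_mem_orthogonal (hmem g) ?_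
    rw [hS, Submodule.orthogonal_closure, Submodule.mem_orthogonal]
    intro u hu
    induction hu using Submodule.span_induction with
    | mem x hx =>
      obtain ⟨i, rfl⟩ := hx
      rw [inner_sub_right, hGg, ← hinner, hT, sub_self]
    | zero => simp
    | add x y _ _ hx hy => rw [inner_add_left, hx, hy, add_zero]
    | smul a x _ hx => rw [real_inner_smul_left, hx, mul_zero]
  rw [hproj hG, hproj hG', hinner]

end Total

/-! ### Exhaustion by finite-dimensional subspaces. -/

section FiniteSubspaces

/-- The directed set of finite dimensional subspaces. -/
abbrev FinSub (H : Type*) [NormedAddCommGroup H] [InnerProductSpace ℝ H] : Type _ :=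
  {F : Submodule ℝ H // FiniteDimensional ℝ F}

variable {H : Type*} [NormedAddCommGroup H] [InnerProductSpace ℝ H]

instance (F : FinSub H) : FiniteDimensional ℝ F.1 := F.2

instance : Nonempty (FinSub H) := ⟨⟨⊥, inferInstance⟩⟩

instance : IsDirectedOrder (FinSub H) :=
  ⟨fun F G => ⟨⟨F.1 ⊔ G.1, inferInstance⟩, le_sup_left (a := F.1), le_sup_right (a := F.1)⟩⟩

lemma tendsto_starProjection_finSub (x : H) :
    Filter.Tendsto (fun F : FinSub H => F.1.starProjection x) Filter.atTop (nhds x) := by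
  refine Submodule.starProjection_tendsto_self (fun F : FinSub H => F.1) (fun _ _ h => h) x ?_
  intro y _
  refine Submodule.le_topologicalClosure _ ?_
  refine Submodule.mem_iSup_of_mem ⟨Submodule.span ℝ {y}, inferInstance⟩ ?_
  exact Submodule.mem_span_singleton_self y

variable [CompleteSpace H]

lemma isTotal_expo : IsTotal (expo : H → Fock H) := fun _ h => eq_zero_of_inner_expo h

/-- The closed span of the exponential vectors of a subspace. -/
def expoSpan (F : Submodule ℝ H) : Submodule ℝ (Fock H) :=
  (Submodule.span ℝ (Set.range fun x : F => expo (x : H))).topologicalClosure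

instance (F : Submodule ℝ H) : (expoSpan F).HasOrthogonalProjection :=
  inferInstanceAs (Submodule.topologicalClosure _).HasOrthogonalProjection

/-- The spaces `expoSpan F` increase with `F`, and each `expo x` lies in the one belonging to the
line of `x`; totality makes their union dense. Inner products in the Fock space are thereby limits
of inner products computed over finite-dimensional `F`. -/
lemma tendsto_starProjection_expoSpan (Φ : Fock H) :
    Filter.Tendsto (fun F : FinSub H => (expoSpan F.1).starProjection Φ) Filter.atTop
      (nhds Φ) := by
  refine Submodule.starProjection_tendsto_self (fun F : FinSub H => expoSpan F.1) ?_ Φ ?_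
  · intro F G hFG
    refine Submodule.topologicalClosure_mono (Submodule.span_mono ?_)
    rintro _ ⟨x, rfl⟩
    exact ⟨⟨x, hFG x.2⟩, rfl⟩
  · rw [top_le_iff, Submodule.topologicalClosure_eq_top_iff, Submodule.eq_bot_iff]
    intro Ψ hΨ
    refine eq_zero_of_inner_expo fun x => ?_
    refine (Submodule.mem_orthogonal _ _).1 hΨ _ ?_
    refine Submodule.mem_iSup_of_mem ⟨Submodule.span ℝ {x}, inferInstance⟩ ?_
    exact Submodule.le_topologicalClosure _
      (Submodule.subset_span ⟨⟨x, Submodule.mem_span_singleton_self x⟩, rfl⟩)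

lemma tendsto_inner_starProjection_expoSpan (Φ Ψ : Fock H) :
    Filter.Tendsto (fun F : FinSub H =>
      ⟪(expoSpan F.1).starProjection Φ, (expoSpan F.1).starProjection Ψ⟫_ℝ) Filter.atTop
      (nhds ⟪Φ, Ψ⟫_ℝ) :=
  (tendsto_starProjection_expoSpan Φ).inner (tendsto_starProjection_expoSpan Ψ)

end FiniteSubspaces

/-! ### Bounded operators attached to vectors of the Fock space of a direct sum. -/

section ExistsOperator

lemma inner_incl_add {H₁ H₂ : Type*} [NormedAddCommGroup H₁] [InnerProductSpace ℝ H₁]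
    [NormedAddCommGroup H₂] [InnerProductSpace ℝ H₂] (x x' : H₂) (y y' : H₁) :
    ⟪incl₁ H₂ H₁ x + incl₂ H₂ H₁ y, incl₁ H₂ H₁ x' + incl₂ H₂ H₁ y'⟫_ℝ =
      ⟪x, x'⟫_ℝ + ⟪y, y'⟫_ℝ := by
  simp [incl₁, incl₂, WithLp.prod_inner_apply]

variable {H₁ H₂ : Type*} [NormedAddCommGroup H₁] [InnerProductSpace ℝ H₁] [CompleteSpace H₁]
  [NormedAddCommGroup H₂] [InnerProductSpace ℝ H₂] [CompleteSpace H₂]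

/-- The Gram kernel of the vectors `expo (x + y)` is `exp ⟪x, x'⟫ * exp ⟪y, y'⟫`, so they behave
like `expo x ⊗ expo y`. This is where the tensor factorisation of the Fock space of a direct sum
enters. -/
lemma norm_sum_expo_incl (c : H₂ →₀ ℝ) (d : H₁ →₀ ℝ) :
    ‖∑ x ∈ c.support, ∑ y ∈ d.support, (c x * d y) • expo (incl₁ H₂ H₁ x + incl₂ H₂ H₁ y)‖ =
      ‖Finsupp.linearCombination ℝ expo c‖ * ‖Finsupp.linearCombination ℝ expo d‖ := by
  rw [← sq_eq_sq₀ (norm_nonneg _) (by positivity), mul_pow, sq_norm_linearCombination,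
    sq_norm_linearCombination, ← real_inner_self_eq_norm_sq]
  rw [Finset.sum_mul_sum, sum_inner]
  refine Finset.sum_congr rfl fun x _ => ?_
  rw [sum_inner]
  refine Finset.sum_congr rfl fun y _ => ?_
  rw [Finset.sum_mul_sum, inner_sum]
  refine Finset.sum_congr rfl fun x' _ => ?_
  rw [inner_sum]
  refine Finset.sum_congr rfl fun y' _ => ?_
  rw [real_inner_smul_left, real_inner_smul_right, inner_expo_expo, inner_incl_add, Real.exp_add,
    inner_expo_expo, inner_expo_expo]
  ring

/-- Every vector of `Sym^*((H₂ ⊕ H₁)^∨)` corresponds to a bounded operator. -/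
lemma exists_operator (Φ : Fock (DirSum H₂ H₁)) :
    ∃ T : Fock H₁ →L[ℝ] Fock H₂, ∀ (x : H₂) (y : H₁), ⟪expo x, T (expo y)⟫_ℝ =
      ⟪expo (incl₁ H₂ H₁ x + incl₂ H₂ H₁ y), Φ⟫_ℝ := by
  have hbound : ∀ (c : H₂ →₀ ℝ) (d : H₁ →₀ ℝ),
      |∑ x ∈ c.support, ∑ y ∈ d.support, c x * d y *
        ⟪expo (incl₁ H₂ H₁ x + incl₂ H₂ H₁ y), Φ⟫_ℝ| ≤
      ‖Finsupp.linearCombination ℝ expo c‖ * ‖Finsupp.linearCombination ℝ expo d‖ * ‖Φ‖ := by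
    intro c d
    rw [← norm_sum_expo_incl]
    refine le_trans (le_of_eq ?_) (abs_real_inner_le_norm _ Φ)
    simp only [sum_inner, real_inner_smul_left]
  have h1 : ∀ y : H₁, ∃ G : Fock H₂, ∀ x : H₂, ⟪expo x, G⟫_ℝ =
      ⟪expo (incl₁ H₂ H₁ x + incl₂ H₂ H₁ y), Φ⟫_ℝ := by
    intro y
    refine isTotal_expo.exists_vector _ (‖expo y‖ * ‖Φ‖) fun c => ?_
    have := hbound c (Finsupp.single y 1)
    rw [Finsupp.support_single _ one_ne_zero] at this
    simp only [Finset.sum_singleton, Finsupp.single_eq_same, mul_one,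
      Finsupp.linearCombination_single, one_smul] at this
    rw [Finsupp.linearCombination_apply, Finsupp.sum]
    simp only [smul_eq_mul]
    refine this.trans (le_of_eq ?_)
    ring
  choose G hG using h1
  obtain ⟨T, hT⟩ := isTotal_expo.exists_clm G ‖Φ‖ fun d => by
    set z := Finsupp.linearCombination ℝ G d with hz
    -- The bilinear bound is known for `w` in the span of coherent vectors; density extends it to
    -- every `w`, and `w = z` bounds `‖z‖`.
    have h2 : ∀ w : Fock H₂, ⟪w, z⟫_ℝ ≤ ‖w‖ * ‖Finsupp.linearCombination ℝ expo d‖ * ‖Φ‖ := by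
      intro w
      refine isTotal_expo.denseRange.induction_on
        (p := fun w => ⟪w, z⟫_ℝ ≤ ‖w‖ * ‖Finsupp.linearCombination ℝ expo d‖ * ‖Φ‖) w
        (isClosed_le (by fun_prop) (by fun_prop)) fun c => ?_
      refine le_trans (le_of_eq ?_) ((le_abs_self _).trans (hbound c d))
      rw [hz, Finsupp.linearCombination_apply, Finsupp.sum, Finsupp.linearCombination_apply,
        Finsupp.sum]
      simp only [sum_inner, inner_sum, real_inner_smul_left, real_inner_smul_right, hG]
      rw [Finset.sum_comm]
      refine Finset.sum_congr rfl fun x _ => Finset.sum_congr rfl fun y _ => ?_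
      ring
    have h3 := h2 z
    rw [real_inner_self_eq_norm_sq] at h3
    by_cases hz0 : ‖z‖ = 0
    · rw [hz0]
      positivity
    · have hpos : 0 < ‖z‖ := lt_of_le_of_ne (norm_nonneg _) (Ne.symm hz0)
      nlinarith
  exact ⟨T, fun x y => by rw [hT, hG]⟩

lemma existsUnique_isOperatorOf (Φ : Fock (DirSum H₂ H₁)) : ∃! T, IsOperatorOf Φ T := by
  obtain ⟨T, hT⟩ := exists_operator Φ
  exact ⟨T, isOperatorOf_of_expo hT, fun _ h => h.unique (isOperatorOf_of_expo hT)⟩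

lemma inner_fockOperator (Φ : Fock (DirSum H₂ H₁)) (x : H₂) (y : H₁) :
    ⟪expo x, fockOperator Φ (expo y)⟫_ℝ = ⟪expo (incl₁ H₂ H₁ x + incl₂ H₂ H₁ y), Φ⟫_ℝ := by
  obtain ⟨T, hT⟩ := exists_operator Φ
  have hex : ∃ T : Fock H₁ →L[ℝ] Fock H₂, IsOperatorOf Φ T := ⟨T, isOperatorOf_of_expo hT⟩
  have : fockOperator Φ = T := by
    rw [fockOperator, dif_pos hex]
    exact hex.choose_spec.unique (isOperatorOf_of_expo hT)
  rw [this, hT]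

/-- Operators between Fock spaces that agree on exponential vectors are equal. -/
lemma clm_ext_expo {T T' : Fock H₁ →L[ℝ] Fock H₂}
    (h : ∀ (x : H₂) (y : H₁), ⟪expo x, T (expo y)⟫_ℝ = ⟪expo x, T' (expo y)⟫_ℝ) : T = T' := by
  refine ContinuousLinearMap.adjoint.injective (ContinuousLinearMap.ext fun g => ?_)
  refine sub_eq_zero.1 (eq_zero_of_inner_expo fun y => ?_)
  have : T (expo y) = T' (expo y) :=
    sub_eq_zero.1 (eq_zero_of_inner_expo fun x => by rw [inner_sub_right, h, sub_self])
  rw [inner_sub_right, ContinuousLinearMap.adjoint_inner_right,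
    ContinuousLinearMap.adjoint_inner_right, this, sub_self]

end ExistsOperator

/-! ### Coercive operators and the Cayley transform. -/

section PosDef

variable {H : Type*} [NormedAddCommGroup H] [InnerProductSpace ℝ H]

/-- Symmetric operators with a positive lower bound. -/
structure IsPosDef (A : H →L[ℝ] H) : Prop where
  symm : ∀ x y : H, ⟪A x, y⟫_ℝ = ⟪x, A y⟫_ℝ
  coercive : ∃ ε : ℝ, 0 < ε ∧ ∀ x : H, ε * ‖x‖ ^ 2 ≤ ⟪A x, x⟫_ℝ

namespace IsPosDef

variable {A B : H →L[ℝ] H}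

lemma isPositiveOperator (hA : IsPosDef A) : IsPositiveOperator A := by
  refine ⟨hA.symm, fun x hx => ?_⟩
  obtain ⟨ε, hε, h⟩ := hA.coercive
  have : 0 < ‖x‖ := norm_pos_iff.2 hx
  exact lt_of_lt_of_le (by positivity) (h x)

lemma one : IsPosDef (1 : H →L[ℝ] H) :=
  ⟨fun _ _ => rfl, 1, one_pos, fun x => by simp⟩

lemma add (hA : IsPosDef A) (hB : IsPosDef B) : IsPosDef (A + B) := by
  obtain ⟨ε, hε, h⟩ := hA.coercive
  obtain ⟨δ, hδ, h'⟩ := hB.coercive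
  refine ⟨fun x y => ?_, ε + δ, by positivity, fun x => ?_⟩
  · simp [inner_add_left, inner_add_right, hA.symm, hB.symm]
  · simp only [_root_.add_apply, inner_add_left]
    nlinarith [h x, h' x]

lemma smul (hA : IsPosDef A) {c : ℝ} (hc : 0 < c) : IsPosDef (c • A) := by
  obtain ⟨ε, hε, h⟩ := hA.coercive
  refine ⟨fun x y => ?_, c * ε, by positivity, fun x => ?_⟩
  · simp [real_inner_smul_left, real_inner_smul_right, hA.symm]
  · simp only [_root_.smul_apply, real_inner_smul_left]
    nlinarith [h x]

/-- Lax–Milgram applied to the bilinear form `⟪A x, y⟫`. -/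
lemma isUnit [CompleteSpace H] (hA : IsPosDef A) : IsUnit A := by
  obtain ⟨ε, hε, h⟩ := hA.coercive
  have hc : IsCoercive ((innerSL ℝ : H →L[ℝ] H →L[ℝ] ℝ) ∘L A) := by
    refine ⟨ε, hε, fun x => ?_⟩
    have := h x
    rw [sq, ← mul_assoc] at this
    exact this
  have : A = (hc.continuousLinearEquivOfBilin : H →L[ℝ] H) := by
    ext x
    refine ext_inner_right ℝ fun y => ?_
    have := hc.continuousLinearEquivOfBilin_apply x y
    exact this.symm
  rw [this]
  exact (ContinuousLinearEquiv.toUnit _).isUnit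

end IsPosDef

/-- With `exists_add_eq`, which writes every vector as `z + T z`, this allows work with the Cayley
transform without mentioning the inverse. -/
lemma cayley_apply {T : H →L[ℝ] H} (h : IsUnit (1 + T)) (z : H) :
    cayley T (z + T z) = z - T z := by
  have h1 : cayley T * (1 + T) = 1 - T := by
    rw [cayley, mul_assoc, Ring.inverse_mul_cancel _ h, mul_one]
  exact congrArg (fun f : H →L[ℝ] H => f z) h1

lemma exists_add_eq {T : H →L[ℝ] H} (h : IsUnit (1 + T)) (x : H) : ∃ z, z + T z = x := by
  refine ⟨Ring.inverse (1 + T) x, ?_⟩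
  exact congrArg (fun f : H →L[ℝ] H => f x) (Ring.mul_inverse_cancel _ h)

lemma cayley_mul_one_add {T : H →L[ℝ] H} (h : IsUnit (1 + T)) : cayley T * (1 + T) = 1 - T := by
  rw [cayley, mul_assoc, Ring.inverse_mul_cancel _ h, mul_one]

lemma one_add_mul_cayley {T : H →L[ℝ] H} (h : IsUnit (1 + T)) : (1 + T) * cayley T = 1 - T := by
  rw [cayley, ← mul_assoc, show (1 + T) * (1 - T) = (1 - T) * (1 + T) by noncomm_ring, mul_assoc,
    Ring.mul_inverse_cancel _ h, mul_one]

lemma cayley_symm {T : H →L[ℝ] H} (h : IsUnit (1 + T)) (hT : ∀ x y : H, ⟪T x, y⟫_ℝ = ⟪x, T y⟫_ℝ)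
    (x y : H) : ⟪cayley T x, y⟫_ℝ = ⟪x, cayley T y⟫_ℝ := by
  obtain ⟨z, rfl⟩ := exists_add_eq h x
  obtain ⟨w, rfl⟩ := exists_add_eq h y
  rw [cayley_apply h, cayley_apply h]
  simp only [inner_sub_left, inner_add_left, inner_sub_right, inner_add_right, hT z w]
  ring

variable [CompleteSpace H]

lemma isUnit_one_add_of_norm_lt_one {T : H →L[ℝ] H} (h : ‖T‖ < 1) : IsUnit (1 + T) := by
  have := isUnit_one_sub_of_norm_lt_one (x := -T) (by rwa [norm_neg])
  rwa [sub_neg_eq_add] at this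

lemma isPosDef_one_add_of_norm_lt_one {H : Type*} [NormedAddCommGroup H] [InnerProductSpace ℝ H]
    {T : H →L[ℝ] H} (h : ‖T‖ < 1)
    (hT : ∀ x y : H, ⟪T x, y⟫_ℝ = ⟪x, T y⟫_ℝ) : IsPosDef (1 + T) := by
  refine ⟨fun x y => ?_, 1 - ‖T‖, by linarith, fun x => ?_⟩
  · simp [inner_add_left, inner_add_right, hT]
  · simp only [_root_.add_apply, one_apply_eq_self, inner_add_left,
      real_inner_self_eq_norm_sq]
    have h1 := abs_real_inner_le_norm (T x) x
    have h2 := T.le_opNorm x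
    have h3 := neg_abs_le ⟪T x, x⟫_ℝ
    nlinarith [norm_nonneg x]

/-- At `x = z + T z` the quadratic form is `‖z‖² - ‖T z‖² ≥ (1 - ‖T‖²) ‖z‖²`, while `‖x‖ ≤ 2 ‖z‖`;
hence the constant `(1 - ‖T‖²) / 4`. -/
lemma isPosDef_cayley_of_norm_lt_one {T : H →L[ℝ] H} (h : ‖T‖ < 1)
    (hT : ∀ x y : H, ⟪T x, y⟫_ℝ = ⟪x, T y⟫_ℝ) : IsPosDef (cayley T) := by
  have hu := isUnit_one_add_of_norm_lt_one h
  refine ⟨cayley_symm hu hT, (1 - ‖T‖ ^ 2) / 4, ?_, fun x => ?_⟩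
  · have := norm_nonneg T
    have : ‖T‖ ^ 2 < 1 := by nlinarith
    linarith
  · obtain ⟨z, rfl⟩ := exists_add_eq hu x
    rw [cayley_apply hu]
    have h1 : ⟪z - T z, z + T z⟫_ℝ = ‖z‖ ^ 2 - ‖T z‖ ^ 2 := by
      simp only [inner_sub_left, inner_add_right, hT z z, real_inner_self_eq_norm_sq]
      rw [← hT z z, real_inner_comm]
      ring
    have h2 := T.le_opNorm z
    have h3 : ‖z + T z‖ ≤ 2 * ‖z‖ := by
      have := norm_add_le z (T z)
      nlinarith [norm_nonneg z]
    have h4 : ‖z + T z‖ ^ 2 ≤ 4 * ‖z‖ ^ 2 := by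
      nlinarith [norm_nonneg z, norm_nonneg (z + T z)]
    have h5 : ‖T z‖ ^ 2 ≤ ‖T‖ ^ 2 * ‖z‖ ^ 2 := by
      rw [← mul_pow]
      gcongr
    have h6 : 0 ≤ 1 - ‖T‖ ^ 2 := by nlinarith [norm_nonneg T]
    rw [h1]
    nlinarith

lemma norm_cayley_lt_one {A : H →L[ℝ] H} (hA : IsPosDef A) : ‖cayley A‖ < 1 := by
  have hu := (IsPosDef.one.add hA).isUnit
  obtain ⟨ε, hε, h⟩ := hA.coercive
  -- By `‖z - A z‖² = ‖z + A z‖² - 4 ⟪A z, z⟫` it suffices that `δ (1 + ‖A‖)² ≤ 4 ε`; the extra `4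
  -- ε` in the denominator keeps `δ < 1`. The resulting bound on the norm is `√(1 - δ)`.
  set δ : ℝ := 4 * ε / ((1 + ‖A‖) ^ 2 + 4 * ε) with hδ
  have hnA := norm_nonneg A
  have hden : 0 < (1 + ‖A‖) ^ 2 + 4 * ε := by positivity
  have hδ0 : 0 < δ := by positivity
  have hδ1 : δ < 1 := by
    rw [hδ, div_lt_one hden]
    have : 0 < (1 + ‖A‖) ^ 2 := by positivity
    linarith
  have hδ2 : δ * (1 + ‖A‖) ^ 2 ≤ 4 * ε := by
    rw [hδ, div_mul_eq_mul_div, div_le_iff₀ hden]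
    nlinarith [sq_nonneg (1 + ‖A‖)]
  refine lt_of_le_of_lt (ContinuousLinearMap.opNorm_le_bound _ (Real.sqrt_nonneg (1 - δ))
    fun x => ?_) (by rw [Real.sqrt_lt' one_pos]; linarith : √(1 - δ) < 1)
  obtain ⟨z, rfl⟩ := exists_add_eq hu x
  rw [cayley_apply hu]
  refine abs_le_of_sq_le_sq' ?_ (by positivity) |>.2
  rw [mul_pow, Real.sq_sqrt (by linarith)]
  have h1 : ‖z - A z‖ ^ 2 = ‖z + A z‖ ^ 2 - 4 * ⟪A z, z⟫_ℝ := by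
    rw [norm_sub_sq_real, norm_add_sq_real, real_inner_comm]
    ring
  have h2 : ‖z + A z‖ ≤ (1 + ‖A‖) * ‖z‖ := by
    have := norm_add_le z (A z)
    have := A.le_opNorm z
    linarith
  have h3 : ‖z + A z‖ ^ 2 ≤ (1 + ‖A‖) ^ 2 * ‖z‖ ^ 2 := by
    rw [← mul_pow]
    gcongr
  rw [h1]
  have h4 := h z
  nlinarith [sq_nonneg ‖z‖]

end PosDef

/-! ### Gaussian integrals and totality of Gaussian functions. -/

section Gaussian

open MeasureTheory

variable {V : Type*} [NormedAddCommGroup V] [InnerProductSpace ℝ V]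

/-- The Gaussian function `exp(-½⟪Ay, y⟫ + √2⟪c, y⟫)`. -/
def gaussFun (A : V →L[ℝ] V) (c : V) (y : V) : ℝ :=
  Real.exp (-(1 / 2) * ⟪A y, y⟫_ℝ + √2 * ⟪c, y⟫_ℝ)

lemma gaussFun_mul (A M : V →L[ℝ] V) (c d : V) (y : V) :
    gaussFun A c y * gaussFun M d y =
      Real.exp (-(1 / 2) * ⟪(A + M) y, y⟫_ℝ + ⟪√2 • (c + d), y⟫_ℝ) := by
  rw [gaussFun, gaussFun, ← Real.exp_add]
  simp only [_root_.add_apply, inner_add_left, real_inner_smul_left]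
  ring_nf

variable [FiniteDimensional ℝ V]

/-- A positive definite operator on a finite dimensional space is `RᵗR`. -/
lemma IsPosDef.exists_sqrt {B : V →L[ℝ] V} (hB : IsPosDef B) :
    ∃ R : V →ₗ[ℝ] V, LinearMap.det R ≠ 0 ∧ LinearMap.det (B : V →ₗ[ℝ] V) = LinearMap.det R ^ 2 ∧
      ∀ x, ⟪B x, x⟫_ℝ = ‖R x‖ ^ 2 := by
  have hs : (B : V →ₗ[ℝ] V).IsSymmetric := hB.symm
  set b := hs.eigenvectorBasis rfl with hb
  set ev := hs.eigenvalues rfl with hev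
  have hBb : ∀ i, B (b i) = ev i • b i := fun i => hs.apply_eigenvectorBasis rfl i
  have hpos : ∀ i, 0 < ev i := by
    intro i
    have h := hB.isPositiveOperator.2 (b i) (b.orthonormal.ne_zero i)
    rw [hBb, real_inner_smul_left, real_inner_self_eq_norm_sq, b.norm_eq_one] at h
    simpa using h
  let R : V →ₗ[ℝ] V := b.toBasis.constr ℝ fun i => √(ev i) • b i
  have hRb : ∀ i, R (b i) = √(ev i) • b i := by
    intro i
    have := b.toBasis.constr_basis ℝ (fun i => √(ev i) • b i) i
    rwa [OrthonormalBasis.coe_toBasis] at this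
  have hRR : (B : V →ₗ[ℝ] V) = R ∘ₗ R := by
    refine b.toBasis.ext fun i => ?_
    rw [OrthonormalBasis.coe_toBasis]
    change B (b i) = R (R (b i))
    rw [hRb, map_smul, hRb, smul_smul, Real.mul_self_sqrt (hpos i).le, hBb]
  have hdet : LinearMap.det (B : V →ₗ[ℝ] V) = LinearMap.det R ^ 2 := by
    rw [hRR, LinearMap.det_comp, sq]
  refine ⟨R, ?_, hdet, fun x => ?_⟩
  · intro h0
    rw [h0, hs.det_eq_prod_eigenvalues rfl] at hdet
    have : (0 : ℝ) < ∏ i, ev i := Finset.prod_pos fun i _ => hpos i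
    simp only [RCLike.ofReal_real_eq_id, id_eq, ne_eq, OfNat.ofNat_ne_zero, not_false_eq_true,
      zero_pow] at hdet
    exact this.ne' hdet
  · have h1 : ∀ i, ⟪b i, R x⟫_ℝ = √(ev i) * ⟪b i, x⟫_ℝ := by
      intro i
      have : (innerₛₗ ℝ (b i)) ∘ₗ R = √(ev i) • innerₛₗ ℝ (b i) := by
        refine b.toBasis.ext fun j => ?_
        rw [OrthonormalBasis.coe_toBasis]
        change ⟪b i, R (b j)⟫_ℝ = √(ev i) * ⟪b i, b j⟫_ℝ
        rw [hRb, real_inner_smul_right]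
        by_cases hij : i = j
        · subst hij
          rfl
        · rw [b.orthonormal.2 hij]
          simp
      exact congrArg (fun f => f x) this
    rw [← b.sum_sq_norm_inner_right, ← b.sum_inner_mul_inner]
    refine Finset.sum_congr rfl fun i _ => ?_
    rw [hB.symm, hBb, real_inner_smul_right, h1, Real.norm_eq_abs, sq_abs, mul_pow,
      Real.sq_sqrt (hpos i).le, real_inner_comm]
    ring

lemma IsPosDef.det_pos {B : V →L[ℝ] V} (hB : IsPosDef B) :
    0 < LinearMap.det (B : V →ₗ[ℝ] V) := by
  obtain ⟨R, h0, h1, -⟩ := hB.exists_sqrt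
  rw [h1]
  positivity

variable [MeasurableSpace V] [BorelSpace V]

lemma IsPosDef.integrable_exp {B : V →L[ℝ] V} (hB : IsPosDef B) (c : V) :
    Integrable fun y : V => Real.exp (-(1 / 2) * ⟪B y, y⟫_ℝ + ⟪c, y⟫_ℝ) := by
  obtain ⟨ε, hε, h⟩ := hB.coercive
  have h1 := (GaussianFourier.integrable_cexp_neg_mul_sq_norm_add (V := V) (b := (ε / 2 : ℝ))
    (by simpa using hε) 1 c).norm
  refine h1.mono' (by fun_prop) (Filter.Eventually.of_forall fun y => ?_)
  rw [Complex.norm_exp, Real.norm_eq_abs, Real.abs_exp, Real.exp_le_exp]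
  have h2 : (-((ε / 2 : ℝ) : ℂ) * (‖y‖ : ℂ) ^ 2 + 1 * ((⟪c, y⟫_ℝ : ℝ) : ℂ)) =
      ((-(ε / 2) * ‖y‖ ^ 2 + ⟪c, y⟫_ℝ : ℝ) : ℂ) := by
    push_cast
    ring
  rw [h2, Complex.ofReal_re]
  have := h y
  linarith

variable (V) in
/-- The integral of the standard Gaussian. -/
def gaussConst : ℝ := ∫ y : V, Real.exp (-(1 / 2) * ‖y‖ ^ 2)

variable (V) in
lemma gaussConst_pos : 0 < gaussConst V := by
  refine integral_exp_pos ?_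
  have := (IsPosDef.one (H := V)).integrable_exp 0
  simpa using this

/-- The Gaussian integral of a positive definite operator. -/
lemma IsPosDef.integral_exp {B : V →L[ℝ] V} (hB : IsPosDef B) (y₀ : V) :
    ∫ y : V, Real.exp (-(1 / 2) * ⟪B y, y⟫_ℝ + ⟪B y₀, y⟫_ℝ) =
      gaussConst V * (√(LinearMap.det (B : V →ₗ[ℝ] V)))⁻¹ * Real.exp ((1 / 2) * ⟪B y₀, y₀⟫_ℝ) := by
  obtain ⟨R, hR0, hRdet, hR⟩ := hB.exists_sqrt
  have h1 : ∫ y : V, Real.exp (-(1 / 2) * ⟪B y, y⟫_ℝ) =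
      gaussConst V * (√(LinearMap.det (B : V →ₗ[ℝ] V)))⁻¹ := by
    simp_rw [hR]
    have hm : Measurable R := (LinearMap.continuous_of_finiteDimensional R).measurable
    have h2 := integral_map (μ := (volume : Measure V)) hm.aemeasurable
      (f := fun y => Real.exp (-(1 / 2) * ‖y‖ ^ 2)) (by fun_prop)
    rw [← h2, Measure.map_linearMap_addHaar_eq_smul_addHaar _ hR0, integral_smul_measure,
      ENNReal.toReal_ofReal (abs_nonneg _), hRdet, Real.sqrt_sq_eq_abs, abs_inv, smul_eq_mul,
      mul_comm, gaussConst]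
  -- Translation by `y₀` completes the square.
  rw [← h1, ← integral_mul_const, ← integral_add_right_eq_self _ y₀]
  congr 1
  funext y
  rw [← Real.exp_add]
  congr 1
  simp only [map_add, inner_add_left, inner_add_right]
  have h3 : ⟪B y, y₀⟫_ℝ = ⟪B y₀, y⟫_ℝ := by rw [hB.symm, real_inner_comm]
  rw [h3]
  ring

lemma IsPosDef.memLp_gaussFun {A : V →L[ℝ] V} (hA : IsPosDef A) (c : V) :
    MemLp (gaussFun A c) 2 (volume : Measure V) := by
  rw [memLp_two_iff_integrable_sq (by unfold gaussFun; fun_prop)]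
  simp_rw [sq, gaussFun_mul]
  exact (hA.add hA).integrable_exp _

/-- The integral of the product of two Gaussian functions. -/
lemma IsPosDef.integral_gaussFun_mul {A M : V →L[ℝ] V} (hA : IsPosDef A) (hM : IsPosDef M)
    (c d y₀ : V) (hy₀ : (A + M) y₀ = c + d) :
    ∫ y : V, gaussFun A c y * gaussFun M d y = gaussConst V *
      (√(LinearMap.det ((A + M : V →L[ℝ] V) : V →ₗ[ℝ] V)))⁻¹ * Real.exp ⟪c + d, y₀⟫_ℝ := by
  simp_rw [gaussFun_mul]
  have := (hA.add hM).integral_exp (√2 • y₀)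
  rw [map_smul, hy₀] at this
  rw [this, real_inner_smul_left, real_inner_smul_right, ← mul_assoc √2,
    Real.mul_self_sqrt (by norm_num)]
  congr 2
  ring

/-- A square integrable function orthogonal to all Gaussians `exp(-½‖y‖² + √2⟪x, y⟫)` is zero. -/
lemma isTotal_gaussFun_one :
    IsTotal fun x : V => (IsPosDef.one.memLp_gaussFun x).toLp (gaussFun (1 : V →L[ℝ] V) x) := by
  intro g hg
  -- Orthogonality says that the two-sided Laplace transform of `h` vanishes at every real vector.
  -- The positive and negative parts of `h` are then densities of finite measures with equal moment
  -- generating functions, hence by analytic continuation with equal characteristic functions. So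
  -- the measures agree and `h = 0` almost everywhere.
  set h : V → ℝ := fun y => Real.exp (-(1 / 2) * ‖y‖ ^ 2) * g y with hh
  have hgm : Measurable (g : V → ℝ) := (Lp.stronglyMeasurable g).measurable
  have hhm : Measurable h := by
    refine Measurable.mul ?_ hgm
    fun_prop
  have hgl : MemLp (g : V → ℝ) 2 (volume : Measure V) := Lp.memLp g
  have hfun : ∀ x y : V, gaussFun (1 : V →L[ℝ] V) x y * g y = Real.exp ⟪√2 • x, y⟫_ℝ * h y := by
    intro x y
    rw [hh, gaussFun, one_apply_eq_self, real_inner_self_eq_norm_sq, Real.exp_add,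
      real_inner_smul_left]
    ring
  have hint : ∀ x : V, Integrable fun y => Real.exp ⟪x, y⟫_ℝ * h y := by
    intro x
    have h1 := (IsPosDef.one.memLp_gaussFun ((√2)⁻¹ • x)).integrable_mul hgl
    refine h1.congr (Filter.Eventually.of_forall fun y => ?_)
    simp only [Pi.mul_apply]
    rw [hfun, smul_smul, mul_inv_cancel₀ (by positivity), one_smul]
  have hzero : ∀ x : V, ∫ y, Real.exp ⟪x, y⟫_ℝ * h y = 0 := by
    intro x
    rw [← hg ((√2)⁻¹ • x), L2.inner_def]
    refine integral_congr_ae ?_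
    filter_upwards [(IsPosDef.one.memLp_gaussFun ((√2)⁻¹ • x)).coeFn_toLp] with y hy
    rw [hy]
    change _ = g y * gaussFun (1 : V →L[ℝ] V) ((√2)⁻¹ • x) y
    rw [mul_comm (g y), hfun, smul_smul, mul_inv_cancel₀ (by positivity), one_smul]
  have hint0 : Integrable h := by simpa using hint 0
  set μp := (volume : Measure V).withDensity fun y => ENNReal.ofReal (h y) with hμp
  set μn := (volume : Measure V).withDensity fun y => ENNReal.ofReal (-h y) with hμn
  have : IsFiniteMeasure μp := isFiniteMeasure_withDensity_ofReal hint0.2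
  have : IsFiniteMeasure μn := isFiniteMeasure_withDensity_ofReal hint0.neg.2
  have hip : ∀ x : V, Integrable (fun y => Real.exp ⟪x, y⟫_ℝ) μp := by
    intro x
    rw [hμp, integrable_withDensity_iff_integrable_smul' (by fun_prop) (by simp)]
    refine (hint x).norm.mono' (by fun_prop) (Filter.Eventually.of_forall fun y => ?_)
    rw [ENNReal.toReal_ofReal', smul_eq_mul, norm_mul, norm_mul, mul_comm]
    gcongr
    rw [Real.norm_eq_abs, abs_of_nonneg (le_max_right _ _), Real.norm_eq_abs]
    exact max_le (le_abs_self _) (abs_nonneg _)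
  have hep : ∀ x : V, ∫ y, Real.exp ⟪x, y⟫_ℝ ∂μp = ∫ y, Real.exp ⟪x, y⟫_ℝ ∂μn := by
    intro x
    rw [hμp, hμn, integral_withDensity_eq_integral_toReal_smul (by fun_prop) (by simp),
      integral_withDensity_eq_integral_toReal_smul (by fun_prop) (by simp), ← sub_eq_zero,
      ← integral_sub, ← hzero x]
    · congr 1
      funext y
      rw [ENNReal.toReal_ofReal', ENNReal.toReal_ofReal', smul_eq_mul, smul_eq_mul, ← sub_mul,
        max_comm, max_comm (-h y), mul_comm]
      congr 1
      rcases le_total 0 (h y) with h0 | h0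
      · rw [max_eq_right h0, max_eq_left (by linarith), sub_zero]
      · rw [max_eq_left h0, max_eq_right (by linarith)]
        ring
    · refine (hint x).norm.mono' (by fun_prop) (Filter.Eventually.of_forall fun y => ?_)
      rw [ENNReal.toReal_ofReal', smul_eq_mul, norm_mul, norm_mul, mul_comm]
      gcongr
      rw [Real.norm_eq_abs, abs_of_nonneg (le_max_right _ _), Real.norm_eq_abs]
      exact max_le (le_abs_self _) (abs_nonneg _)
    · refine (hint x).norm.mono' (by fun_prop) (Filter.Eventually.of_forall fun y => ?_)
      rw [ENNReal.toReal_ofReal', smul_eq_mul, norm_mul, norm_mul, mul_comm]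
      gcongr
      rw [Real.norm_eq_abs, abs_of_nonneg (le_max_right _ _), Real.norm_eq_abs]
      exact max_le (neg_le_abs _) (abs_nonneg _)
  have hmass : μp.real Set.univ = μn.real Set.univ := by
    have := hep 0
    simpa using this
  have hnull : μp = 0 ↔ μn = 0 := by
    rw [← Measure.measure_univ_eq_zero, ← Measure.measure_univ_eq_zero,
      ← measureReal_eq_zero_iff, hmass, measureReal_eq_zero_iff]
  have hchar : μp = μn := by
    refine Measure.ext_of_charFun (funext fun x => ?_)
    have h1 := ProbabilityTheory.eqOn_complexMGF_of_mgf' (X := fun y : V => ⟪x, y⟫_ℝ)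
      (Y := fun y : V => ⟪x, y⟫_ℝ) (μ := μp) (μ' := μn) (by
        funext s
        have := hep (s • x)
        simpa only [ProbabilityTheory.mgf, real_inner_smul_left] using this) hnull
    have h2 : ProbabilityTheory.integrableExpSet (fun y : V => ⟪x, y⟫_ℝ) μp = Set.univ := by
      refine Set.eq_univ_of_forall fun s => ?_
      have := hip (s • x)
      simp only [real_inner_smul_left] at this
      exact this
    have h3 := h1 (x := Complex.I) (by simp [h2])
    rw [charFun_apply, charFun_apply]
    simp only [ProbabilityTheory.complexMGF] at h3
    simpa only [mul_comm Complex.I, real_inner_comm] using h3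
  have hae := (withDensity_eq_iff (by fun_prop) (by fun_prop) (hint0.lintegral_lt_top.ne)).1 hchar
  rw [Lp.eq_zero_iff_ae_eq_zero]
  filter_upwards [hae] with y hy
  have h1 := congrArg ENNReal.toReal hy
  rw [ENNReal.toReal_ofReal', ENNReal.toReal_ofReal'] at h1
  have h2 : h y = 0 := by
    rcases le_total 0 (h y) with h0 | h0
    · rw [max_eq_left h0, max_eq_right (by linarith)] at h1
      exact h1
    · rw [max_eq_right h0, max_eq_left (by linarith)] at h1
      linarith
  rw [hh] at h2
  exact (mul_eq_zero.1 h2).resolve_left (Real.exp_pos _).ne'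

end Gaussian

/-! ### Gaussian vectors realised in `L²` of a finite-dimensional space. -/

section GaussVec

open MeasureTheory

variable {V : Type*} [NormedAddCommGroup V] [InnerProductSpace ℝ V]

lemma det_mul_clm (A B : V →L[ℝ] V) : LinearMap.det ((A * B : V →L[ℝ] V) : V →ₗ[ℝ] V) =
    LinearMap.det (A : V →ₗ[ℝ] V) * LinearMap.det (B : V →ₗ[ℝ] V) :=
  LinearMap.det_comp _ _

/-- Cancelling the outer factors leaves `(1 - S)(1 + T) + (1 + S)(1 - T)`. The determinant of the
quadratic form `C(S) + C(T)` in a Gaussian integral is thereby converted into `det (1 - S T)`. -/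
lemma cayley_add_cayley {S T : V →L[ℝ] V} (hS : IsUnit (1 + S)) (hT : IsUnit (1 + T)) :
    (1 + S) * (cayley S + cayley T) * (1 + T) = (2 : ℝ) • (1 - S * T) := by
  have h : (1 + S) * (cayley S + cayley T) * (1 + T) =
      ((1 + S) * cayley S) * (1 + T) + (1 + S) * (cayley T * (1 + T)) := by noncomm_ring
  rw [h, one_add_mul_cayley hS, cayley_mul_one_add hT, two_smul]
  noncomm_ring

variable [FiniteDimensional ℝ V]

lemma det_cayley_add {S T : V →L[ℝ] V} (hS : IsUnit (1 + S)) (hT : IsUnit (1 + T)) :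
    LinearMap.det ((1 + S : V →L[ℝ] V) : V →ₗ[ℝ] V) *
      LinearMap.det ((cayley S + cayley T : V →L[ℝ] V) : V →ₗ[ℝ] V) *
      LinearMap.det ((1 + T : V →L[ℝ] V) : V →ₗ[ℝ] V) =
    2 ^ Module.finrank ℝ V * LinearMap.det ((1 - S * T : V →L[ℝ] V) : V →ₗ[ℝ] V) := by
  rw [← det_mul_clm, ← det_mul_clm, cayley_add_cayley hS hT, ← LinearMap.det_smul]
  rfl

/-- The operator `1 - S * T` need not be symmetric; positivity comes from `det_cayley_add`, whose
other three determinants belong to positive definite operators. -/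
lemma det_one_sub_mul_pos {S T : V →L[ℝ] V} (hS : ‖S‖ < 1) (hT : ‖T‖ < 1)
    (hSs : ∀ x y : V, ⟪S x, y⟫_ℝ = ⟪x, S y⟫_ℝ) (hTs : ∀ x y : V, ⟪T x, y⟫_ℝ = ⟪x, T y⟫_ℝ) :
    0 < LinearMap.det ((1 - S * T : V →L[ℝ] V) : V →ₗ[ℝ] V) := by
  have h := det_cayley_add (isUnit_one_add_of_norm_lt_one hS) (isUnit_one_add_of_norm_lt_one hT)
  have h1 := (isPosDef_one_add_of_norm_lt_one hS hSs).det_pos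
  have h2 := (isPosDef_one_add_of_norm_lt_one hT hTs).det_pos
  have h3 := ((isPosDef_cayley_of_norm_lt_one hS hSs).add
    (isPosDef_cayley_of_norm_lt_one hT hTs)).det_pos
  have h4 : (0 : ℝ) < 2 ^ Module.finrank ℝ V := by positivity
  refine pos_of_mul_pos_right (a := 2 ^ Module.finrank ℝ V) ?_ h4.le
  rw [← h]
  positivity

variable [MeasurableSpace V] [BorelSpace V]

open Classical in
/-- The square integrable function on `V` that corresponds to the vector of the Fock space whose
pairing with `expo x` is `exp(½⟪Tx, x⟫ + ⟪w, x⟫)`. -/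
def gaussVec (T : V →L[ℝ] V) (w : V) : Lp ℝ 2 (volume : Measure V) :=
  if h : MemLp (gaussFun (cayley T) (Ring.inverse (1 + T) w)) 2 (volume : Measure V) then
    -- The normalisation is chosen so that in the pairing of two such vectors `gaussConst` cancels,
    -- the power of `2` absorbs that of `det_cayley_add`, and the exponentials remove the terms in
    -- which `w` is paired with its own image.
    ((√(gaussConst V))⁻¹ * √(√(2 ^ Module.finrank ℝ V)) *
      (√(LinearMap.det ((1 + T : V →L[ℝ] V) : V →ₗ[ℝ] V)))⁻¹ *
      Real.exp (-(1 / 2) * ⟪w, Ring.inverse (1 + T) w⟫_ℝ)) • h.toLp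
  else 0

lemma inner_toLp {f g : V → ℝ} (hf : MemLp f 2 (volume : Measure V))
    (hg : MemLp g 2 (volume : Measure V)) : ⟪hf.toLp, hg.toLp⟫_ℝ = ∫ y, f y * g y := by
  rw [L2.inner_def]
  refine integral_congr_ae ?_
  filter_upwards [hf.coeFn_toLp, hg.coeFn_toLp] with y h1 h2
  rw [h1, h2]
  exact mul_comm _ _

/-- The integrand is Gaussian with quadratic form `C(Z) + C(P)`. Up to the factor `√2`, its critical
point is the midpoint `(s + t) / 2`, by the two equations relating `s` and `t`. -/
lemma inner_gaussVec {Z P : V →L[ℝ] V} (hZ : ‖Z‖ < 1) (hP : ‖P‖ < 1)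
    (hZs : ∀ x y : V, ⟪Z x, y⟫_ℝ = ⟪x, Z y⟫_ℝ) (hPs : ∀ x y : V, ⟪P x, y⟫_ℝ = ⟪x, P y⟫_ℝ)
    {a b s t : V} (ht : t = a + Z s) (hs : s = b + P t) :
    ⟪gaussVec Z a, gaussVec P b⟫_ℝ =
      (√(LinearMap.det ((1 - Z * P : V →L[ℝ] V) : V →ₗ[ℝ] V)))⁻¹ *
        Real.exp ((1 / 2) * (⟪a, s⟫_ℝ + ⟪b, t⟫_ℝ)) := by
  have huZ := isUnit_one_add_of_norm_lt_one hZ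
  have huP := isUnit_one_add_of_norm_lt_one hP
  have hA := isPosDef_cayley_of_norm_lt_one hZ hZs
  have hM := isPosDef_cayley_of_norm_lt_one hP hPs
  set c := Ring.inverse (1 + Z) a with hc
  set d := Ring.inverse (1 + P) b with hd
  have hca : c + Z c = a := congrArg (fun f : V →L[ℝ] V => f a) (Ring.mul_inverse_cancel _ huZ)
  have hdb : d + P d = b := congrArg (fun f : V →L[ℝ] V => f b) (Ring.mul_inverse_cancel _ huP)
  have hAst : cayley Z (s + t) = s - t + (2 : ℝ) • c := by
    have h1 : s + t = (s + c) + Z (s + c) := by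
      rw [map_add, ht]
      nth_rewrite 1 [← hca]
      abel
    rw [h1, cayley_apply huZ, map_add, ht]
    linear_combination (norm := module) (-1 : ℝ) • hca
  have hMst : cayley P (s + t) = t - s + (2 : ℝ) • d := by
    have h1 : s + t = (t + d) + P (t + d) := by
      rw [map_add]
      nth_rewrite 1 [hs]
      nth_rewrite 1 [← hdb]
      abel
    rw [h1, cayley_apply huP, map_add]
    linear_combination (norm := module) hs - hdb
  have hy₀ : (cayley Z + cayley P) ((1 / 2 : ℝ) • (s + t)) = c + d := by
    rw [map_smul, _root_.add_apply, hAst, hMst]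
    module
  have hint := hA.integral_gaussFun_mul hM c d _ hy₀
  have hexp : ⟪c + d, (1 / 2 : ℝ) • (s + t)⟫_ℝ =
      (1 / 2) * (⟪a, s⟫_ℝ + ⟪b, t⟫_ℝ) + (1 / 2) * ⟪a, c⟫_ℝ + (1 / 2) * ⟪b, d⟫_ℝ := by
    have h1 : ⟪c, s + t⟫_ℝ = ⟪a, s⟫_ℝ + ⟪a, c⟫_ℝ := by
      have : s + t = (s + c) + Z (s + c) := by
        rw [map_add, ht]
        nth_rewrite 1 [← hca]
        abel
      rw [this, inner_add_right, ← hZs, ← inner_add_left, hca, inner_add_right]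
    have h2 : ⟪d, s + t⟫_ℝ = ⟪b, t⟫_ℝ + ⟪b, d⟫_ℝ := by
      have : s + t = (t + d) + P (t + d) := by
        rw [map_add]
        nth_rewrite 1 [hs]
        nth_rewrite 1 [← hdb]
        abel
      rw [this, inner_add_right, ← hPs, ← inner_add_left, hdb, inner_add_right]
    rw [real_inner_smul_right, inner_add_left, h1, h2]
    ring
  have hdet := det_cayley_add huZ huP
  have h1 := (isPosDef_one_add_of_norm_lt_one hZ hZs).det_pos
  have h2 := (isPosDef_one_add_of_norm_lt_one hP hPs).det_pos
  have h3 := (hA.add hM).det_pos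
  have h4 := det_one_sub_mul_pos hZ hP hZs hPs
  rw [gaussVec, gaussVec, dif_pos (hA.memLp_gaussFun _), dif_pos (hM.memLp_gaussFun _),
    real_inner_smul_left, real_inner_smul_right, inner_toLp, hint, hexp, ← hc, ← hd,
    Real.exp_add, Real.exp_add, neg_mul, neg_mul, Real.exp_neg, Real.exp_neg]
  have hJ := gaussConst_pos V
  set D1 := LinearMap.det ((1 + Z : V →L[ℝ] V) : V →ₗ[ℝ] V)
  set D2 := LinearMap.det ((1 + P : V →L[ℝ] V) : V →ₗ[ℝ] V)
  set D3 := LinearMap.det ((cayley Z + cayley P : V →L[ℝ] V) : V →ₗ[ℝ] V)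
  set D4 := LinearMap.det ((1 - Z * P : V →L[ℝ] V) : V →ₗ[ℝ] V)
  have h5 : √D1 * √D3 * √D2 = √(2 ^ Module.finrank ℝ V) * √D4 := by
    rw [← Real.sqrt_mul h1.le, ← Real.sqrt_mul (by positivity), hdet,
      Real.sqrt_mul (by positivity)]
  have h6 := Real.mul_self_sqrt (Real.sqrt_nonneg (2 ^ Module.finrank ℝ V))
  have h7 := Real.mul_self_sqrt hJ.le
  set q := √(√(2 ^ Module.finrank ℝ V))
  have hq : 0 < q := by positivity
  rw [← h6] at h5
  set j := √(gaussConst V)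
  have hj : 0 < j := by positivity
  rw [← h7]
  have e1 := Real.exp_pos (1 / 2 * ⟪a, c⟫_ℝ)
  have e2 := Real.exp_pos (1 / 2 * ⟪b, d⟫_ℝ)
  have s1 : 0 < √D1 := by positivity
  have s2 : 0 < √D2 := by positivity
  have s3 : 0 < √D3 := by positivity
  have s4 : 0 < √D4 := by positivity
  field_simp
  linarith

lemma isTotal_gaussVec_zero : IsTotal fun x : V => gaussVec (0 : V →L[ℝ] V) x := by
  have h0 : cayley (0 : V →L[ℝ] V) = 1 := by simp [cayley]
  intro g hg
  refine isTotal_gaussFun_one g fun x => ?_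
  have h1 := hg x
  have hi : Ring.inverse (1 + (0 : V →L[ℝ] V)) x = x := by simp
  have hf : gaussFun (cayley (0 : V →L[ℝ] V)) (Ring.inverse (1 + (0 : V →L[ℝ] V)) x) =
      gaussFun 1 x := by rw [h0, hi]
  have hm := IsPosDef.one.memLp_gaussFun x
  simp only [gaussVec] at h1
  rw [dif_pos (hf ▸ hm), real_inner_smul_left,
    MemLp.toLp_congr _ hm (Filter.Eventually.of_forall fun y => congrFun hf y), hi] at h1
  refine (mul_eq_zero.1 h1).resolve_left ?_
  have hJ := gaussConst_pos V
  have h2 : 0 < LinearMap.det ((1 + 0 : V →L[ℝ] V) : V →ₗ[ℝ] V) := by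
    rw [add_zero]
    exact IsPosDef.one.det_pos
  have h3 := Real.exp_pos (-(1 / 2) * ⟪x, x⟫_ℝ)
  positivity

end GaussVec

/-- A Hilbert space with Gaussian vectors over a finite dimensional space. -/
lemma exists_gaussian_model.{u} (V : Type u) [NormedAddCommGroup V] [InnerProductSpace ℝ V]
    [FiniteDimensional ℝ V] :
    ∃ (𝓚 : Type u) (_ : NormedAddCommGroup 𝓚) (_ : InnerProductSpace ℝ 𝓚) (_ : CompleteSpace 𝓚)
      (g : (V →L[ℝ] V) → V → 𝓚), IsTotal (g 0) ∧
      ∀ {Z P : V →L[ℝ] V}, ‖Z‖ < 1 → ‖P‖ < 1 →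
        (∀ x y : V, ⟪Z x, y⟫_ℝ = ⟪x, Z y⟫_ℝ) → (∀ x y : V, ⟪P x, y⟫_ℝ = ⟪x, P y⟫_ℝ) →
        ∀ {a b s t : V}, t = a + Z s → s = b + P t →
        ⟪g Z a, g P b⟫_ℝ = (√(LinearMap.det ((1 - Z * P : V →L[ℝ] V) : V →ₗ[ℝ] V)))⁻¹ *
          Real.exp ((1 / 2) * (⟪a, s⟫_ℝ + ⟪b, t⟫_ℝ)) := by
  -- The measurable structure stays inside this proof, so that only Hilbert space data is passed on.
  let _ : MeasurableSpace V := borel V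
  have : BorelSpace V := ⟨rfl⟩
  exact ⟨MeasureTheory.Lp ℝ 2 (MeasureTheory.volume : MeasureTheory.Measure V), inferInstance,
    inferInstance, inferInstance, gaussVec, isTotal_gaussVec_zero,
    fun hZ hP hZs hPs _ _ _ _ ht hs => inner_gaussVec hZ hP hZs hPs ht hs⟩

/-! ### Determinants of `1 + K` for nuclear operators `K` -/

section Minors

/-- The principal minor of `(⟪uᵢ, vⱼ⟫)` with index set `S`. -/
def minor {E ι : Type*} [NormedAddCommGroup E] [InnerProductSpace ℝ E] [DecidableEq ι]
    (u v : ι → E) (S : Finset ι) : ℝ :=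
  (Matrix.of fun i j : S => ⟪u i, v j⟫_ℝ).det

lemma prod_le_one_of_sum_le_card {n : Type*} [Fintype n] (f : n → ℝ) (hf : ∀ i, 0 ≤ f i)
    (h : ∑ i, f i ≤ Fintype.card n) : ∏ i, f i ≤ 1 := by
  calc ∏ i, f i ≤ ∏ i, Real.exp (f i - 1) :=
        Finset.prod_le_prod (fun i _ => hf i) fun i _ => by
          linarith [Real.add_one_le_exp (f i - 1)]
    _ = Real.exp (∑ i, f i - Fintype.card n) := by
        rw [← Real.exp_sum]; simp [Finset.sum_sub_distrib]
    _ ≤ 1 := Real.exp_le_one_iff.2 (by linarith)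

variable {E : Type*} [NormedAddCommGroup E] [InnerProductSpace ℝ E]

/-- The eigenvalues are nonnegative and their sum, the trace, is at most the size of the matrix;
hence their product is at most one. -/
lemma det_gram_le_one {n : Type*} [Fintype n] [DecidableEq n] (u : n → E)
    (hu : ∀ i, ‖u i‖ ≤ 1) : (Matrix.gram ℝ u).det ≤ 1 := by
  have hp := Matrix.posSemidef_gram ℝ u
  rw [hp.1.det_eq_prod_eigenvalues]
  refine prod_le_one_of_sum_le_card _ hp.eigenvalues_nonneg ?_
  have ht := hp.1.trace_eq_sum_eigenvalues
  refine le_trans (le_of_eq ht.symm) ?_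
  rw [Matrix.trace]
  calc ∑ i, (Matrix.gram ℝ u).diag i ≤ ∑ _i : n, (1 : ℝ) := by
        refine Finset.sum_le_sum fun i _ => ?_
        simp only [Matrix.diag_apply, Matrix.gram_apply, real_inner_self_eq_norm_sq]
        exact pow_le_one₀ (norm_nonneg _) (hu i)
    _ = Fintype.card n := by simp

variable [FiniteDimensional ℝ E]

/-- Up to transposition the determinant is the inner product of `u₁ ∧ ⋯ ∧ uₙ` and `v₁ ∧ ⋯ ∧ vₙ` in
the exterior power. Cauchy–Schwarz reduces the bound to Gram determinants. -/
lemma abs_det_inner_le_one {n : ℕ} (u v : Fin n → E) (hu : ∀ i, ‖u i‖ ≤ 1)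
    (hv : ∀ i, ‖v i‖ ≤ 1) : |(Matrix.of fun i j => ⟪u i, v j⟫_ℝ).det| ≤ 1 := by
  have hn : ∀ w : Fin n → E, (∀ i, ‖w i‖ ≤ 1) → ‖exteriorPower.ιMulti ℝ n w‖ ≤ 1 := by
    intro w hw
    rw [← abs_norm, abs_le_one_iff_mul_self_le_one, ← real_inner_self_eq_norm_mul_norm,
      exteriorPower.inner_ιMulti_self]
    exact det_gram_le_one w hw
  rw [← Matrix.det_transpose]
  have h := abs_real_inner_le_norm (exteriorPower.ιMulti ℝ n u) (exteriorPower.ιMulti ℝ n v)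
  rw [exteriorPower.inner_ιMulti_ιMulti] at h
  exact h.trans (mul_le_one₀ (hn u hu) (norm_nonneg _) (hn v hv))

lemma abs_det_inner_le {n : Type*} [Fintype n] [DecidableEq n] (u v : n → E) :
    |(Matrix.of fun i j => ⟪u i, v j⟫_ℝ).det| ≤ ∏ i, ‖u i‖ * ‖v i‖ := by
  have key : (Matrix.of fun i j => ⟪u i, v j⟫_ℝ) = Matrix.of fun i j => ‖u i‖ *
      (Matrix.of fun i j => ‖v j‖ * (Matrix.of fun i j =>
        ⟪‖u i‖⁻¹ • u i, ‖v j‖⁻¹ • v j⟫_ℝ) i j) i j := by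
    ext i j
    simp only [Matrix.of_apply, real_inner_smul_left, real_inner_smul_right]
    rcases eq_or_ne (u i) 0 with h | h
    · simp [h]
    rcases eq_or_ne (v j) 0 with h' | h'
    · simp [h']
    field_simp [norm_ne_zero_iff.2 h, norm_ne_zero_iff.2 h']
  have hu : ∀ w : E, ‖‖w‖⁻¹ • w‖ ≤ 1 := by
    intro w
    rw [norm_smul, norm_inv, norm_norm]
    exact inv_mul_le_one
  rw [key, Matrix.det_mul_column, Matrix.det_mul_row, Finset.prod_mul_distrib, abs_mul, abs_mul,
    Finset.abs_prod, Finset.abs_prod, ← mul_assoc]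
  simp only [abs_norm]
  refine mul_le_of_le_one_right (by positivity) ?_
  let e := Fintype.equivFin n
  rw [← Matrix.det_submatrix_equiv_self e.symm]
  exact abs_det_inner_le_one (fun i => ‖u (e.symm i)‖⁻¹ • u (e.symm i))
    (fun i => ‖v (e.symm i)‖⁻¹ • v (e.symm i)) (fun i => hu _) (fun i => hu _)

lemma abs_minor_le {ι : Type*} [DecidableEq ι] (u v : ι → E) (S : Finset ι) :
    |minor u v S| ≤ ∏ i ∈ S, ‖u i‖ * ‖v i‖ := by
  rw [← Finset.prod_coe_sort]
  exact abs_det_inner_le (fun i : S => u i) fun i : S => v i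

end Minors

lemma det_one_add_eq_sum_det {n : Type*} [Fintype n] [DecidableEq n] (M : Matrix n n ℝ) :
    (1 + M).det = ∑ S : Finset n, (M.submatrix (↑) (↑) : Matrix S S ℝ).det := by
  rw [add_comm]
  have := (Matrix.detRowAlternating (R := ℝ) (n := n)).map_add_univ M (1 : Matrix n n ℝ)
  refine this.trans (Finset.sum_congr rfl fun S _ => ?_)
  exact Matrix.det_piecewise_one_eq_submatrix_det M S

section FiniteExpansion

variable {E : Type*} [NormedAddCommGroup E] [InnerProductSpace ℝ E] [FiniteDimensional ℝ E]

/-- The operator `x ↦ ∑ᵢ ⟪uᵢ, x⟫ vᵢ` for a finite set of indices. -/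
def sumRankOne {E F ι : Type*} [NormedAddCommGroup E] [InnerProductSpace ℝ E]
    [NormedAddCommGroup F] [InnerProductSpace ℝ F] (u : ι → E) (v : ι → F) (s : Finset ι) :
    E →L[ℝ] F :=
  ∑ i ∈ s, (innerSL ℝ (u i)).smulRight (v i)

lemma sumRankOne_apply {E F ι : Type*} [NormedAddCommGroup E] [InnerProductSpace ℝ E]
    [NormedAddCommGroup F] [InnerProductSpace ℝ F] (u : ι → E) (v : ι → F) (s : Finset ι) (x : E) :
    sumRankOne u v s x = ∑ i ∈ s, ⟪u i, x⟫_ℝ • v i := by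
  simp [sumRankOne, _root_.sum_apply]

/-- Sylvester's identity `det (1 + V U) = det (1 + U V)`, with `U` and `V` the coordinate matrices
of the two families. -/
lemma det_one_add_sumRankOne_univ {ι : Type*} [Fintype ι] [DecidableEq ι] (u v : ι → E) :
    LinearMap.det ((1 + sumRankOne u v Finset.univ : E →L[ℝ] E) : E →ₗ[ℝ] E) =
      (1 + Matrix.of fun i j => ⟪u i, v j⟫_ℝ : Matrix ι ι ℝ).det := by
  let b := stdOrthonormalBasis ℝ E
  let V : Matrix (Fin (Module.finrank ℝ E)) ι ℝ := Matrix.of fun a i => ⟪b a, v i⟫_ℝ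
  let U : Matrix ι (Fin (Module.finrank ℝ E)) ℝ := Matrix.of fun i a => ⟪u i, b a⟫_ℝ
  have h1 : (Matrix.of fun i j => ⟪u i, v j⟫_ℝ : Matrix ι ι ℝ) = U * V := by
    ext i j
    rw [Matrix.mul_apply]
    exact (b.sum_inner_mul_inner (u i) (v j)).symm
  have h2 : LinearMap.toMatrix b.toBasis b.toBasis
      ((1 + sumRankOne u v Finset.univ : E →L[ℝ] E) : E →ₗ[ℝ] E) = 1 + V * U := by
    ext a c
    rw [LinearMap.toMatrix_apply, Matrix.add_apply, Matrix.mul_apply]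
    simp only [OrthonormalBasis.coe_toBasis, ContinuousLinearMap.coe_coe, _root_.add_apply,
      sumRankOne_apply, OrthonormalBasis.coe_toBasis_repr_apply, OrthonormalBasis.repr_apply_apply,
      inner_add_right, inner_sum, real_inner_smul_right, one_apply_eq_self]
    congr 1
    · rw [orthonormal_iff_ite.1 b.orthonormal, Matrix.one_apply]
    · exact Finset.sum_congr rfl fun i _ => mul_comm _ _
  rw [← LinearMap.det_toMatrix b.toBasis, h2, h1, Matrix.det_one_add_mul_comm]

lemma det_one_add_sumRankOne {ι : Type*} [DecidableEq ι] (u v : ι → E) (s : Finset ι) :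
    LinearMap.det ((1 + sumRankOne u v s : E →L[ℝ] E) : E →ₗ[ℝ] E) =
      ∑ S ∈ s.powerset, minor u v S := by
  have h : sumRankOne u v s = sumRankOne (fun i : s => u i) (fun i : s => v i) Finset.univ := by
    unfold sumRankOne
    exact (Finset.sum_coe_sort s fun i => (innerSL ℝ (u i)).smulRight (v i)).symm
  rw [h, det_one_add_sumRankOne_univ, det_one_add_eq_sum_det]
  refine Finset.sum_nbij (fun S => S.map (Function.Embedding.subtype _)) ?_ ?_ ?_ ?_
  · intro S _
    rw [Finset.mem_powerset]
    intro i hi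
    obtain ⟨j, _, rfl⟩ := Finset.mem_map.1 hi
    exact j.2
  · exact fun S _ S' _ h => Finset.map_injective _ h
  · intro S hS
    refine ⟨S.subtype (· ∈ s), Finset.mem_coe.2 (Finset.mem_univ _), ?_⟩
    exact Finset.subtype_map_of_mem fun i hi => Finset.mem_powerset.1 (Finset.mem_coe.1 hS) hi
  · intro S _
    let f : S → S.map (Function.Embedding.subtype (· ∈ s)) := fun i =>
      ⟨(i : s), Finset.mem_map.2 ⟨i, i.2, rfl⟩⟩
    have hf : Function.Bijective f := by
      constructor
      · intro i j hij
        have h := Subtype.ext_iff.1 hij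
        exact Subtype.ext (Subtype.ext h)
      · rintro ⟨i, hi⟩
        obtain ⟨j, hj, rfl⟩ := Finset.mem_map.1 hi
        exact ⟨⟨j, hj⟩, rfl⟩
    unfold minor
    rw [← Matrix.det_submatrix_equiv_self (Equiv.ofBijective f hf)]
    rfl

end FiniteExpansion

section InfiniteExpansion

lemma tendsto_det {E α : Type*} [NormedAddCommGroup E] [InnerProductSpace ℝ E]
    [FiniteDimensional ℝ E] {l : Filter α} {A : α → E →L[ℝ] E} {B : E →L[ℝ] E}
    (h : ∀ x, Filter.Tendsto (fun a => A a x) l (nhds (B x))) :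
    Filter.Tendsto (fun a => LinearMap.det (A a : E →ₗ[ℝ] E)) l
      (nhds (LinearMap.det (B : E →ₗ[ℝ] E))) := by
  let b := stdOrthonormalBasis ℝ E
  simp_rw [← LinearMap.det_toMatrix b.toBasis]
  refine ((continuous_id.matrix_det).tendsto _).comp ?_
  refine tendsto_pi_nhds.2 fun i => tendsto_pi_nhds.2 fun j => ?_
  simp only [LinearMap.toMatrix_apply, OrthonormalBasis.coe_toBasis,
    ContinuousLinearMap.coe_coe, OrthonormalBasis.coe_toBasis_repr_apply,
    OrthonormalBasis.repr_apply_apply]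
  exact tendsto_const_nhds.inner (h _)

/-- `K x = ∑ᵢ ⟪uᵢ, x⟫ vᵢ` with `∑ᵢ ‖uᵢ‖ ‖vᵢ‖ < ∞`. -/
structure NuclearRep {E F ι : Type*} [NormedAddCommGroup E] [InnerProductSpace ℝ E]
    [NormedAddCommGroup F] [InnerProductSpace ℝ F] (K : E →L[ℝ] F) (u : ι → E) (v : ι → F) :
    Prop where
  summable : Summable fun i => ‖u i‖ * ‖v i‖
  hasSum : ∀ x, HasSum (fun i => ⟪u i, x⟫_ℝ • v i) (K x)

lemma summable_minor {E ι : Type*} [NormedAddCommGroup E] [InnerProductSpace ℝ E]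
    [FiniteDimensional ℝ E] [DecidableEq ι] {u v : ι → E}
    (h : Summable fun i => ‖u i‖ * ‖v i‖) : Summable (minor u v) :=
  Summable.of_norm_bounded
    (summable_finsetProd_of_summable_nonneg (fun _ => by positivity) h) (abs_minor_le u v)

/-- The expansion over finite index sets passes to the limit by absolute summability. Its terms see
the operator only through the numbers `⟪u i, v j⟫`, so it keeps its meaning when the underlying
space varies or has infinite dimension. -/
lemma NuclearRep.det_one_add {E ι : Type*} [NormedAddCommGroup E] [InnerProductSpace ℝ E]
    [FiniteDimensional ℝ E] [DecidableEq ι] {K : E →L[ℝ] E} {u v : ι → E}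
    (h : NuclearRep K u v) :
    LinearMap.det ((1 + K : E →L[ℝ] E) : E →ₗ[ℝ] E) = ∑' S, minor u v S := by
  have h1 := (summable_minor h.summable).hasSum.comp
    Filter.tendsto_finset_powerset_atTop_atTop
  have h2 : Filter.Tendsto (fun s => LinearMap.det
      ((1 + sumRankOne u v s : E →L[ℝ] E) : E →ₗ[ℝ] E)) Filter.atTop
      (nhds (LinearMap.det ((1 + K : E →L[ℝ] E) : E →ₗ[ℝ] E))) := by
    refine tendsto_det fun x => ?_
    simp only [_root_.add_apply, sumRankOne_apply]
    exact tendsto_const_nhds.add (h.hasSum x)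
  refine tendsto_nhds_unique h2 (h1.congr fun s => ?_)
  exact (det_one_add_sumRankOne u v s).symm

/-- Convergence of the determinants `det (1 + K_a)` of nuclear operators on finite dimensional
spaces when the numbers `⟪uᵢ, vⱼ⟫` converge. -/
lemma tendsto_det_one_add {α ι E : Type*} [DecidableEq ι] {l : Filter α} {V : α → Type*}
    [∀ a, NormedAddCommGroup (V a)] [∀ a, InnerProductSpace ℝ (V a)]
    [∀ a, FiniteDimensional ℝ (V a)] [NormedAddCommGroup E] [InnerProductSpace ℝ E]
    {K : ∀ a, V a →L[ℝ] V a} {u v : ∀ a, ι → V a} (h : ∀ a, NuclearRep (K a) (u a) (v a))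
    {c : ι → ℝ} (hc : Summable c) (hb : ∀ a i, ‖u a i‖ * ‖v a i‖ ≤ c i) {u' v' : ι → E}
    (hlim : ∀ i j, Filter.Tendsto (fun a => ⟪u a i, v a j⟫_ℝ) l (nhds ⟪u' i, v' j⟫_ℝ)) :
    Filter.Tendsto (fun a => LinearMap.det ((1 + K a : V a →L[ℝ] V a) : V a →ₗ[ℝ] V a)) l
      (nhds (∑' S, minor u' v' S)) := by
  rcases isEmpty_or_nonempty α with hα | ⟨⟨a₀⟩⟩
  · rw [Filter.filter_eq_bot_of_isEmpty l]; exact Filter.tendsto_bot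
  have hc0 : ∀ i, 0 ≤ c i := fun i => le_trans (by positivity) (hb a₀ i)
  simp_rw [fun a => (h a).det_one_add]
  -- Each minor converges as a polynomial in finitely many inner products, and is dominated by `∏ i
  -- ∈ S, c i`, which is summable over finite sets `S`.
  refine tendsto_tsum_of_dominated_convergence
    (summable_finsetProd_of_summable_nonneg hc0 hc) (fun S => ?_)
    (Filter.Eventually.of_forall fun a S => ?_)
  · refine ((continuous_id.matrix_det).tendsto _).comp ?_
    exact tendsto_pi_nhds.2 fun i => tendsto_pi_nhds.2 fun j => hlim i j
  · exact (abs_minor_le _ _ S).trans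
      (Finset.prod_le_prod (fun i _ => by positivity) fun i _ => hb a i)

end InfiniteExpansion

/-! ### Nuclear operators. -/

section Nuclear

variable {D E F : Type*} [NormedAddCommGroup D] [InnerProductSpace ℝ D]
  [NormedAddCommGroup E] [InnerProductSpace ℝ E] [NormedAddCommGroup F] [InnerProductSpace ℝ F]

namespace NuclearRep

variable {ι κ : Type*}

lemma add {K L : E →L[ℝ] F} {u : ι → E} {v : ι → F} {u' : κ → E} {v' : κ → F}
    (h : NuclearRep K u v) (h' : NuclearRep L u' v') :
    NuclearRep (K + L) (Sum.elim u u') (Sum.elim v v') where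
  summable := (HasSum.sum (by exact h.summable.hasSum) (by exact h'.summable.hasSum)).summable
  hasSum x := HasSum.sum (by exact h.hasSum x) (by exact h'.hasSum x)

lemma comp_left {K : D →L[ℝ] E} {u : ι → D} {v : ι → E} (h : NuclearRep K u v) (A : E →L[ℝ] F) :
    NuclearRep (A ∘L K) u (fun i => A (v i)) where
  summable := (h.summable.mul_left ‖A‖).of_nonneg_of_le (fun _ => by positivity) fun i => by
    calc ‖u i‖ * ‖A (v i)‖ ≤ ‖u i‖ * (‖A‖ * ‖v i‖) := by gcongr; exact A.le_opNorm _
      _ = ‖A‖ * (‖u i‖ * ‖v i‖) := by ring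
  hasSum x := by
    have := A.hasSum (h.hasSum x)
    simpa using this

lemma comp_right [CompleteSpace D] [CompleteSpace E] {K : E →L[ℝ] F} {u : ι → E} {v : ι → F}
    (h : NuclearRep K u v) (A : D →L[ℝ] E) :
    NuclearRep (K ∘L A) (fun i => ContinuousLinearMap.adjoint A (u i)) v where
  summable := (h.summable.mul_left ‖A‖).of_nonneg_of_le (fun _ => by positivity) fun i => by
    calc ‖ContinuousLinearMap.adjoint A (u i)‖ * ‖v i‖ ≤ (‖A‖ * ‖u i‖) * ‖v i‖ := by
          gcongr
          rw [← ContinuousLinearMap.adjoint.norm_map A]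
          exact ContinuousLinearMap.le_opNorm _ _
      _ = ‖A‖ * (‖u i‖ * ‖v i‖) := by ring
  hasSum x := by
    have := h.hasSum (A x)
    simpa only [ContinuousLinearMap.adjoint_inner_left, ContinuousLinearMap.comp_apply] using this

lemma reindex {K : E →L[ℝ] F} {u : ι → E} {v : ι → F} (h : NuclearRep K u v) (e : κ ≃ ι) :
    NuclearRep K (u ∘ e) (v ∘ e) where
  summable := (e.summable_iff (f := fun i => ‖u i‖ * ‖v i‖)).2 h.summable
  hasSum x := (e.hasSum_iff (f := fun i => ⟪u i, x⟫_ℝ • v i)).2 (h.hasSum x)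

end NuclearRep

/-- Nuclear operators between Hilbert spaces. -/
def IsNuclear (K : E →L[ℝ] F) : Prop := ∃ (u : ℕ → E) (v : ℕ → F), NuclearRep K u v

lemma isNuclear_iff_isTraceClass {K : E →L[ℝ] E} : IsNuclear K ↔ IsTraceClass K :=
  ⟨fun ⟨u, v, h⟩ => ⟨u, v, h.summable, h.hasSum⟩, fun ⟨u, v, h, h'⟩ => ⟨u, v, h, h'⟩⟩

namespace IsNuclear

lemma zero : IsNuclear (0 : E →L[ℝ] F) :=
  ⟨0, 0, by simp, fun x => by simp⟩

lemma add {K L : E →L[ℝ] F} (hK : IsNuclear K) (hL : IsNuclear L) : IsNuclear (K + L) := by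
  obtain ⟨u, v, h⟩ := hK
  obtain ⟨u', v', h'⟩ := hL
  exact ⟨_, _, (h.add h').reindex Equiv.natSumNatEquivNat.symm⟩

lemma comp_left {K : D →L[ℝ] E} (hK : IsNuclear K) (A : E →L[ℝ] F) : IsNuclear (A ∘L K) := by
  obtain ⟨u, v, h⟩ := hK
  exact ⟨_, _, h.comp_left A⟩

lemma comp_right [CompleteSpace D] [CompleteSpace E] {K : E →L[ℝ] F} (hK : IsNuclear K)
    (A : D →L[ℝ] E) : IsNuclear (K ∘L A) := by
  obtain ⟨u, v, h⟩ := hK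
  exact ⟨_, _, h.comp_right A⟩

lemma smul {K : E →L[ℝ] F} (hK : IsNuclear K) (c : ℝ) : IsNuclear (c • K) := by
  have := hK.comp_left (c • ContinuousLinearMap.id ℝ F)
  rwa [ContinuousLinearMap.smul_comp, ContinuousLinearMap.id_comp] at this

lemma neg {K : E →L[ℝ] F} (hK : IsNuclear K) : IsNuclear (-K) := by
  simpa using hK.smul (-1)

lemma sub {K L : E →L[ℝ] F} (hK : IsNuclear K) (hL : IsNuclear L) : IsNuclear (K - L) := by
  simpa [sub_eq_add_neg] using hK.add hL.neg

lemma mul_left {K : E →L[ℝ] E} (hK : IsNuclear K) (A : E →L[ℝ] E) : IsNuclear (A * K) :=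
  hK.comp_left A

lemma mul_right [CompleteSpace E] {K : E →L[ℝ] E} (hK : IsNuclear K) (A : E →L[ℝ] E) :
    IsNuclear (K * A) :=
  hK.comp_right A

lemma mul_sub_one [CompleteSpace E] {A B : E →L[ℝ] E} (hA : IsNuclear (A - 1))
    (hB : IsNuclear (B - 1)) : IsNuclear (A * B - 1) := by
  have : A * B - 1 = (A - 1) * B + (B - 1) := by noncomm_ring
  rw [this]
  exact (hA.mul_right B).add hB

end IsNuclear

end Nuclear

/-! ### Compressions to finite-dimensional subspaces. -/

section Compression

variable {H : Type*} [NormedAddCommGroup H] [InnerProductSpace ℝ H]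

/-- The compression `P_F A|_F`. -/
def compression (F : FinSub H) (A : H →L[ℝ] H) : F.1 →L[ℝ] F.1 :=
  F.1.orthogonalProjectionOnto ∘L A ∘L F.1.subtypeL

lemma compressionDet_eq (A : H →L[ℝ] H) (F : FinSub H) :
    compressionDet A F = LinearMap.det (compression F A : F.1 →ₗ[ℝ] F.1) := rfl

lemma compression_apply (F : FinSub H) (A : H →L[ℝ] H) (x : F.1) :
    compression F A x = F.1.orthogonalProjectionOnto (A x) := rfl

lemma compression_one (F : FinSub H) : compression F (1 : H →L[ℝ] H) = 1 := by
  ext x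
  simp [compression_apply]

lemma compression_add (F : FinSub H) (A B : H →L[ℝ] H) :
    compression F (A + B) = compression F A + compression F B := by
  ext x
  simp [compression_apply]

lemma inner_compression (F : FinSub H) (A : H →L[ℝ] H) (x y : F.1) :
    ⟪compression F A x, y⟫_ℝ = ⟪A x, (y : H)⟫_ℝ := by
  rw [compression_apply, Submodule.inner_orthogonalProjectionOnto_eq_of_mem_right]

lemma norm_compression_le (F : FinSub H) (A : H →L[ℝ] H) : ‖compression F A‖ ≤ ‖A‖ := by
  refine ContinuousLinearMap.opNorm_le_bound _ (norm_nonneg _) fun x => ?_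
  rw [compression_apply]
  exact (Submodule.norm_orthogonalProjectionOnto_apply_le _ _).trans (A.le_opNorm _)

lemma NuclearRep.compression {ι : Type*} {K : H →L[ℝ] H} {u v : ι → H} (h : NuclearRep K u v)
    (F : FinSub H) : NuclearRep (compression F K) (fun i => F.1.orthogonalProjectionOnto (u i))
      (fun i => F.1.orthogonalProjectionOnto (v i)) where
  summable := h.summable.of_nonneg_of_le (fun _ => by positivity) fun i => by
    gcongr <;> exact Submodule.norm_orthogonalProjectionOnto_apply_le _ _
  hasSum x := by
    have := F.1.orthogonalProjectionOnto.hasSum (h.hasSum x)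
    simp only [Submodule.inner_orthogonalProjectionOnto_eq_of_mem_right]
    simpa [compression_apply] using this

lemma tendsto_starProjection_of_tendsto {z : FinSub H → H} {w : H}
    (h : Filter.Tendsto z Filter.atTop (nhds w)) :
    Filter.Tendsto (fun F : FinSub H => F.1.starProjection (z F)) Filter.atTop (nhds w) := by
  have h0 : Filter.Tendsto (fun F : FinSub H => F.1.starProjection (z F - w)) Filter.atTop
      (nhds 0) := by
    refine squeeze_zero_norm (a := fun F => ‖z F - w‖) (fun F => ?_) ?_
    · exact Submodule.norm_starProjection_apply_le _ _
    · exact tendsto_iff_norm_sub_tendsto_zero.1 h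
  have := h0.add (tendsto_starProjection_finSub w)
  simpa using this

lemma tendsto_inner_projection {x y : FinSub H → H} {x₀ y₀ : H}
    (hx : Filter.Tendsto x Filter.atTop (nhds x₀)) (hy : Filter.Tendsto y Filter.atTop (nhds y₀)) :
    Filter.Tendsto (fun F : FinSub H => ⟪F.1.orthogonalProjectionOnto (x F),
      F.1.orthogonalProjectionOnto (y F)⟫_ℝ) Filter.atTop (nhds ⟪x₀, y₀⟫_ℝ) :=
  (tendsto_starProjection_of_tendsto hx).inner (tendsto_starProjection_of_tendsto hy)

end Compression

/-! ### Existence and multiplicativity of Fredholm determinants. -/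

section FredholmDet

variable {H : Type*} [NormedAddCommGroup H] [InnerProductSpace ℝ H]

/-- The compressions are represented by the projected vectors, which are no longer than the original
ones and whose inner products converge to the original ones. -/
lemma NuclearRep.hasFredholmDet {ι : Type*} [DecidableEq ι] {K : H →L[ℝ] H} {u v : ι → H}
    (h : NuclearRep K u v) : HasFredholmDet (1 + K) (∑' S, minor u v S) := by
  have := tendsto_det_one_add (l := Filter.atTop) (fun F : FinSub H => h.compression F)
    h.summable (fun F i => by
      gcongr <;> exact Submodule.norm_orthogonalProjectionOnto_apply_le _ _)
    (fun i j => tendsto_inner_projection (x₀ := u i) (y₀ := v j) tendsto_const_nhds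
      tendsto_const_nhds)
  refine this.congr fun F => ?_
  rw [compressionDet_eq, compression_add, compression_one]

lemma HasFredholmDet.fredholmDet_eq {A : H →L[ℝ] H} {d : ℝ} (h : HasFredholmDet A d) :
    fredholmDet A = d :=
  Filter.Tendsto.limUnder_eq h

lemma NuclearRep.fredholmDet_one_add {ι : Type*} [DecidableEq ι] {K : H →L[ℝ] H} {u v : ι → H}
    (h : NuclearRep K u v) : fredholmDet (1 + K) = ∑' S, minor u v S :=
  h.hasFredholmDet.fredholmDet_eq

lemma IsNuclear.hasFredholmDet {A : H →L[ℝ] H} (h : IsNuclear (A - 1)) :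
    HasFredholmDet A (fredholmDet A) := by
  obtain ⟨u, v, h⟩ := h
  have h1 := h.hasFredholmDet
  rw [add_sub_cancel] at h1
  rwa [h1.fredholmDet_eq]

/-- Compression is not multiplicative, but the minors of the product of the compressions still
converge to those of `A * L`. This gives multiplicativity through `A B = 1 + (A - 1) + A (B - 1)`,
and the limit of `det (1 - Z P)` over compressions. -/
lemma tendsto_det_compression_add_mul {K L : H →L[ℝ] H} (hK : IsNuclear K) (hL : IsNuclear L)
    (A : H →L[ℝ] H) :
    Filter.Tendsto (fun F : FinSub H => LinearMap.det
      ((1 + (compression F K + compression F A * compression F L) : F.1 →L[ℝ] F.1) :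
        F.1 →ₗ[ℝ] F.1)) Filter.atTop (nhds (fredholmDet (1 + (K + A * L)))) := by
  obtain ⟨u, v, h⟩ := hK
  obtain ⟨u', v', h'⟩ := hL
  rw [show A * L = A ∘L L from rfl, (h.add (h'.comp_left A)).fredholmDet_one_add]
  refine tendsto_det_one_add (c := Sum.elim (fun i => ‖u i‖ * ‖v i‖)
    fun i => ‖A‖ * (‖u' i‖ * ‖v' i‖))
    (fun F : FinSub H => (h.compression F).add ((h'.compression F).comp_left (compression F A)))
    ?_ ?_ ?_
  · exact (HasSum.sum (by exact h.summable.hasSum)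
      (by exact (h'.summable.mul_left ‖A‖).hasSum)).summable
  · rintro F (i | i)
    · simp only [Sum.elim_inl]
      gcongr <;> exact Submodule.norm_orthogonalProjectionOnto_apply_le _ _
    · simp only [Sum.elim_inr]
      calc _ ≤ ‖u' i‖ * (‖A‖ * ‖v' i‖) := by
            gcongr
            · exact Submodule.norm_orthogonalProjectionOnto_apply_le _ _
            · refine (ContinuousLinearMap.le_opNorm _ _).trans ?_
              gcongr
              · exact norm_compression_le F A
              · exact Submodule.norm_orthogonalProjectionOnto_apply_le _ _
        _ = _ := by ring
  · have hA : ∀ j, Filter.Tendsto (fun F : FinSub H => A (F.1.starProjection (v' j))) Filter.atTop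
        (nhds (A (v' j))) := fun j => (A.continuous.tendsto _).comp (tendsto_starProjection_finSub _)
    rintro (i | i) (j | j)
    · exact tendsto_inner_projection tendsto_const_nhds tendsto_const_nhds
    · exact tendsto_inner_projection tendsto_const_nhds (hA j)
    · exact tendsto_inner_projection tendsto_const_nhds tendsto_const_nhds
    · exact tendsto_inner_projection tendsto_const_nhds (hA j)

lemma tendsto_det_one_sub_compression_mul {P : H →L[ℝ] H} (hP : IsNuclear P) (Z : H →L[ℝ] H) :
    Filter.Tendsto (fun F : FinSub H => LinearMap.det
      ((1 - compression F Z * compression F P : F.1 →L[ℝ] F.1) : F.1 →ₗ[ℝ] F.1)) Filter.atTop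
      (nhds (fredholmDet (1 - Z * P))) := by
  have h := tendsto_det_compression_add_mul IsNuclear.zero hP (-Z)
  have h1 : 1 + (0 + -Z * P) = 1 - Z * P := by noncomm_ring
  rw [h1] at h
  refine h.congr fun F => ?_
  have h2 : compression F (0 : H →L[ℝ] H) = 0 := by ext x; simp [compression_apply]
  have h3 : compression F (-Z) = -compression F Z := by ext x; simp [compression_apply]
  have h4 : -compression F Z * compression F P = -(compression F Z * compression F P) :=
    ContinuousLinearMap.neg_comp _ _
  rw [h2, h3, zero_add, h4, sub_eq_add_neg]

lemma fredholmDet_mul {A B : H →L[ℝ] H} (hA : IsNuclear (A - 1)) (hB : IsNuclear (B - 1)) :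
    fredholmDet (A * B) = fredholmDet A * fredholmDet B := by
  have h := tendsto_det_compression_add_mul hA hB A
  have h1 : 1 + ((A - 1) + A * (B - 1)) = A * B := by noncomm_ring
  rw [h1] at h
  refine tendsto_nhds_unique h ((hA.hasFredholmDet.mul hB.hasFredholmDet).congr fun F => ?_)
  rw [compressionDet_eq, compressionDet_eq, ← det_mul_clm]
  congr 2
  obtain ⟨K, rfl⟩ : ∃ K, A = 1 + K := ⟨A - 1, by abel⟩
  obtain ⟨L, rfl⟩ : ∃ L, B = 1 + L := ⟨B - 1, by abel⟩
  simp only [add_sub_cancel_left, compression_add, compression_one]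
  noncomm_ring

lemma fredholmDet_one : fredholmDet (1 : H →L[ℝ] H) = 1 := by
  refine HasFredholmDet.fredholmDet_eq (tendsto_const_nhds.congr fun F => ?_)
  rw [compressionDet_eq, compression_one]
  exact LinearMap.det_id.symm

/-- Moving `V` across the inner product by its adjoint shows that both sides have the same minors,
although they live on different spaces. -/
lemma fredholmDet_one_add_comm {E F : Type*} [NormedAddCommGroup E] [InnerProductSpace ℝ E]
    [NormedAddCommGroup F] [InnerProductSpace ℝ F] [CompleteSpace E] [CompleteSpace F]
    {U : E →L[ℝ] F} (hU : IsNuclear U) (V : F →L[ℝ] E) :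
    fredholmDet (1 + V ∘L U) = fredholmDet (1 + U ∘L V) := by
  obtain ⟨u, v, h⟩ := hU
  rw [(h.comp_left V).fredholmDet_one_add, (h.comp_right V).fredholmDet_one_add]
  refine tsum_congr fun S => ?_
  simp only [minor, ContinuousLinearMap.adjoint_inner_left]

end FredholmDet

/-! ### Gaussian vectors of the Fock space -/

section Contractions

variable {H : Type*} [NormedAddCommGroup H] [InnerProductSpace ℝ H]

/-- A symmetric operator of norm less than one. -/
structure IsSymContraction (T : H →L[ℝ] H) : Prop where
  symm : ∀ x y : H, ⟪T x, y⟫_ℝ = ⟪x, T y⟫_ℝ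
  norm_lt_one : ‖T‖ < 1

lemma IsSymContraction.zero : IsSymContraction (0 : H →L[ℝ] H) := ⟨by simp, by simp⟩

lemma IsSymContraction.compression {T : H →L[ℝ] H} (hT : IsSymContraction T) (F : FinSub H) :
    IsSymContraction (compression F T) where
  symm x y := by
    rw [inner_compression, hT.symm, ← real_inner_comm, ← inner_compression, real_inner_comm]
  norm_lt_one := (norm_compression_le F T).trans_lt hT.norm_lt_one

lemma exists_eq_add_apply [CompleteSpace H] {T : H →L[ℝ] H} (hT : ‖T‖ < 1) (w : H) :
    ∃ s, s = w + T s := by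
  have h := Ring.mul_inverse_cancel _ (isUnit_one_sub_of_norm_lt_one hT)
  refine ⟨Ring.inverse (1 - T) w, ?_⟩
  have := congrArg (fun A : H →L[ℝ] H => A w) h
  simp only [mul_apply_eq_comp, _root_.sub_apply, one_apply_eq_self] at this
  rw [← sub_eq_iff_eq_add]
  exact this

lemma norm_mul_lt_one {Z P : H →L[ℝ] H} (hZ : ‖Z‖ < 1) (hP : ‖P‖ < 1) : ‖Z * P‖ < 1 :=
  (norm_mul_le Z P).trans_lt (mul_lt_one_of_nonneg_of_lt_one_left (norm_nonneg _) hZ hP.le)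

lemma exists_pair [CompleteSpace H] {Z P : H →L[ℝ] H} (hZ : ‖Z‖ < 1) (hP : ‖P‖ < 1) (a b : H) :
    ∃ s t, t = a + Z s ∧ s = b + P t := by
  obtain ⟨s, hs⟩ := exists_eq_add_apply (norm_mul_lt_one hP hZ) (b + P a)
  refine ⟨s, a + Z s, rfl, ?_⟩
  rw [map_add, ← add_assoc]
  exact hs

/-- The solutions of `t = a + Z s`, `s = b + P t` are the limits of the solutions of the
compressed equations. -/
lemma tendsto_pair {Z P : H →L[ℝ] H} (hZ : ‖Z‖ < 1) (hP : ‖P‖ < 1) {a b s t : H}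
    (ht : t = a + Z s) (hs : s = b + P t) {s' t' : ∀ F : FinSub H, F.1}
    (ht' : ∀ F, t' F = F.1.orthogonalProjectionOnto a + compression F Z (s' F))
    (hs' : ∀ F, s' F = F.1.orthogonalProjectionOnto b + compression F P (t' F)) :
    Filter.Tendsto (fun F => (s' F : H)) Filter.atTop (nhds s) ∧
      Filter.Tendsto (fun F => (t' F : H)) Filter.atTop (nhds t) := by
  set q := max ‖Z‖ ‖P‖ with hq
  have hq1 : q < 1 := max_lt hZ hP
  -- The error in each variable is at most `q` times the error in the other plus a projection error.
  -- Adding the two estimates and absorbing with `q < 1` bounds the total error by projection errors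
  -- alone.
  have hone : ∀ (A : H →L[ℝ] H) (c y : H) (F : FinSub H) (y' : F.1) (z z' : H), ‖A‖ ≤ q →
      z = c + A y → z' = (F.1.orthogonalProjectionOnto c + compression F A y' : F.1) →
      ‖z' - z‖ ≤ q * ‖(y' : H) - y‖ + ‖F.1.starProjection z - z‖ := by
    intro A c y F y' z z' hA hz hz'
    have h1 : z' - z = F.1.starProjection (A ((y' : H) - y)) + (F.1.starProjection z - z) := by
      have e1 : z' = F.1.starProjection c + F.1.starProjection (A y') := by rw [hz']; rfl
      have e2 : F.1.starProjection z = F.1.starProjection c + F.1.starProjection (A y) := by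
        rw [hz, map_add]
      rw [e1, e2, map_sub, map_sub]
      abel
    rw [h1]
    refine (norm_add_le _ _).trans ?_
    gcongr
    refine (Submodule.norm_starProjection_apply_le _ _).trans ((A.le_opNorm _).trans ?_)
    gcongr
  have hbound : ∀ F : FinSub H, ‖(s' F : H) - s‖ + ‖(t' F : H) - t‖ ≤
      (‖F.1.starProjection s - s‖ + ‖F.1.starProjection t - t‖) / (1 - q) := by
    intro F
    rw [le_div_iff₀ (by linarith)]
    have h1 := hone P b t F (t' F) s (s' F) (le_max_right _ _) hs (congrArg Subtype.val (hs' F))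
    have h2 := hone Z a s F (s' F) t (t' F) (le_max_left _ _) ht (congrArg Subtype.val (ht' F))
    linarith
  have hlim : Filter.Tendsto (fun F : FinSub H =>
      (‖F.1.starProjection s - s‖ + ‖F.1.starProjection t - t‖) / (1 - q)) Filter.atTop
      (nhds 0) := by
    have := ((tendsto_iff_norm_sub_tendsto_zero.1 (tendsto_starProjection_finSub s)).add
      (tendsto_iff_norm_sub_tendsto_zero.1 (tendsto_starProjection_finSub t))).div_const (1 - q)
    simpa using this
  constructor <;> rw [tendsto_iff_norm_sub_tendsto_zero] <;>
    refine squeeze_zero (fun _ => norm_nonneg _) (fun F => le_trans ?_ (hbound F)) hlim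
  · exact le_add_of_nonneg_right (norm_nonneg _)
  · exact le_add_of_nonneg_left (norm_nonneg _)

lemma isNuclear_inverse_sub_one {A : H →L[ℝ] H} (h : IsNuclear (A - 1)) (hA : IsUnit A) :
    IsNuclear (Ring.inverse A - 1) := by
  have : Ring.inverse A - 1 = -(Ring.inverse A * (A - 1)) := by
    rw [mul_sub, Ring.inverse_mul_cancel _ hA, mul_one, neg_sub]
  rw [this]
  exact (h.mul_left _).neg

lemma fredholmDet_mul_inverse {A : H →L[ℝ] H} (h : IsNuclear (A - 1)) (hA : IsUnit A) :
    fredholmDet A * fredholmDet (Ring.inverse A) = 1 := by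
  rw [← fredholmDet_mul h (isNuclear_inverse_sub_one h hA), Ring.mul_inverse_cancel _ hA,
    fredholmDet_one]

lemma fredholmDet_ne_zero {A : H →L[ℝ] H} (h : IsNuclear (A - 1)) (hA : IsUnit A) :
    fredholmDet A ≠ 0 :=
  left_ne_zero_of_mul_eq_one (fredholmDet_mul_inverse h hA)

variable [CompleteSpace H]

/-- As a limit of positive determinants it is nonnegative; it does not vanish because `1 - Z * P` is
invertible and the determinant is multiplicative. -/
lemma fredholmDet_one_sub_mul_pos {Z P : H →L[ℝ] H} (hZ : IsSymContraction Z)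
    (hP : IsSymContraction P) (hn : IsNuclear P) : 0 < fredholmDet (1 - Z * P) := by
  refine lt_of_le_of_ne ?_ (Ne.symm ?_)
  · refine ge_of_tendsto' (tendsto_det_one_sub_compression_mul hn Z) fun F => ?_
    exact (det_one_sub_mul_pos (hZ.compression F).norm_lt_one (hP.compression F).norm_lt_one
      (hZ.compression F).symm (hP.compression F).symm).le
  · refine fredholmDet_ne_zero ?_ (isUnit_one_sub_of_norm_lt_one
      (norm_mul_lt_one hZ.norm_lt_one hP.norm_lt_one))
    have := (hn.mul_left Z).neg
    rwa [sub_sub_cancel_left]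

end Contractions

section GaussianVectors

variable {H : Type*} [NormedAddCommGroup H] [InnerProductSpace ℝ H] [CompleteSpace H]

/-- `G` is the vector of the Fock space with generating function
`exp (½ ⟪T x, x⟫ + ⟪w, x⟫)`. -/
def IsGaussian (T : H →L[ℝ] H) (w : H) (G : Fock H) : Prop :=
  ∀ x, ⟪expo x, G⟫_ℝ = Real.exp ((1 / 2) * ⟪T x, x⟫_ℝ + ⟪w, x⟫_ℝ)

/-- A Hilbert space with Gaussian vectors that have the same inner products with exponential
vectors as the Gaussian vectors of the Fock space. -/
lemma exists_compressed_model.{u} {H : Type u} [NormedAddCommGroup H] [InnerProductSpace ℝ H]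
    [CompleteSpace H] (F : FinSub H) :
    ∃ (𝓚 : Type u) (_ : NormedAddCommGroup 𝓚) (_ : InnerProductSpace ℝ 𝓚) (_ : CompleteSpace 𝓚)
      (e : F.1 → 𝓚) (g : (H →L[ℝ] H) → H → 𝓚), IsTotal e ∧
      (∀ x y : F.1, ⟪expo (x : H), expo (y : H)⟫_ℝ = ⟪e x, e y⟫_ℝ) ∧
      (∀ T : H →L[ℝ] H, IsSymContraction T → ∀ (w : H) (x : F.1),
        ⟪e x, g T w⟫_ℝ = Real.exp ((1 / 2) * ⟪T x, (x : H)⟫_ℝ + ⟪w, (x : H)⟫_ℝ)) ∧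
      ∀ Z P : H →L[ℝ] H, IsSymContraction Z → IsSymContraction P → ∀ (a b : H) (s t : F.1),
        t = F.1.orthogonalProjectionOnto a + compression F Z s →
        s = F.1.orthogonalProjectionOnto b + compression F P t →
        ⟪g Z a, g P b⟫_ℝ = (√(LinearMap.det
          ((1 - compression F Z * compression F P : F.1 →L[ℝ] F.1) : F.1 →ₗ[ℝ] F.1)))⁻¹ *
          Real.exp ((1 / 2) * (⟪a, (s : H)⟫_ℝ + ⟪b, (t : H)⟫_ℝ)) := by
  obtain ⟨𝓚, i₁, i₂, i₃, g, htot, hg⟩ := exists_gaussian_model F.1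
  have h0 : IsSymContraction (0 : F.1 →L[ℝ] F.1) := .zero
  -- Coherent vectors are the Gaussian vectors with zero quadratic part, so all three pairings are
  -- instances of one formula.
  refine ⟨𝓚, i₁, i₂, i₃, g 0, fun T w => g (compression F T) (F.1.orthogonalProjectionOnto w),
    htot, fun x y => ?_, fun T hT w x => ?_, fun Z P hZ hP a b s t ht hs => ?_⟩
  · rw [hg h0.norm_lt_one h0.norm_lt_one h0.symm h0.symm (a := x) (b := y) (s := y) (t := x)
      (by simp) (by simp), inner_expo_expo]
    simp only [mul_zero, sub_zero]
    rw [real_inner_comm (x : F.1) y]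
    simp [← Submodule.coe_inner]
    ring
  · have hc := hT.compression F
    rw [hg h0.norm_lt_one hc.norm_lt_one h0.symm hc.symm (a := x)
      (b := F.1.orthogonalProjectionOnto w)
      (s := F.1.orthogonalProjectionOnto w + compression F T x) (t := x) (by simp) rfl]
    simp only [zero_mul, sub_zero]
    rw [show LinearMap.det ((1 : F.1 →L[ℝ] F.1) : F.1 →ₗ[ℝ] F.1) = 1 from LinearMap.det_id,
      inner_add_right, real_inner_comm (F.1.orthogonalProjectionOnto w) x,
      real_inner_comm (compression F T x) x, inner_compression,
      Submodule.inner_orthogonalProjectionOnto_eq_of_mem_right]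
    simp only [Real.sqrt_one, inv_one, one_mul]
    congr 1
    ring
  · have hc := hZ.compression F
    have hd := hP.compression F
    rw [hg hc.norm_lt_one hd.norm_lt_one hc.symm hd.symm ht hs,
      Submodule.inner_orthogonalProjectionOnto_eq_of_mem_right,
      Submodule.inner_orthogonalProjectionOnto_eq_of_mem_right]

/-- The inner product of two Gaussian vectors. -/
lemma IsGaussian.inner {Z P : H →L[ℝ] H} {a b s t : H} {G G' : Fock H} (hG : IsGaussian Z a G)
    (hG' : IsGaussian P b G') (hZ : IsSymContraction Z) (hP : IsSymContraction P)
    (hn : IsNuclear P) (ht : t = a + Z s) (hs : s = b + P t) :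
    ⟪G, G'⟫_ℝ = (√(fredholmDet (1 - Z * P)))⁻¹ *
      Real.exp ((1 / 2) * (⟪a, s⟫_ℝ + ⟪b, t⟫_ℝ)) := by
  choose s' t' ht' hs' using fun F : FinSub H => exists_pair (hZ.compression F).norm_lt_one
    (hP.compression F).norm_lt_one (F.1.orthogonalProjectionOnto a) (F.1.orthogonalProjectionOnto b)
  obtain ⟨hs1, ht1⟩ := tendsto_pair hZ.norm_lt_one hP.norm_lt_one ht hs ht' hs'
  have hd := (fredholmDet_one_sub_mul_pos hZ hP hn)
  have h1 : Filter.Tendsto (fun F : FinSub H => (√(LinearMap.det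
      ((1 - compression F Z * compression F P : F.1 →L[ℝ] F.1) : F.1 →ₗ[ℝ] F.1)))⁻¹ *
      Real.exp ((1 / 2) * (⟪a, (s' F : H)⟫_ℝ + ⟪b, (t' F : H)⟫_ℝ))) Filter.atTop
      (nhds ((√(fredholmDet (1 - Z * P)))⁻¹ *
        Real.exp ((1 / 2) * (⟪a, s⟫_ℝ + ⟪b, t⟫_ℝ)))) := by
    refine Filter.Tendsto.mul ?_ ?_
    · exact ((Real.continuous_sqrt.tendsto _).comp
        (tendsto_det_one_sub_compression_mul hn Z)).inv₀ (Real.sqrt_ne_zero'.2 hd)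
    · refine (Real.continuous_exp.tendsto _).comp (Filter.Tendsto.const_mul _ ?_)
      exact (tendsto_const_nhds.inner hs1).add (tendsto_const_nhds.inner ht1)
  -- Over each `F` the projections of `G` and `G'` have the inner product of their model vectors,
  -- because the pairings with coherent vectors agree.
  refine tendsto_nhds_unique (tendsto_inner_starProjection_expoSpan G G') (h1.congr fun F => ?_)
  obtain ⟨𝓚, i₁, i₂, i₃, e, g, htot, hee, heg, hgg⟩ := exists_compressed_model F
  rw [← hgg Z P hZ hP a b (s' F) (t' F) (ht' F) (hs' F)]
  symm
  refine inner_starProjection_eq (E := fun x : F.1 => expo (x : H)) htot hee (fun x => ?_)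
    fun x => ?_
  · rw [heg Z hZ, hG]
  · rw [heg P hP, hG']

/-- Centred Gaussian vectors exist for nuclear symmetric contractions. -/
lemma exists_isGaussian {T : H →L[ℝ] H} (hT : IsSymContraction T) (hn : IsNuclear T) :
    ∃ G, IsGaussian T 0 G := by
  set d := fredholmDet (1 - T * T) with hd
  have hd0 : 0 < d := fredholmDet_one_sub_mul_pos hT hT hn
  -- From `F₀` on the compressed determinants are at least `d / 2`, so the model vectors have
  -- squared norm at most `1 / √(d / 2)`. This bound, independent of `F`, is what Riesz
  -- representation needs; `F` is then enlarged to contain the support of `c`.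
  obtain ⟨F₀, hF₀⟩ := Filter.eventually_atTop.1
    ((tendsto_det_one_sub_compression_mul hn T).eventually_const_le (half_lt_self hd0))
  refine isTotal_expo.exists_vector (fun x => Real.exp ((1 / 2) * ⟪T x, x⟫_ℝ + ⟪0, x⟫_ℝ))
    (√(√(d / 2))⁻¹) fun c => ?_
  obtain ⟨F, hF1, hF2⟩ := exists_ge_ge F₀
    (⟨Submodule.span ℝ (c.support : Set H), inferInstance⟩ : FinSub H)
  have hsub : (c.support : Set H) ⊆ Set.range (fun x : F.1 => (x : H)) := by
    intro x hx
    exact ⟨⟨x, hF2 (Submodule.subset_span hx)⟩, rfl⟩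
  have hinj : Function.Injective (fun x : F.1 => (x : H)) := Subtype.val_injective
  obtain ⟨c', hc'⟩ : ∃ c' : F.1 →₀ ℝ, Finsupp.mapDomain (fun x : F.1 => (x : H)) c' = c :=
    ⟨_, Finsupp.mapDomain_comapDomain _ hinj c hsub⟩
  obtain ⟨𝓚, i₁, i₂, i₃, e, g, htot, hee, heg, hgg⟩ := exists_compressed_model F
  rw [← hc', Finsupp.linearCombination_mapDomain, Finsupp.linearCombination_mapDomain]
  have h1 : Finsupp.linearCombination ℝ ((fun x : H =>
      Real.exp ((1 / 2) * ⟪T x, x⟫_ℝ + ⟪0, x⟫_ℝ)) ∘ fun x : F.1 => (x : H)) c' =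
      ⟪Finsupp.linearCombination ℝ e c', g T 0⟫_ℝ := by
    rw [inner_linearCombination_left]
    congr 2
    funext x
    rw [heg T hT]
    rfl
  have h2 : ‖Finsupp.linearCombination ℝ (expo ∘ fun x : F.1 => (x : H)) c'‖ =
      ‖Finsupp.linearCombination ℝ e c'‖ := norm_linearCombination_eq _ _ hee c'
  rw [h1, h2, mul_comm]
  refine (abs_real_inner_le_norm _ _).trans ?_
  gcongr
  refine Real.le_sqrt_of_sq_le ?_
  rw [← real_inner_self_eq_norm_sq, hgg T T hT hT 0 0 0 0 (by simp) (by simp)]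
  simp only [inner_zero_left, add_zero, mul_zero, Real.exp_zero, mul_one]
  gcongr
  exact hF₀ F hF1

end GaussianVectors

/-! ### Positive perturbations of the identity by nuclear operators -/

section Positive

variable {H : Type*} [NormedAddCommGroup H] [InnerProductSpace ℝ H]

lemma isCompactOperator_smulRight {F : Type*} [NormedAddCommGroup F] [NormedSpace ℝ F]
    (f : H →L[ℝ] ℝ) (v : F) : IsCompactOperator (f.smulRight v) := by
  have h : f.smulRight v = (ContinuousLinearMap.toSpanSingleton ℝ v) ∘L f := by
    ext x
    simp
  rw [h]
  exact (isCompactOperator_of_locallyCompactSpace_dom f).clm_comp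
    (ContinuousLinearMap.toSpanSingleton ℝ v)

lemma NuclearRep.hasSum_smulRight {ι F : Type*} [NormedAddCommGroup F] [InnerProductSpace ℝ F]
    [CompleteSpace F] {K : H →L[ℝ] F} {u : ι → H} {v : ι → F} (h : NuclearRep K u v) :
    HasSum (fun i => (innerSL ℝ (u i)).smulRight (v i)) K := by
  have hs : Summable fun i => (innerSL ℝ (u i)).smulRight (v i) := by
    refine Summable.of_norm ?_
    simpa [ContinuousLinearMap.norm_smulRight_apply] using h.summable
  convert! hs.hasSum
  ext x
  refine (h.hasSum x).unique ?_
  simpa using (ContinuousLinearMap.apply ℝ F x).hasSum hs.hasSum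

/-- The partial sums have finite rank and converge in operator norm. -/
lemma IsNuclear.isCompactOperator {F : Type*} [NormedAddCommGroup F] [InnerProductSpace ℝ F]
    [CompleteSpace F] {K : H →L[ℝ] F} (h : IsNuclear K) : IsCompactOperator K := by
  obtain ⟨u, v, h⟩ := h
  refine isCompactOperator_of_tendsto h.hasSum_smulRight (Filter.Eventually.of_forall fun s => ?_)
  exact (compactOperator (RingHom.id ℝ) H F).sum_mem
    fun i _ => isCompactOperator_smulRight _ _

/-- Cauchy–Schwarz for the form `⟪A ·, ·⟫` applied to `x` and `A x`, in its discriminant form. -/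
lemma IsPositiveOperator.norm_sq_apply_le {A : H →L[ℝ] H} (hA : IsPositiveOperator A) (x : H) :
    ‖A x‖ ^ 2 ≤ ‖A‖ * ⟪A x, x⟫_ℝ := by
  have hnonneg : ∀ y, 0 ≤ ⟪A y, y⟫_ℝ := fun y => by
    rcases eq_or_ne y 0 with rfl | hy
    · simp
    · exact (hA.2 y hy).le
  have hcs : ⟪A x, A x⟫_ℝ ^ 2 ≤ ⟪A x, x⟫_ℝ * ⟪A (A x), A x⟫_ℝ := by
    have hq : ∀ r : ℝ, 0 ≤ ⟪A x, x⟫_ℝ * (r * r) + (2 * ⟪A x, A x⟫_ℝ) * r + ⟪A (A x), A x⟫_ℝ := by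
      intro r
      have := hnonneg (r • x + A x)
      rw [map_add, map_smul, inner_add_left, inner_add_right, inner_add_right,
        real_inner_smul_left, real_inner_smul_left, real_inner_smul_right,
        real_inner_smul_right, hA.1 (A x) x] at this
      linarith
    have := discrim_le_zero hq
    rw [discrim] at this
    linarith
  rw [real_inner_self_eq_norm_sq] at hcs
  have hb : ⟪A (A x), A x⟫_ℝ ≤ ‖A‖ * ‖A x‖ ^ 2 := by
    refine (real_inner_le_norm _ _).trans ?_
    have := mul_le_mul_of_nonneg_right (A.le_opNorm (A x)) (norm_nonneg (A x))
    linarith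
  rcases eq_or_ne (A x) 0 with h0 | h0
  · simp [h0]
  have hpos : 0 < ‖A x‖ ^ 2 := by positivity
  refine le_of_mul_le_mul_right ?_ hpos
  nlinarith [mul_le_mul_of_nonneg_left hb (hnonneg x)]

/-- Strict positivity excludes `-1` as an eigenvalue of the compact operator `A - 1`, so by the
Fredholm alternative `A` is bounded below; `norm_sq_apply_le` turns this into a lower bound for the
quadratic form. -/
lemma IsPositiveOperator.isPosDef [CompleteSpace H] {A : H →L[ℝ] H} (hA : IsPositiveOperator A)
    (hn : IsNuclear (A - 1)) : IsPosDef A := by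
  have hK := hn.isCompactOperator
  have hne : ¬ Module.End.HasEigenvalue ((A - 1 : H →L[ℝ] H) : Module.End ℝ H) (-1) := by
    intro h
    obtain ⟨x, hx⟩ := h.exists_hasEigenvector
    have h1 := hx.apply_eq_smul
    simp only [ContinuousLinearMap.coe_coe, _root_.sub_apply, one_apply_eq_self, neg_smul,
      one_smul, sub_eq_neg_self] at h1
    have := hA.2 x hx.2
    rw [h1, inner_zero_left] at this
    exact lt_irrefl _ this
  obtain ⟨c, hc⟩ := hK.antilipschitz_of_not_hasEigenvalue (by norm_num) hne
  have hAe : (A - 1 - (-1 : ℝ) • 1 : H →L[ℝ] H) = A := by simp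
  rw [hAe] at hc
  have hb : ∀ x, ‖x‖ ≤ c * ‖A x‖ := fun x => by
    simpa using hc.le_mul_dist x 0
  refine ⟨hA.1, ((c : ℝ) ^ 2 * ‖A‖ + 1)⁻¹, by positivity, fun x => ?_⟩
  rw [inv_mul_le_iff₀ (by positivity)]
  have h1 : ‖x‖ ^ 2 ≤ (c : ℝ) ^ 2 * ‖A x‖ ^ 2 := by
    rw [← mul_pow]
    exact pow_le_pow_left₀ (norm_nonneg _) (hb x) 2
  have h2 := mul_le_mul_of_nonneg_left (hA.norm_sq_apply_le x) (sq_nonneg (c : ℝ))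
  have h3 : 0 ≤ ⟪A x, x⟫_ℝ := by
    rcases eq_or_ne x 0 with rfl | hx
    · simp
    · exact (hA.2 x hx).le
  nlinarith

lemma IsPosDef.compression {A : H →L[ℝ] H} (hA : IsPosDef A) (F : FinSub H) :
    IsPosDef (compression F A) := by
  obtain ⟨ε, hε, h⟩ := hA.coercive
  refine ⟨fun x y => ?_, ε, hε, fun x => ?_⟩
  · rw [inner_compression, hA.symm, ← real_inner_comm, ← inner_compression, real_inner_comm]
  · rw [inner_compression]
    exact h x

lemma IsPosDef.fredholmDet_pos [CompleteSpace H] {A : H →L[ℝ] H} (hA : IsPosDef A)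
    (hn : IsNuclear (A - 1)) : 0 < fredholmDet A := by
  refine lt_of_le_of_ne ?_ (fredholmDet_ne_zero hn hA.isUnit).symm
  exact ge_of_tendsto' hn.hasFredholmDet fun F => (hA.compression F).det_pos.le

/-! ### The Cayley transform -/

variable {A : H →L[ℝ] H}

lemma isNuclear_half_one_add_sub_one (hn : IsNuclear (A - 1)) :
    IsNuclear ((1 / 2 : ℝ) • (1 + A) - 1) := by
  have : (1 / 2 : ℝ) • (1 + A) - 1 = (1 / 2 : ℝ) • (A - 1) := by module
  rw [this]
  exact hn.smul _

variable [CompleteSpace H]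

lemma IsPosDef.isUnit_one_add (hA : IsPosDef A) : IsUnit (1 + A) := (IsPosDef.one.add hA).isUnit

lemma IsPosDef.isSymContraction_cayley (hA : IsPosDef A) : IsSymContraction (cayley A) :=
  ⟨cayley_symm hA.isUnit_one_add hA.symm, norm_cayley_lt_one hA⟩

lemma isNuclear_cayley (hn : IsNuclear (A - 1)) : IsNuclear (cayley A) := by
  have : cayley A = -(A - 1) * Ring.inverse (1 + A) := by rw [cayley, neg_sub]
  rw [this]
  exact hn.neg.mul_right _

lemma IsPosDef.one_add_cayley_mul (hA : IsPosDef A) :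
    (1 + cayley A) * ((1 / 2 : ℝ) • (1 + A)) = 1 := by
  rw [mul_smul_comm, add_mul, cayley_mul_one_add hA.isUnit_one_add, one_mul]
  module

lemma IsPosDef.mul_one_add_cayley (hA : IsPosDef A) :
    ((1 / 2 : ℝ) • (1 + A)) * (1 + cayley A) = 1 := by
  rw [smul_mul_assoc, mul_add, one_add_mul_cayley hA.isUnit_one_add, mul_one]
  module

lemma IsPosDef.fredholmDet_one_add_cayley (hA : IsPosDef A) (hn : IsNuclear (A - 1)) :
    fredholmDet (1 + cayley A) * fredholmDet ((1 / 2 : ℝ) • (1 + A)) = 1 := by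
  rw [← fredholmDet_mul (by simpa using isNuclear_cayley hn) (isNuclear_half_one_add_sub_one hn),
    hA.one_add_cayley_mul, fredholmDet_one]

/-- Since `A (1 + C) = 1 - C`, the operator `1 - C²` equals `A (1 + C)²`, and `1 + C` is the inverse
of `(1 + A) / 2`. -/
lemma IsPosDef.fredholmDet_one_sub_cayley_sq (hA : IsPosDef A) (hn : IsNuclear (A - 1)) :
    fredholmDet (1 - cayley A * cayley A) =
      fredholmDet A / fredholmDet ((1 / 2 : ℝ) • (1 + A)) ^ 2 := by
  have hc := isNuclear_cayley hn
  have h1 : 1 - cayley A * cayley A = A * (1 + cayley A) * (1 + cayley A) := by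
    have h2 : A * (1 + cayley A) = 1 - cayley A := by
      have := one_add_mul_cayley hA.isUnit_one_add
      have h3 : A * (1 + cayley A) = (1 + A) * cayley A - cayley A + A := by noncomm_ring
      rw [h3, this]
      abel
    rw [h2]
    noncomm_ring
  have hc1 : IsNuclear (1 + cayley A - 1) := by simpa using hc
  have hd := hA.fredholmDet_one_add_cayley hn
  rw [h1, fredholmDet_mul (hn.mul_sub_one hc1) hc1, fredholmDet_mul hn hc1,
    eq_div_iff (pow_ne_zero 2 (right_ne_zero_of_mul_eq_one hd))]
  linear_combination fredholmDet A * (fredholmDet (1 + cayley A) *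
    fredholmDet ((1 / 2 : ℝ) • (1 + A)) + 1) * hd

/-! ### The vectors `Exp(½ S(C(A)))` -/

lemma IsSymContraction.isExpVector {T : H →L[ℝ] H} (hT : IsSymContraction T) (hn : IsNuclear T) :
    IsExpVector T (expVector T) := by
  obtain ⟨G, hG⟩ := exists_isGaussian hT hn
  exact isExpVector_expVector (Φ := G) fun x => by rw [hG, inner_zero_left, add_zero]

lemma IsSymContraction.inner_expo_expVector {T : H →L[ℝ] H} (hT : IsSymContraction T)
    (hn : IsNuclear T) (x : H) :
    ⟪expo x, expVector T⟫_ℝ = Real.exp ((1 / 2) * ⟪T x, x⟫_ℝ) :=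
  (hT.isExpVector hn).inner_expo x

lemma IsSymContraction.norm_sq_expVector {T : H →L[ℝ] H} (hT : IsSymContraction T)
    (hn : IsNuclear T) : ‖expVector T‖ ^ 2 = (√(fredholmDet (1 - T * T)))⁻¹ := by
  have hG : IsGaussian T 0 (expVector T) := fun x => by
    rw [hT.inner_expo_expVector hn, inner_zero_left, add_zero]
  rw [← real_inner_self_eq_norm_sq, hG.inner hG hT hT hn (s := 0) (t := 0) (by simp) (by simp)]
  simp

lemma IsPosDef.fredholmDet_half_one_add_pos (hA : IsPosDef A) (hn : IsNuclear (A - 1)) :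
    0 < fredholmDet ((1 / 2 : ℝ) • (1 + A)) :=
  ((IsPosDef.one.add hA).smul (by norm_num)).fredholmDet_pos (isNuclear_half_one_add_sub_one hn)

/-- The squared norm is `det (1 - C²)^(-1/2)`. The resulting fourth root of `det A` is the one that
the constant of the composition law is designed to cancel. -/
lemma IsPosDef.norm_expVector_cayley (hA : IsPosDef A) (hn : IsNuclear (A - 1)) :
    ‖expVector (cayley A)‖ = √(fredholmDet ((1 / 2 : ℝ) • (1 + A))) /
      fredholmDet A ^ (1 / 4 : ℝ) := by
  have h1 := hA.fredholmDet_pos hn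
  have h2 := hA.fredholmDet_half_one_add_pos hn
  rw [← sq_eq_sq₀ (norm_nonneg _) (by positivity),
    hA.isSymContraction_cayley.norm_sq_expVector (isNuclear_cayley hn),
    hA.fredholmDet_one_sub_cayley_sq hn, div_pow, Real.sq_sqrt h2.le,
    Real.sqrt_div h1.le, Real.sqrt_sq h2.le, inv_div, ← Real.rpow_natCast (_ ^ (1 / 4 : ℝ)) 2,
    ← Real.rpow_mul h1.le, Real.sqrt_eq_rpow]
  norm_num

end Positive

/-! ### Block operators -/

section Pairs

variable {E F : Type*} [NormedAddCommGroup E] [InnerProductSpace ℝ E]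
  [NormedAddCommGroup F] [InnerProductSpace ℝ F]

/-- The vector `(x, y)` of `E ⊕ F`. -/
def pair (x : E) (y : F) : DirSum E F := incl₁ E F x + incl₂ E F y

lemma fstL_incl₁ (x : E) : WithLp.fstL 2 ℝ E F (incl₁ E F x) = x := rfl

lemma fstL_incl₂ (y : F) : WithLp.fstL 2 ℝ E F (incl₂ E F y) = 0 := rfl

lemma sndL_incl₁ (x : E) : WithLp.sndL 2 ℝ E F (incl₁ E F x) = 0 := rfl

lemma sndL_incl₂ (y : F) : WithLp.sndL 2 ℝ E F (incl₂ E F y) = y := rfl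

lemma fstL_pair (x : E) (y : F) : WithLp.fstL 2 ℝ E F (pair x y) = x := by
  rw [pair, map_add, fstL_incl₁, fstL_incl₂, add_zero]

lemma sndL_pair (x : E) (y : F) : WithLp.sndL 2 ℝ E F (pair x y) = y := by
  rw [pair, map_add, sndL_incl₁, sndL_incl₂, zero_add]

lemma eq_pair (z : DirSum E F) : z = pair (WithLp.fstL 2 ℝ E F z) (WithLp.sndL 2 ℝ E F z) := by
  refine WithLp.ofLp_injective 2 (Prod.ext ?_ ?_)
  · exact (fstL_pair _ _).symm
  · exact (sndL_pair _ _).symm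

lemma pair_inj {x x' : E} {y y' : F} : pair x y = pair x' y' ↔ x = x' ∧ y = y' := by
  refine ⟨fun h => ⟨?_, ?_⟩, fun h => by rw [h.1, h.2]⟩
  · rw [← fstL_pair x y, h, fstL_pair]
  · rw [← sndL_pair x y, h, sndL_pair]

lemma pair_add (x x' : E) (y y' : F) : pair x y + pair x' y' = pair (x + x') (y + y') := by
  simp only [pair, map_add]
  abel

lemma pair_sub (x x' : E) (y y' : F) : pair x y - pair x' y' = pair (x - x') (y - y') := by
  simp only [pair, map_sub]
  abel

lemma inner_pair (x x' : E) (y y' : F) :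
    ⟪pair x y, pair x' y'⟫_ℝ = ⟪x, x'⟫_ℝ + ⟪y, y'⟫_ℝ :=
  inner_incl_add x x' y y'

lemma norm_sq_pair (x : E) (y : F) : ‖pair x y‖ ^ 2 = ‖x‖ ^ 2 + ‖y‖ ^ 2 := by
  rw [← real_inner_self_eq_norm_sq, inner_pair, real_inner_self_eq_norm_sq,
    real_inner_self_eq_norm_sq]

lemma apply_pair (A : DirSum E F →L[ℝ] DirSum E F) (x : E) (y : F) :
    A (pair x y) = pair (block₁₁ A x + block₁₂ A y) (block₂₁ A x + block₂₂ A y) := by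
  rw [eq_pair (A (pair x y)), pair_inj]
  simp only [pair, map_add]
  exact ⟨rfl, rfl⟩

lemma ofBlocks_pair (a : E →L[ℝ] E) (b : F →L[ℝ] E) (c : E →L[ℝ] F) (d : F →L[ℝ] F) (x : E)
    (y : F) : ofBlocks a b c d (pair x y) = pair (a x + b y) (c x + d y) := by
  simp only [ofBlocks, _root_.add_apply, ContinuousLinearMap.comp_apply, fstL_pair, sndL_pair]
  rfl

lemma clm_ext_pair {G : Type*} [NormedAddCommGroup G] [InnerProductSpace ℝ G]
    {A B : DirSum E F →L[ℝ] G} (h : ∀ x y, A (pair x y) = B (pair x y)) : A = B := by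
  ext z
  rw [eq_pair z]
  exact h _ _

lemma inner_block₁₂ {A : DirSum E F →L[ℝ] DirSum E F}
    (hA : ∀ x y, ⟪A x, y⟫_ℝ = ⟪x, A y⟫_ℝ) (x : E) (y : F) :
    ⟪block₁₂ A y, x⟫_ℝ = ⟪y, block₂₁ A x⟫_ℝ := by
  have := hA (pair 0 y) (pair x 0)
  simpa only [apply_pair, inner_pair, map_zero, zero_add, add_zero, inner_zero_left,
    inner_zero_right] using this

lemma inner_block₁₁ {A : DirSum E F →L[ℝ] DirSum E F}
    (hA : ∀ x y, ⟪A x, y⟫_ℝ = ⟪x, A y⟫_ℝ) (x y : E) :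
    ⟪block₁₁ A x, y⟫_ℝ = ⟪x, block₁₁ A y⟫_ℝ := by
  have := hA (pair x 0) (pair y 0)
  simpa only [apply_pair, inner_pair, map_zero, zero_add, add_zero, inner_zero_left,
    inner_zero_right] using this

lemma inner_block₂₂ {A : DirSum E F →L[ℝ] DirSum E F}
    (hA : ∀ x y, ⟪A x, y⟫_ℝ = ⟪x, A y⟫_ℝ) (x y : F) :
    ⟪block₂₂ A x, y⟫_ℝ = ⟪x, block₂₂ A y⟫_ℝ := by
  have := hA (pair 0 x) (pair 0 y)
  simpa only [apply_pair, inner_pair, map_zero, zero_add, add_zero, inner_zero_left,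
    inner_zero_right] using this

lemma norm_pair_zero (x : E) : ‖pair x (0 : F)‖ = ‖x‖ := by
  rw [← sq_eq_sq₀ (norm_nonneg _) (norm_nonneg _), norm_sq_pair]
  simp

lemma norm_zero_pair (y : F) : ‖pair (0 : E) y‖ = ‖y‖ := by
  rw [← sq_eq_sq₀ (norm_nonneg _) (norm_nonneg _), norm_sq_pair]
  simp

lemma IsPosDef.block₁₁ {A : DirSum E F →L[ℝ] DirSum E F} (hA : IsPosDef A) :
    IsPosDef (block₁₁ A) := by
  obtain ⟨ε, hε, h⟩ := hA.coercive
  refine ⟨inner_block₁₁ hA.symm, ε, hε, fun x => ?_⟩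
  have := h (pair x 0)
  simpa only [apply_pair, inner_pair, norm_pair_zero, map_zero, zero_add, add_zero, inner_zero_right]
    using this

lemma IsPosDef.block₂₂ {A : DirSum E F →L[ℝ] DirSum E F} (hA : IsPosDef A) :
    IsPosDef (block₂₂ A) := by
  obtain ⟨ε, hε, h⟩ := hA.coercive
  refine ⟨inner_block₂₂ hA.symm, ε, hε, fun x => ?_⟩
  have := h (pair 0 x)
  simpa only [apply_pair, inner_pair, norm_zero_pair, map_zero, zero_add, add_zero, inner_zero_right]
    using this

lemma norm_block₁₁_le (A : DirSum E F →L[ℝ] DirSum E F) : ‖block₁₁ A‖ ≤ ‖A‖ := by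
  refine ContinuousLinearMap.opNorm_le_bound _ A.opNorm_nonneg fun x => ?_
  calc ‖block₁₁ A x‖ ≤ ‖A (pair x 0)‖ := by
        rw [← pow_le_pow_iff_left₀ (norm_nonneg _) (norm_nonneg _) two_ne_zero, apply_pair,
          norm_sq_pair, map_zero, add_zero]
        exact le_add_of_nonneg_right (sq_nonneg _)
    _ ≤ ‖A‖ * ‖x‖ := by rw [← norm_pair_zero (F := F) x]; exact A.le_opNorm _

lemma norm_block₂₂_le (A : DirSum E F →L[ℝ] DirSum E F) : ‖block₂₂ A‖ ≤ ‖A‖ := by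
  refine ContinuousLinearMap.opNorm_le_bound _ A.opNorm_nonneg fun x => ?_
  calc ‖block₂₂ A x‖ ≤ ‖A (pair 0 x)‖ := by
        rw [← pow_le_pow_iff_left₀ (norm_nonneg _) (norm_nonneg _) two_ne_zero, apply_pair,
          norm_sq_pair, map_zero, map_zero, zero_add, zero_add]
        exact le_add_of_nonneg_left (sq_nonneg _)
    _ ≤ ‖A‖ * ‖x‖ := by rw [← norm_zero_pair (E := E) x]; exact A.le_opNorm _

lemma IsSymContraction.block₁₁ {A : DirSum E F →L[ℝ] DirSum E F} (hA : IsSymContraction A) :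
    IsSymContraction (block₁₁ A) :=
  ⟨inner_block₁₁ hA.symm, (norm_block₁₁_le A).trans_lt hA.norm_lt_one⟩

lemma IsSymContraction.block₂₂ {A : DirSum E F →L[ℝ] DirSum E F} (hA : IsSymContraction A) :
    IsSymContraction (block₂₂ A) :=
  ⟨inner_block₂₂ hA.symm, (norm_block₂₂_le A).trans_lt hA.norm_lt_one⟩

lemma block₁₁_one : block₁₁ (1 : DirSum E F →L[ℝ] DirSum E F) = 1 := rfl

lemma block₂₂_one : block₂₂ (1 : DirSum E F →L[ℝ] DirSum E F) = 1 := rfl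

lemma block₁₁_add (A B : DirSum E F →L[ℝ] DirSum E F) :
    block₁₁ (A + B) = block₁₁ A + block₁₁ B := rfl

lemma block₂₂_add (A B : DirSum E F →L[ℝ] DirSum E F) :
    block₂₂ (A + B) = block₂₂ A + block₂₂ B := rfl

lemma block₁₁_sub_one (A : DirSum E F →L[ℝ] DirSum E F) : block₁₁ (A - 1) = block₁₁ A - 1 := rfl

lemma block₁₂_sub_one (A : DirSum E F →L[ℝ] DirSum E F) : block₁₂ (A - 1) = block₁₂ A := by
  ext x
  exact sub_zero _

lemma block₂₁_sub_one (A : DirSum E F →L[ℝ] DirSum E F) : block₂₁ (A - 1) = block₂₁ A := by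
  ext x
  exact sub_zero _

lemma block₂₂_sub_one (A : DirSum E F →L[ℝ] DirSum E F) : block₂₂ (A - 1) = block₂₂ A - 1 := rfl

section

variable [CompleteSpace E] [CompleteSpace F] {A : DirSum E F →L[ℝ] DirSum E F}

lemma IsNuclear.block₁₁ (h : IsNuclear A) : IsNuclear (block₁₁ A) :=
  (h.comp_right _).comp_left _

lemma IsNuclear.block₁₂ (h : IsNuclear A) : IsNuclear (block₁₂ A) :=
  (h.comp_right _).comp_left _

lemma IsNuclear.block₂₁ (h : IsNuclear A) : IsNuclear (block₂₁ A) :=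
  (h.comp_right _).comp_left _

lemma IsNuclear.block₂₂ (h : IsNuclear A) : IsNuclear (block₂₂ A) :=
  (h.comp_right _).comp_left _

lemma isNuclear_ofBlocks {a : E →L[ℝ] E} {b : F →L[ℝ] E} {c : E →L[ℝ] F} {d : F →L[ℝ] F}
    (ha : IsNuclear a) (hb : IsNuclear b) (hc : IsNuclear c) (hd : IsNuclear d) :
    IsNuclear (ofBlocks a b c d) :=
  (((ha.comp_right _).add (hb.comp_right _)).comp_left _).add
    (((hc.comp_right _).add (hd.comp_right _)).comp_left _)

end

lemma ofBlocks_sub_one (a : E →L[ℝ] E) (b : F →L[ℝ] E) (c : E →L[ℝ] F) (d : F →L[ℝ] F) :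
    ofBlocks a b c d - 1 = ofBlocks (a - 1) b c (d - 1) := by
  refine clm_ext_pair fun x y => ?_
  simp only [_root_.sub_apply, one_apply_eq_self, ofBlocks_pair, pair_sub, pair_inj]
  constructor <;> abel

end Pairs

/-! ### Composition of block operators and its Cayley transform. -/

section Composition

variable {H₁ H₂ H₃ : Type*} [NormedAddCommGroup H₁] [InnerProductSpace ℝ H₁]
  [NormedAddCommGroup H₂] [InnerProductSpace ℝ H₂]
  [NormedAddCommGroup H₃] [InnerProductSpace ℝ H₃]
  {𝒜₁ : DirSum H₂ H₁ →L[ℝ] DirSum H₂ H₁} {𝒜₂ : DirSum H₃ H₂ →L[ℝ] DirSum H₃ H₂}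

lemma IsPosDef.gluing (h₂ : IsPosDef 𝒜₂) (h₁ : IsPosDef 𝒜₁) : IsPosDef (gluing 𝒜₂ 𝒜₁) :=
  h₁.block₁₁.add h₂.block₂₂

/-- The value of `𝒜₂ ∘ 𝒜₁` at `(u, v)` is obtained by matching the values of `𝒜₂` at `(u, h)` and
of `𝒜₁` at `(h, v)` along `H₂`. -/
lemma exists_blockComp_pair (hG : IsUnit (gluing 𝒜₂ 𝒜₁)) (u : H₃) (v : H₁) :
    ∃ (h m : H₂) (k : H₃) (n : H₁), 𝒜₂ (pair u h) = pair k m ∧ 𝒜₁ (pair h v) = pair (-m) n ∧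
      blockComp 𝒜₂ 𝒜₁ (pair u v) = pair k n := by
  set R := Ring.inverse (gluing 𝒜₂ 𝒜₁) with hR
  -- Matching requires `(A + M) h = -(Lᵗ u + B v)`, the equation for a critical point in `h` of the
  -- sum of the two quadratic forms.
  set h := -R (block₂₁ 𝒜₂ u + block₁₂ 𝒜₁ v) with hh
  have hGh : gluing 𝒜₂ 𝒜₁ h = -(block₂₁ 𝒜₂ u + block₁₂ 𝒜₁ v) := by
    have := congrArg (fun A : H₂ →L[ℝ] H₂ => A (block₂₁ 𝒜₂ u + block₁₂ 𝒜₁ v))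
      (Ring.mul_inverse_cancel _ hG)
    simp only [mul_apply_eq_comp, one_apply_eq_self] at this
    rw [hh, map_neg, hR, this]
  have hGh' : block₁₁ 𝒜₁ h + block₂₂ 𝒜₂ h = -(block₂₁ 𝒜₂ u + block₁₂ 𝒜₁ v) := hGh
  refine ⟨h, block₂₁ 𝒜₂ u + block₂₂ 𝒜₂ h, block₁₁ 𝒜₂ u + block₁₂ 𝒜₂ h,
    block₂₁ 𝒜₁ h + block₂₂ 𝒜₁ v, apply_pair _ _ _, ?_, ?_⟩
  · rw [apply_pair, pair_inj]
    refine ⟨?_, rfl⟩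
    rw [eq_neg_iff_add_eq_zero]
    rw [eq_neg_iff_add_eq_zero] at hGh'
    rw [← hGh']
    abel
  · rw [blockComp, ofBlocks_pair, pair_inj, hh]
    simp only [_root_.sub_apply, _root_.neg_apply, ContinuousLinearMap.comp_apply, map_neg, map_add]
    constructor <;> abel

variable [CompleteSpace H₂]

/-- In the sum of `⟪𝒜₂ (u, h), (u, h)⟫` and `⟪𝒜₁ (h, v), (h, v)⟫` the contributions of `m` along
`H₂` cancel, leaving the form of the composition. Symmetry and the lower bound are inherited. -/
lemma IsPosDef.blockComp (h₂ : IsPosDef 𝒜₂) (h₁ : IsPosDef 𝒜₁) :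
    IsPosDef (blockComp 𝒜₂ 𝒜₁) := by
  have hG := (h₂.gluing h₁).isUnit
  obtain ⟨ε, hε, hc₂⟩ := h₂.coercive
  obtain ⟨δ, hδ, hc₁⟩ := h₁.coercive
  refine ⟨fun x y => ?_, min ε δ, lt_min hε hδ, fun x => ?_⟩
  · rw [eq_pair x, eq_pair y]
    generalize WithLp.fstL 2 ℝ H₃ H₁ x = u
    generalize WithLp.sndL 2 ℝ H₃ H₁ x = v
    generalize WithLp.fstL 2 ℝ H₃ H₁ y = u'
    generalize WithLp.sndL 2 ℝ H₃ H₁ y = v'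
    obtain ⟨h, m, k, n, e1, e2, e3⟩ := exists_blockComp_pair hG u v
    obtain ⟨h', m', k', n', e1', e2', e3'⟩ := exists_blockComp_pair hG u' v'
    have f1 := h₂.symm (pair u h) (pair u' h')
    have f2 := h₁.symm (pair h v) (pair h' v')
    rw [e1, e1', inner_pair, inner_pair] at f1
    rw [e2, e2', inner_pair, inner_pair, inner_neg_left, inner_neg_right] at f2
    rw [e3, e3', inner_pair, inner_pair]
    linarith
  · rw [eq_pair x]
    generalize WithLp.fstL 2 ℝ H₃ H₁ x = u
    generalize WithLp.sndL 2 ℝ H₃ H₁ x = v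
    obtain ⟨h, m, k, n, e1, e2, e3⟩ := exists_blockComp_pair hG u v
    have f1 := hc₂ (pair u h)
    have f2 := hc₁ (pair h v)
    rw [e1, inner_pair, norm_sq_pair] at f1
    rw [e2, inner_pair, norm_sq_pair, inner_neg_left] at f2
    rw [e3, inner_pair, norm_sq_pair]
    have g1 : min ε δ * ‖u‖ ^ 2 ≤ ε * ‖u‖ ^ 2 := by gcongr; exact min_le_left _ _
    have g2 : min ε δ * ‖v‖ ^ 2 ≤ δ * ‖v‖ ^ 2 := by gcongr; exact min_le_right _ _
    have g3 : 0 ≤ ε * ‖h‖ ^ 2 := by positivity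
    have g4 : 0 ≤ δ * ‖h‖ ^ 2 := by positivity
    linarith

variable [CompleteSpace H₁] [CompleteSpace H₃]

lemma isNuclear_blockComp_sub_one (h₁ : IsNuclear (𝒜₁ - 1)) (h₂ : IsNuclear (𝒜₂ - 1)) :
    IsNuclear (blockComp 𝒜₂ 𝒜₁ - 1) := by
  have hL := h₂.block₁₂
  have hL' := h₂.block₂₁
  have hB := h₁.block₁₂
  have hB' := h₁.block₂₁
  rw [block₁₂_sub_one] at hL hB
  rw [block₂₁_sub_one] at hL' hB'
  rw [blockComp, ofBlocks_sub_one]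
  refine isNuclear_ofBlocks ?_ ?_ ?_ ?_
  · rw [sub_right_comm]
    exact h₂.block₁₁.sub (hL.comp_right _)
  · exact (hL.comp_right _).neg
  · exact (hB'.comp_right _).neg
  · rw [sub_right_comm]
    exact h₁.block₂₂.sub (hB'.comp_right _)

/-- The Cayley transform of `𝒜₂ ∘ 𝒜₁` in terms of those of `𝒜₁` and `𝒜₂`. -/
lemma exists_cayley_blockComp_pair (h₂ : IsPosDef 𝒜₂) (h₁ : IsPosDef 𝒜₁) (u : H₃) (v : H₁) :
    ∃ (s t : H₂) (k : H₃) (n : H₁), cayley 𝒜₂ (pair u s) = pair k t ∧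
      cayley 𝒜₁ (pair t v) = pair s n ∧ cayley (blockComp 𝒜₂ 𝒜₁) (pair u v) = pair k n := by
  have h₃ := h₂.blockComp h₁
  obtain ⟨z, hz⟩ := exists_add_eq h₃.isUnit_one_add (pair u v)
  obtain ⟨x, y, rfl⟩ : ∃ x y, z = pair x y := ⟨_, _, eq_pair z⟩
  obtain ⟨h, m, k, n, e1, e2, e3⟩ := exists_blockComp_pair (h₂.gluing h₁).isUnit x y
  have f1 := cayley_apply h₂.isUnit_one_add (pair x h)
  have f2 := cayley_apply h₁.isUnit_one_add (pair h y)
  have f3 := cayley_apply h₃.isUnit_one_add (pair x y)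
  rw [e3, pair_add, pair_inj] at hz
  rw [e1, pair_add, pair_sub, hz.1] at f1
  rw [e2, pair_add, pair_sub, hz.2, ← sub_eq_add_neg, sub_neg_eq_add] at f2
  rw [e3, pair_add, pair_sub, hz.1, hz.2] at f3
  -- The sign in `-m` exchanges the roles of `h + m` and `h - m` between the two Cayley transforms:
  -- what enters one along `H₂` leaves the other.
  exact ⟨h + m, h - m, x - k, y - n, f1, f2, f3⟩

end Composition

/-! ### Determinants of block operators -/

section BlockDet

variable {E F : Type*} [NormedAddCommGroup E] [InnerProductSpace ℝ E]
  [NormedAddCommGroup F] [InnerProductSpace ℝ F]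

lemma incl₁_fstL_add_incl₂_sndL :
    incl₁ E F ∘L WithLp.fstL 2 ℝ E F + incl₂ E F ∘L WithLp.sndL 2 ℝ E F = 1 := by
  ext z
  exact (eq_pair z).symm

variable [CompleteSpace E] [CompleteSpace F]

/-- Cyclicity moves the projection `fstL` past the inclusion, so that the block determinant becomes
a determinant on the whole sum. -/
lemma fredholmDet_block₁₁ {X : DirSum E F →L[ℝ] DirSum E F} (hX : IsNuclear (X - 1)) :
    fredholmDet (block₁₁ X) =
      fredholmDet (1 + (X - 1) * (incl₁ E F ∘L WithLp.fstL 2 ℝ E F)) := by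
  have h := fredholmDet_one_add_comm (hX.comp_right (incl₁ E F)) (WithLp.fstL 2 ℝ E F)
  have h1 : 1 + WithLp.fstL 2 ℝ E F ∘L (X - 1) ∘L incl₁ E F = block₁₁ X := by
    rw [show WithLp.fstL 2 ℝ E F ∘L (X - 1) ∘L incl₁ E F = block₁₁ (X - 1) from rfl,
      block₁₁_sub_one, add_sub_cancel]
  rw [← h1]
  exact h

lemma fredholmDet_block₂₂ {X : DirSum E F →L[ℝ] DirSum E F} (hX : IsNuclear (X - 1)) :
    fredholmDet (block₂₂ X) =
      fredholmDet (1 + (X - 1) * (incl₂ E F ∘L WithLp.sndL 2 ℝ E F)) := by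
  have h := fredholmDet_one_add_comm (hX.comp_right (incl₂ E F)) (WithLp.sndL 2 ℝ E F)
  have h1 : 1 + WithLp.sndL 2 ℝ E F ∘L (X - 1) ∘L incl₂ E F = block₂₂ X := by
    rw [show WithLp.sndL 2 ℝ E F ∘L (X - 1) ∘L incl₂ E F = block₂₂ (X - 1) from rfl,
      block₂₂_sub_one, add_sub_cancel]
  rw [← h1]
  exact h

/-- The algebra behind Jacobi's formula: with `p` and `q` the two coordinate projections, the two
bracketed factors represent complementary blocks of `Y` and `X`. -/
lemma mul_one_add_sub_one_mul {R : Type*} [Ring R] {X Y p q : R} (hXY : X * Y = 1)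
    (hpq : p + q = 1) : X * (1 + (Y - 1) * p) = 1 + (X - 1) * q := by
  have hq : q = 1 - p := by rw [← hpq, add_sub_cancel_left]
  have h : X * (1 + (Y - 1) * p) = X + (X * Y) * p - X * p := by noncomm_ring
  rw [h, hXY, hq]
  noncomm_ring

/-- Jacobi's complementary minor formula. -/
lemma fredholmDet_mul_block₁₁ {X Y : DirSum E F →L[ℝ] DirSum E F} (hX : IsNuclear (X - 1))
    (hY : IsNuclear (Y - 1)) (hXY : X * Y = 1) :
    fredholmDet X * fredholmDet (block₁₁ Y) = fredholmDet (block₂₂ X) := by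
  rw [fredholmDet_block₁₁ hY, fredholmDet_block₂₂ hX,
    ← mul_one_add_sub_one_mul hXY incl₁_fstL_add_incl₂_sndL, fredholmDet_mul hX]
  rw [add_sub_cancel_left]
  exact hY.mul_right _

/-- Jacobi's complementary minor formula. -/
lemma fredholmDet_mul_block₂₂ {X Y : DirSum E F →L[ℝ] DirSum E F} (hX : IsNuclear (X - 1))
    (hY : IsNuclear (Y - 1)) (hXY : X * Y = 1) :
    fredholmDet X * fredholmDet (block₂₂ Y) = fredholmDet (block₁₁ X) := by
  rw [fredholmDet_block₂₂ hY, fredholmDet_block₁₁ hX,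
    ← mul_one_add_sub_one_mul hXY ((add_comm _ _).trans incl₁_fstL_add_incl₂_sndL),
    fredholmDet_mul hX]
  rw [add_sub_cancel_left]
  exact hY.mul_right _

lemma fredholmDet_blockDiagonal {a : E →L[ℝ] E} {d : F →L[ℝ] F} (ha : IsNuclear (a - 1))
    (hd : IsNuclear (d - 1)) :
    fredholmDet (ofBlocks a 0 0 d) = fredholmDet a * fredholmDet d := by
  have h₁ : IsNuclear (ofBlocks a 0 0 (1 : F →L[ℝ] F) - 1) := by
    rw [ofBlocks_sub_one, sub_self]
    exact isNuclear_ofBlocks ha .zero .zero .zero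
  have h₂ : IsNuclear (ofBlocks (1 : E →L[ℝ] E) 0 0 d - 1) := by
    rw [ofBlocks_sub_one, sub_self]
    exact isNuclear_ofBlocks .zero .zero .zero hd
  have h : ofBlocks a 0 0 d = ofBlocks a 0 0 1 * ofBlocks 1 0 0 d :=
    clm_ext_pair fun x y => by simp [ofBlocks_pair]
  have ha' : fredholmDet (ofBlocks a 0 0 (1 : F →L[ℝ] F)) = fredholmDet a := by
    have := fredholmDet_one_add_comm (ha.comp_right (WithLp.fstL 2 ℝ E F)) (incl₁ E F)
    convert this using 2
    · refine clm_ext_pair fun x y => ?_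
      have e : (incl₁ E F) ((a - 1) x) = pair ((a - 1) x) 0 := by simp [pair]
      simp only [_root_.add_apply, one_apply_eq_self, ContinuousLinearMap.comp_apply, fstL_pair,
        ofBlocks_pair, e, pair_add, pair_inj]
      simp
    · ext x
      simp only [_root_.add_apply, one_apply_eq_self, ContinuousLinearMap.comp_apply, fstL_incl₁,
        _root_.sub_apply, add_sub_cancel]
  have hd' : fredholmDet (ofBlocks (1 : E →L[ℝ] E) 0 0 d) = fredholmDet d := by
    have := fredholmDet_one_add_comm (hd.comp_right (WithLp.sndL 2 ℝ E F)) (incl₂ E F)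
    convert this using 2
    · refine clm_ext_pair fun x y => ?_
      have e : (incl₂ E F) ((d - 1) y) = pair 0 ((d - 1) y) := by simp [pair]
      simp only [_root_.add_apply, one_apply_eq_self, ContinuousLinearMap.comp_apply, sndL_pair,
        ofBlocks_pair, e, pair_add, pair_inj]
      simp
    · ext x
      simp only [_root_.add_apply, one_apply_eq_self, ContinuousLinearMap.comp_apply, sndL_incl₂,
        _root_.sub_apply, add_sub_cancel]
  rw [h, fredholmDet_mul h₁ h₂, ha', hd']

end BlockDet

/-! ### Schur complements as inverses of diagonal blocks. -/

section Schur

variable {E F : Type*} [NormedAddCommGroup E] [InnerProductSpace ℝ E]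
  [NormedAddCommGroup F] [InnerProductSpace ℝ F]

/-- The equation `X Y = 1` is applied to `(x, 0)`, and its second component is used to eliminate the
off-diagonal block of `Y`. -/
lemma schur_mul_block₁₁ {X Y : DirSum E F →L[ℝ] DirSum E F} (hXY : X * Y = 1) {D : F →L[ℝ] F}
    (hD : D * block₂₂ X = 1) :
    (block₁₁ X - block₁₂ X ∘L D ∘L block₂₁ X) * block₁₁ Y = 1 := by
  ext x
  have h := congrArg (fun A : DirSum E F →L[ℝ] DirSum E F => A (pair x 0)) hXY
  simp only [mul_apply_eq_comp, one_apply_eq_self, apply_pair, map_zero, add_zero, pair_inj] at h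
  obtain ⟨h1, h2⟩ := h
  have h3 := congrArg (fun A : F →L[ℝ] F => A (block₂₁ Y x)) hD
  simp only [mul_apply_eq_comp, one_apply_eq_self] at h3
  have h4 : D (block₂₁ X (block₁₁ Y x)) = -block₂₁ Y x := by
    rw [eq_neg_of_add_eq_zero_left h2, map_neg, h3]
  simp only [mul_apply_eq_comp, one_apply_eq_self, _root_.sub_apply,
    ContinuousLinearMap.comp_apply, h4, map_neg, sub_neg_eq_add]
  exact h1

lemma block₂₂_mul_schur {X Y : DirSum E F →L[ℝ] DirSum E F} (hYX : Y * X = 1) {D : E →L[ℝ] E}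
    (hD : block₁₁ X * D = 1) :
    block₂₂ Y * (block₂₂ X - block₂₁ X ∘L D ∘L block₁₂ X) = 1 := by
  ext y
  have h := congrArg (fun A : DirSum E F →L[ℝ] DirSum E F => A (pair (-D (block₁₂ X y)) y)) hYX
  have h3 := congrArg (fun A : E →L[ℝ] E => A (block₁₂ X y)) hD
  simp only [mul_apply_eq_comp, one_apply_eq_self] at h3
  simp only [mul_apply_eq_comp, one_apply_eq_self, apply_pair X, map_neg, h3, neg_add_cancel]
    at h
  rw [apply_pair, map_zero, map_zero, zero_add, zero_add, pair_inj] at h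
  simp only [mul_apply_eq_comp, one_apply_eq_self, _root_.sub_apply,
    ContinuousLinearMap.comp_apply]
  rw [sub_eq_neg_add]
  exact h.2

end Schur

/-! ### The determinant identity for the composition. -/

section CompositionDet

variable {H₁ H₂ H₃ : Type*} [NormedAddCommGroup H₁] [InnerProductSpace ℝ H₁] [CompleteSpace H₁]
  [NormedAddCommGroup H₂] [InnerProductSpace ℝ H₂] [CompleteSpace H₂]
  [NormedAddCommGroup H₃] [InnerProductSpace ℝ H₃] [CompleteSpace H₃]
  {𝒜₁ : DirSum H₂ H₁ →L[ℝ] DirSum H₂ H₁} {𝒜₂ : DirSum H₃ H₂ →L[ℝ] DirSum H₃ H₂}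

lemma isNuclear_half_gluing_sub_one (h₁ : IsNuclear (𝒜₁ - 1)) (h₂ : IsNuclear (𝒜₂ - 1)) :
    IsNuclear ((1 / 2 : ℝ) • gluing 𝒜₂ 𝒜₁ - 1) := by
  have h : (1 / 2 : ℝ) • gluing 𝒜₂ 𝒜₁ - 1 =
      (1 / 2 : ℝ) • (block₁₁ (𝒜₁ - 1) + block₂₂ (𝒜₂ - 1)) := by
    rw [block₁₁_sub_one, block₂₂_sub_one, gluing]
    module
  rw [h]
  exact (h₁.block₁₁.add h₂.block₂₂).smul _

/-- The product of the determinants of `(A + M) / 2` and `(1 + 𝒜₂ ∘ 𝒜₁) / 2`, in terms of Schur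
complements. -/
lemma fredholmDet_gluing_mul_blockComp (hp₂ : IsPosDef 𝒜₂) (hp₁ : IsPosDef 𝒜₁)
    (hn₁ : IsNuclear (𝒜₁ - 1)) (hn₂ : IsNuclear (𝒜₂ - 1))
    {X₁ : DirSum H₂ H₁ →L[ℝ] DirSum H₂ H₁} {X₂ : DirSum H₃ H₂ →L[ℝ] DirSum H₃ H₂}
    (hX₁ : X₁ = (1 / 2 : ℝ) • (1 + 𝒜₁)) (hX₂ : X₂ = (1 / 2 : ℝ) • (1 + 𝒜₂))
    {κ : H₃ →L[ℝ] H₃} {δ : H₁ →L[ℝ] H₁} (hκ : block₁₁ X₂ * κ = 1) (hδ : block₂₂ X₁ * δ = 1) :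
    fredholmDet ((1 / 2 : ℝ) • gluing 𝒜₂ 𝒜₁) *
        fredholmDet ((1 / 2 : ℝ) • (1 + blockComp 𝒜₂ 𝒜₁)) =
      fredholmDet (block₁₁ X₂) * fredholmDet (block₂₂ X₁) *
        fredholmDet ((block₁₁ X₁ - block₁₂ X₁ ∘L δ ∘L block₂₁ X₁) +
          (block₂₂ X₂ - block₂₁ X₂ ∘L κ ∘L block₁₂ X₂) - 1) := by
  set R := Ring.inverse (gluing 𝒜₂ 𝒜₁) with hR
  have hGR : ∀ y, gluing 𝒜₂ 𝒜₁ (R y) = y := fun y =>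
    congrArg (fun A : H₂ →L[ℝ] H₂ => A y)
      (Ring.mul_inverse_cancel _ (hp₂.gluing hp₁).isUnit)
  have hκ' : ∀ x, block₁₁ X₂ (κ x) = x := fun x => congrArg (fun A : H₃ →L[ℝ] H₃ => A x) hκ
  have hδ' : ∀ x, block₂₂ X₁ (δ x) = x := fun x => congrArg (fun A : H₁ →L[ℝ] H₁ => A x) hδ
  -- Consider the operator on `H₂ ⊕ (H₃ ⊕ H₁)` with diagonal blocks `(A + M) / 2` and `Γ = diag
  -- (block₁₁ X₂, block₂₂ X₁)`, and off-diagonal blocks half of those of `𝒜₁`, `𝒜₂`. Its two Schur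
  -- complements are `Γ (1 + T U)` and `((A + M) / 2) (1 + U T)`, and the factors `1 + T U` and `1 +
  -- U T` have the same determinant.
  let T : H₂ →L[ℝ] DirSum H₃ H₁ := ofBlocks κ 0 0 δ ∘L
    (incl₁ H₃ H₁ ∘L block₁₂ 𝒜₂ + incl₂ H₃ H₁ ∘L block₂₁ 𝒜₁)
  let U : DirSum H₃ H₁ →L[ℝ] H₂ := (-(1 / 2 : ℝ)) • (R ∘L
    (block₂₁ 𝒜₂ ∘L WithLp.fstL 2 ℝ H₃ H₁ + block₁₂ 𝒜₁ ∘L WithLp.sndL 2 ℝ H₃ H₁))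
  have hU : IsNuclear U := by
    have hL := hn₂.block₂₁
    have hB := hn₁.block₁₂
    rw [block₂₁_sub_one] at hL
    rw [block₁₂_sub_one] at hB
    exact (((hL.comp_right _).add (hB.comp_right _)).comp_left _).smul _
  have hT : ∀ y, T y = pair (κ (block₁₂ 𝒜₂ y)) (δ (block₂₁ 𝒜₁ y)) := fun y => by
    change ofBlocks κ 0 0 δ (pair (block₁₂ 𝒜₂ y) (block₂₁ 𝒜₁ y)) = _
    rw [ofBlocks_pair]
    simp
  have hUp : ∀ u v, U (pair u v) = (-(1 / 2 : ℝ)) • R (block₂₁ 𝒜₂ u + block₁₂ 𝒜₁ v) :=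
    fun u v => by
      simp only [U, _root_.smul_apply, ContinuousLinearMap.comp_apply, _root_.add_apply, fstL_pair,
        sndL_pair]
  have b11 : ∀ x, block₁₁ X₁ x = (1 / 2 : ℝ) • (x + block₁₁ 𝒜₁ x) := fun x => by rw [hX₁]; rfl
  have b12 : ∀ x, block₁₂ X₁ x = (1 / 2 : ℝ) • block₁₂ 𝒜₁ x := fun x => by
    rw [hX₁]; exact congrArg _ (zero_add _)
  have b21 : ∀ x, block₂₁ X₁ x = (1 / 2 : ℝ) • block₂₁ 𝒜₁ x := fun x => by
    rw [hX₁]; exact congrArg _ (zero_add _)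
  have b22 : ∀ x, block₂₂ X₁ x = (1 / 2 : ℝ) • (x + block₂₂ 𝒜₁ x) := fun x => by rw [hX₁]; rfl
  have c11 : ∀ x, block₁₁ X₂ x = (1 / 2 : ℝ) • (x + block₁₁ 𝒜₂ x) := fun x => by rw [hX₂]; rfl
  have c12 : ∀ x, block₁₂ X₂ x = (1 / 2 : ℝ) • block₁₂ 𝒜₂ x := fun x => by
    rw [hX₂]; exact congrArg _ (zero_add _)
  have c21 : ∀ x, block₂₁ X₂ x = (1 / 2 : ℝ) • block₂₁ 𝒜₂ x := fun x => by
    rw [hX₂]; exact congrArg _ (zero_add _)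
  have c22 : ∀ x, block₂₂ X₂ x = (1 / 2 : ℝ) • (x + block₂₂ 𝒜₂ x) := fun x => by rw [hX₂]; rfl
  have hnX₁ : IsNuclear (X₁ - 1) := hX₁ ▸ isNuclear_half_one_add_sub_one hn₁
  have hnX₂ : IsNuclear (X₂ - 1) := hX₂ ▸ isNuclear_half_one_add_sub_one hn₂
  have hnδ : IsNuclear (block₂₂ X₁ - 1) := hnX₁.block₂₂
  have hnκ : IsNuclear (block₁₁ X₂ - 1) := hnX₂.block₁₁
  have hX₃ : (1 / 2 : ℝ) • (1 + blockComp 𝒜₂ 𝒜₁) =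
      ofBlocks (block₁₁ X₂) 0 0 (block₂₂ X₁) * (1 + T ∘L U) := by
    refine clm_ext_pair fun u v => ?_
    have e1 : blockComp 𝒜₂ 𝒜₁ (pair u v) =
        pair (block₁₁ 𝒜₂ u - block₁₂ 𝒜₂ (R (block₂₁ 𝒜₂ u + block₁₂ 𝒜₁ v)))
          (block₂₂ 𝒜₁ v - block₂₁ 𝒜₁ (R (block₂₁ 𝒜₂ u + block₁₂ 𝒜₁ v))) := by
      rw [blockComp, ofBlocks_pair, pair_inj]
      simp only [_root_.sub_apply, _root_.neg_apply, ContinuousLinearMap.comp_apply, map_add, ← hR]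
      constructor <;> abel
    simp only [mul_apply_eq_comp, _root_.smul_apply, _root_.add_apply, one_apply_eq_self,
      ContinuousLinearMap.comp_apply, e1, hUp, map_smul, hT]
    generalize R (block₂₁ 𝒜₂ u + block₁₂ 𝒜₁ v) = w
    have e2 : ∀ (c : ℝ) (x : H₃) (y : H₁), c • pair x y = pair (c • x) (c • y) := fun c x y => by
      simp only [pair, map_smul, smul_add]
    simp only [e2, pair_add, ofBlocks_pair, pair_inj, map_add, map_smul, hκ', hδ', _root_.zero_apply,
      zero_add]
    rw [c11, b22]
    constructor <;> module
  have hs : (block₁₁ X₁ - block₁₂ X₁ ∘L δ ∘L block₂₁ X₁) +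
      (block₂₂ X₂ - block₂₁ X₂ ∘L κ ∘L block₁₂ X₂) - 1 =
      ((1 / 2 : ℝ) • gluing 𝒜₂ 𝒜₁) * (1 + U ∘L T) := by
    ext y
    simp only [mul_apply_eq_comp, _root_.smul_apply, _root_.add_apply, _root_.sub_apply,
      one_apply_eq_self, ContinuousLinearMap.comp_apply, hT, hUp, map_add, map_smul, hGR, b11, b12,
      b21, c12, c21, c22]
    rw [show gluing 𝒜₂ 𝒜₁ y = block₁₁ 𝒜₁ y + block₂₂ 𝒜₂ y from rfl]
    module
  have hTU : IsNuclear (1 + T ∘L U - 1) := by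
    rw [add_sub_cancel_left]
    exact hU.comp_left T
  have hUT : IsNuclear (1 + U ∘L T - 1) := by
    rw [add_sub_cancel_left]
    exact hU.comp_right T
  have hΓ : IsNuclear (ofBlocks (block₁₁ X₂) 0 0 (block₂₂ X₁) - 1) := by
    rw [ofBlocks_sub_one]
    exact isNuclear_ofBlocks hnκ .zero .zero hnδ
  rw [hX₃, hs, fredholmDet_mul hΓ hTU,
    fredholmDet_mul (isNuclear_half_gluing_sub_one hn₁ hn₂) hUT,
    fredholmDet_blockDiagonal hnκ hnδ, fredholmDet_one_add_comm hU T]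
  ring

/-- Let `Yᵢ = 1 + C(𝒜ᵢ)` be the inverse of `Xᵢ = (1 + 𝒜ᵢ) / 2`, and put `z = block₂₂ Y₂`, `p =
block₁₁ Y₁`. Then `1 - (z - 1)(p - 1) = z (S₁ + S₂ - 1) p`, because the Schur complements satisfy
`S₁ p = 1` and `z S₂ = 1`. Jacobi's formula expresses `det z` and `det p` by complementary blocks of
`X₂` and `X₁`, and `fredholmDet_gluing_mul_blockComp` handles the middle factor. -/
lemma fredholmDet_composition (hp₂ : IsPosDef 𝒜₂) (hp₁ : IsPosDef 𝒜₁)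
    (hn₁ : IsNuclear (𝒜₁ - 1)) (hn₂ : IsNuclear (𝒜₂ - 1)) :
    fredholmDet (1 - block₂₂ (cayley 𝒜₂) * block₁₁ (cayley 𝒜₁)) *
        (fredholmDet ((1 / 2 : ℝ) • (1 + 𝒜₁)) * fredholmDet ((1 / 2 : ℝ) • (1 + 𝒜₂))) =
      fredholmDet ((1 / 2 : ℝ) • gluing 𝒜₂ 𝒜₁) *
        fredholmDet ((1 / 2 : ℝ) • (1 + blockComp 𝒜₂ 𝒜₁)) := by
  obtain ⟨X₁, hX₁⟩ : ∃ X₁, X₁ = (1 / 2 : ℝ) • (1 + 𝒜₁) := ⟨_, rfl⟩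
  obtain ⟨X₂, hX₂⟩ : ∃ X₂, X₂ = (1 / 2 : ℝ) • (1 + 𝒜₂) := ⟨_, rfl⟩
  have hnX₁ : IsNuclear (X₁ - 1) := hX₁ ▸ isNuclear_half_one_add_sub_one hn₁
  have hnX₂ : IsNuclear (X₂ - 1) := hX₂ ▸ isNuclear_half_one_add_sub_one hn₂
  have hpX₁ : IsPosDef X₁ := hX₁ ▸ (IsPosDef.one.add hp₁).smul (by norm_num)
  have hpX₂ : IsPosDef X₂ := hX₂ ▸ (IsPosDef.one.add hp₂).smul (by norm_num)
  obtain ⟨Y₁, hY₁⟩ : ∃ Y₁, Y₁ = 1 + cayley 𝒜₁ := ⟨_, rfl⟩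
  obtain ⟨Y₂, hY₂⟩ : ∃ Y₂, Y₂ = 1 + cayley 𝒜₂ := ⟨_, rfl⟩
  have hnY₁ : IsNuclear (Y₁ - 1) := by rw [hY₁, add_sub_cancel_left]; exact isNuclear_cayley hn₁
  have hnY₂ : IsNuclear (Y₂ - 1) := by rw [hY₂, add_sub_cancel_left]; exact isNuclear_cayley hn₂
  have hXY₁ : X₁ * Y₁ = 1 := by rw [hX₁, hY₁]; exact hp₁.mul_one_add_cayley
  have hXY₂ : X₂ * Y₂ = 1 := by rw [hX₂, hY₂]; exact hp₂.mul_one_add_cayley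
  have hYX₂ : Y₂ * X₂ = 1 := by rw [hX₂, hY₂]; exact hp₂.one_add_cayley_mul
  have hδu := hpX₁.block₂₂.isUnit
  have hκu := hpX₂.block₁₁.isUnit
  set δ := Ring.inverse (block₂₂ X₁) with hδ
  set κ := Ring.inverse (block₁₁ X₂) with hκ
  have hs₁ := schur_mul_block₁₁ hXY₁ (Ring.inverse_mul_cancel _ hδu)
  have hs₂ := block₂₂_mul_schur hYX₂ (Ring.mul_inverse_cancel _ hκu)
  rw [fredholmDet_gluing_mul_blockComp hp₂ hp₁ hn₁ hn₂ hX₁ hX₂ (Ring.mul_inverse_cancel _ hκu)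
    (Ring.mul_inverse_cancel _ hδu), ← hX₁, ← hX₂, ← hδ, ← hκ]
  rw [← hδ] at hs₁
  rw [← hκ] at hs₂
  have hnS₁ : IsNuclear (block₁₁ X₁ - block₁₂ X₁ ∘L δ ∘L block₂₁ X₁ - 1) := by
    have hB := hnX₁.block₁₂
    rw [block₁₂_sub_one] at hB
    rw [sub_right_comm]
    exact hnX₁.block₁₁.sub (hB.comp_right _)
  have hnS₂ : IsNuclear (block₂₂ X₂ - block₂₁ X₂ ∘L κ ∘L block₁₂ X₂ - 1) := by
    have hB := hnX₂.block₂₁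
    rw [block₂₁_sub_one] at hB
    rw [sub_right_comm]
    exact hnX₂.block₂₂.sub (hB.comp_right _)
  set S₁ := block₁₁ X₁ - block₁₂ X₁ ∘L δ ∘L block₂₁ X₁
  set S₂ := block₂₂ X₂ - block₂₁ X₂ ∘L κ ∘L block₁₂ X₂
  have hnS : IsNuclear (S₁ + S₂ - 1 - 1) := by
    have : S₁ + S₂ - 1 - 1 = (S₁ - 1) + (S₂ - 1) := by abel
    rw [this]
    exact hnS₁.add hnS₂
  have hnp : IsNuclear (block₁₁ Y₁ - 1) := hnY₁.block₁₁
  have hnz : IsNuclear (block₂₂ Y₂ - 1) := hnY₂.block₂₂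
  have hkey : 1 - block₂₂ (cayley 𝒜₂) * block₁₁ (cayley 𝒜₁) =
      block₂₂ Y₂ * (S₁ + S₂ - 1) * block₁₁ Y₁ := by
    have e1 : block₂₂ (cayley 𝒜₂) = block₂₂ Y₂ - 1 := by
      rw [hY₂, block₂₂_add, block₂₂_one, add_sub_cancel_left]
    have e2 : block₁₁ (cayley 𝒜₁) = block₁₁ Y₁ - 1 := by
      rw [hY₁, block₁₁_add, block₁₁_one, add_sub_cancel_left]
    have e3 : block₂₂ Y₂ * (S₁ + S₂ - 1) * block₁₁ Y₁ = block₂₂ Y₂ * (S₁ * block₁₁ Y₁) +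
        (block₂₂ Y₂ * S₂) * block₁₁ Y₁ - block₂₂ Y₂ * block₁₁ Y₁ := by noncomm_ring
    rw [e1, e2, e3, hs₁, hs₂]
    noncomm_ring
  rw [hkey, fredholmDet_mul (hnz.mul_sub_one hnS) hnp, fredholmDet_mul hnz hnS,
    ← fredholmDet_mul_block₁₁ hnX₁ hnY₁ hXY₁, ← fredholmDet_mul_block₂₂ hnX₂ hnY₂ hXY₂]
  ring

end CompositionDet

/-! ### The composition law -/

section CompositionLaw

lemma IsGaussian.of_inner_expo {H : Type*} [NormedAddCommGroup H] [InnerProductSpace ℝ H]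
    [CompleteSpace H] {T : H →L[ℝ] H} {w : H} {G : Fock H} {c : ℝ}
    (h : ∀ x, ⟪expo x, G⟫_ℝ = Real.exp (c + ((1 / 2) * ⟪T x, x⟫_ℝ + ⟪w, x⟫_ℝ))) :
    IsGaussian T w (Real.exp (-c) • G) := fun x => by
  rw [real_inner_smul_right, h, ← Real.exp_add, neg_add_cancel_left]

lemma inner_apply_pair {H₁ H₂ : Type*} [NormedAddCommGroup H₁] [InnerProductSpace ℝ H₁]
    [NormedAddCommGroup H₂] [InnerProductSpace ℝ H₂] {C : DirSum H₂ H₁ →L[ℝ] DirSum H₂ H₁}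
    (hC : IsSymContraction C) (x : H₂) (y : H₁) : ⟪C (pair x y), pair x y⟫_ℝ =
      ⟪block₁₁ C x, x⟫_ℝ + 2 * ⟪block₁₂ C y, x⟫_ℝ + ⟪block₂₂ C y, y⟫_ℝ := by
  rw [apply_pair, inner_pair, inner_add_left, inner_add_left, inner_block₁₂ hC.symm,
    real_inner_comm (block₂₁ C x) y]
  ring

variable {H₁ H₂ H₃ : Type*} [NormedAddCommGroup H₁] [InnerProductSpace ℝ H₁] [CompleteSpace H₁]
  [NormedAddCommGroup H₂] [InnerProductSpace ℝ H₂] [CompleteSpace H₂]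
  [NormedAddCommGroup H₃] [InnerProductSpace ℝ H₃] [CompleteSpace H₃]
  {𝒜₁ : DirSum H₂ H₁ →L[ℝ] DirSum H₂ H₁} {𝒜₂ : DirSum H₃ H₂ →L[ℝ] DirSum H₃ H₂}

lemma inner_fockOperator_expVector {C : DirSum H₂ H₁ →L[ℝ] DirSum H₂ H₁} (hC : IsSymContraction C)
    (hn : IsNuclear C) (x : H₂) (y : H₁) :
    ⟪expo x, fockOperator (expVector C) (expo y)⟫_ℝ =
      Real.exp ((1 / 2) * ⟪C (pair x y), pair x y⟫_ℝ) := by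
  rw [inner_fockOperator]
  exact hC.inner_expo_expVector hn (pair x y)

/-- On coherent vectors the left side is an inner product of two Gaussian vectors over `H₂`. The
terms of its exponent reassemble into `½ (⟪k, u⟫ + ⟪n, v⟫)`, where `(k, n)` is the value at `(u, v)`
of the Cayley transform of the composition. -/
lemma fockOperator_comp_fockOperator (hp₂ : IsPosDef 𝒜₂) (hp₁ : IsPosDef 𝒜₁)
    (hn₁ : IsNuclear (𝒜₁ - 1)) (hn₂ : IsNuclear (𝒜₂ - 1)) :
    fockOperator (expVector (cayley 𝒜₂)) ∘L fockOperator (expVector (cayley 𝒜₁)) =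
      (√(fredholmDet (1 - block₂₂ (cayley 𝒜₂) * block₁₁ (cayley 𝒜₁))))⁻¹ •
        fockOperator (expVector (cayley (blockComp 𝒜₂ 𝒜₁))) := by
  refine clm_ext_expo fun u v => ?_
  have hc₁ := hp₁.isSymContraction_cayley
  have hc₂ := hp₂.isSymContraction_cayley
  have hc₃ := (hp₂.blockComp hp₁).isSymContraction_cayley
  have hm₁ := isNuclear_cayley hn₁
  have hm₂ := isNuclear_cayley hn₂
  have hm₃ := isNuclear_cayley (isNuclear_blockComp_sub_one hn₁ hn₂)
  obtain ⟨s, t, k, n, e1, e2, e3⟩ := exists_cayley_blockComp_pair hp₂ hp₁ u v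
  set C₁ := cayley 𝒜₁
  set C₂ := cayley 𝒜₂
  -- With `u` fixed, the block quadratic form in `y` splits into a quadratic part, a linear part and
  -- a constant; the scalar removes the constant.
  have hG₂ : IsGaussian (block₂₂ C₂) (block₂₁ C₂ u)
      (Real.exp (-((1 / 2) * ⟪block₁₁ C₂ u, u⟫_ℝ)) •
        ContinuousLinearMap.adjoint (fockOperator (expVector C₂)) (expo u)) := by
    refine IsGaussian.of_inner_expo fun y => ?_
    rw [ContinuousLinearMap.adjoint_inner_right, real_inner_comm,
      inner_fockOperator_expVector hc₂ hm₂, inner_apply_pair hc₂, inner_block₁₂ hc₂.symm,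
      real_inner_comm (block₂₁ C₂ u) y]
    congr 1
    ring
  have hG₁ : IsGaussian (block₁₁ C₁) (block₁₂ C₁ v)
      (Real.exp (-((1 / 2) * ⟪block₂₂ C₁ v, v⟫_ℝ)) • fockOperator (expVector C₁) (expo v)) := by
    refine IsGaussian.of_inner_expo fun y => ?_
    rw [inner_fockOperator_expVector hc₁ hm₁, inner_apply_pair hc₁]
    congr 1
    ring
  rw [apply_pair, pair_inj] at e1 e2
  -- The `H₂` components of the two Cayley identities are exactly the equations required of `s` and
  -- `t`.
  have h := hG₂.inner hG₁ hc₂.block₂₂ hc₁.block₁₁ hm₁.block₁₁ (s := s) (t := t) e1.2.symm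
    (by rw [add_comm]; exact e2.1.symm)
  rw [real_inner_smul_left, real_inner_smul_right, ContinuousLinearMap.adjoint_inner_left] at h
  have h' : ⟪expo u, fockOperator (expVector C₂) (fockOperator (expVector C₁) (expo v))⟫_ℝ =
      (√(fredholmDet (1 - block₂₂ C₂ * block₁₁ C₁)))⁻¹ * Real.exp
        ((1 / 2) * ⟪block₁₁ C₂ u, u⟫_ℝ + ((1 / 2) * ⟪block₂₂ C₁ v, v⟫_ℝ +
          (1 / 2) * (⟪block₂₁ C₂ u, s⟫_ℝ + ⟪block₁₂ C₁ v, t⟫_ℝ))) := by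
    rw [Real.exp_add, Real.exp_add]
    rw [Real.exp_neg, Real.exp_neg] at h
    field_simp at h ⊢
    linarith
  rw [ContinuousLinearMap.comp_apply, h', _root_.smul_apply, real_inner_smul_right,
    inner_fockOperator_expVector hc₃ hm₃, e3, inner_pair, ← e1.1, ← e2.2, inner_add_left,
    inner_add_left, inner_block₁₂ hc₂.symm, inner_block₁₂ hc₁.symm,
    real_inner_comm (block₂₁ C₂ u) s, real_inner_comm (block₂₁ C₁ t) v]
  congr 2
  ring

/-- After the norm formula the fourth roots cancel, and the remaining identity is the square root of
`fredholmDet_composition`. -/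
lemma composition_constant (hp₂ : IsPosDef 𝒜₂) (hp₁ : IsPosDef 𝒜₁)
    (hn₁ : IsNuclear (𝒜₁ - 1)) (hn₂ : IsNuclear (𝒜₂ - 1)) :
    (fredholmDet 𝒜₁ ^ (1 / 4 : ℝ) * fredholmDet 𝒜₂ ^ (1 / 4 : ℝ)) /
          (fredholmDet ((1 / 2 : ℝ) • gluing 𝒜₂ 𝒜₁) ^ (1 / 2 : ℝ) *
            fredholmDet (blockComp 𝒜₂ 𝒜₁) ^ (1 / 4 : ℝ)) *
        ((‖expVector (cayley 𝒜₁)‖ * ‖expVector (cayley 𝒜₂)‖) /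
          ‖expVector (cayley (blockComp 𝒜₂ 𝒜₁))‖) =
      (√(fredholmDet (1 - block₂₂ (cayley 𝒜₂) * block₁₁ (cayley 𝒜₁))))⁻¹ := by
  have hp₃ := hp₂.blockComp hp₁
  have hn₃ := isNuclear_blockComp_sub_one hn₁ hn₂
  have x₁ := hp₁.fredholmDet_half_one_add_pos hn₁
  have x₂ := hp₂.fredholmDet_half_one_add_pos hn₂
  have x₃ := hp₃.fredholmDet_half_one_add_pos hn₃
  have d₁ := Real.rpow_pos_of_pos (hp₁.fredholmDet_pos hn₁) (1 / 4)
  have d₂ := Real.rpow_pos_of_pos (hp₂.fredholmDet_pos hn₂) (1 / 4)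
  have d₃ := Real.rpow_pos_of_pos (hp₃.fredholmDet_pos hn₃) (1 / 4)
  have hg : 0 < fredholmDet ((1 / 2 : ℝ) • gluing 𝒜₂ 𝒜₁) :=
    ((hp₂.gluing hp₁).smul (by norm_num)).fredholmDet_pos (isNuclear_half_gluing_sub_one hn₁ hn₂)
  have hzp : 0 < fredholmDet (1 - block₂₂ (cayley 𝒜₂) * block₁₁ (cayley 𝒜₁)) :=
    fredholmDet_one_sub_mul_pos hp₂.isSymContraction_cayley.block₂₂
      hp₁.isSymContraction_cayley.block₁₁ (isNuclear_cayley hn₁).block₁₁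
  have hdet := congrArg Real.sqrt (fredholmDet_composition hp₂ hp₁ hn₁ hn₂)
  rw [Real.sqrt_mul hzp.le, Real.sqrt_mul x₁.le, Real.sqrt_mul hg.le] at hdet
  rw [hp₁.norm_expVector_cayley hn₁, hp₂.norm_expVector_cayley hn₂,
    hp₃.norm_expVector_cayley hn₃, ← Real.sqrt_eq_rpow]
  have r₁ := Real.sqrt_pos.2 x₁
  have r₂ := Real.sqrt_pos.2 x₂
  have r₃ := Real.sqrt_pos.2 x₃
  have rg := Real.sqrt_pos.2 hg
  have rz := Real.sqrt_pos.2 hzp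
  field_simp
  linarith

end CompositionLaw

end FreeField

end

open FreeField in
/-- The composition law for the operators `ℰ(C(𝒜))`. -/
theorem propositionP4p1p6
    {H₁ H₂ H₃ : Type*}
    [NormedAddCommGroup H₁] [InnerProductSpace ℝ H₁] [CompleteSpace H₁]
    [TopologicalSpace.SeparableSpace H₁]
    [NormedAddCommGroup H₂] [InnerProductSpace ℝ H₂] [CompleteSpace H₂]
    [TopologicalSpace.SeparableSpace H₂]
    [NormedAddCommGroup H₃] [InnerProductSpace ℝ H₃] [CompleteSpace H₃]
    [TopologicalSpace.SeparableSpace H₃]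
    (𝒜₁ : DirSum H₂ H₁ →L[ℝ] DirSum H₂ H₁) (𝒜₂ : DirSum H₃ H₂ →L[ℝ] DirSum H₃ H₂)
    (hpos₁ : IsPositiveOperator 𝒜₁) (hpos₂ : IsPositiveOperator 𝒜₂)
    (htr₁ : IsTraceClass (𝒜₁ - 1)) (htr₂ : IsTraceClass (𝒜₂ - 1)) :
    -- the composition `𝒜₂ ∘ 𝒜₁` is defined and is again of the same kind
    IsUnit (gluing 𝒜₂ 𝒜₁) ∧
    IsPositiveOperator (blockComp 𝒜₂ 𝒜₁) ∧ IsTraceClass (blockComp 𝒜₂ 𝒜₁ - 1) ∧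
    -- the Cayley transforms are defined
    IsUnit (1 + 𝒜₁) ∧ IsUnit (1 + 𝒜₂) ∧ IsUnit (1 + blockComp 𝒜₂ 𝒜₁) ∧
    -- the Fredholm determinants exist and are positive
    HasFredholmDet 𝒜₁ (fredholmDet 𝒜₁) ∧ 0 < fredholmDet 𝒜₁ ∧
    HasFredholmDet 𝒜₂ (fredholmDet 𝒜₂) ∧ 0 < fredholmDet 𝒜₂ ∧
    HasFredholmDet ((1 / 2 : ℝ) • gluing 𝒜₂ 𝒜₁) (fredholmDet ((1 / 2 : ℝ) • gluing 𝒜₂ 𝒜₁)) ∧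
    0 < fredholmDet ((1 / 2 : ℝ) • gluing 𝒜₂ 𝒜₁) ∧
    HasFredholmDet (blockComp 𝒜₂ 𝒜₁) (fredholmDet (blockComp 𝒜₂ 𝒜₁)) ∧
    0 < fredholmDet (blockComp 𝒜₂ 𝒜₁) ∧
    -- the vectors `ℰ(C(·))` exist in the Fock spaces
    IsExpVector (cayley 𝒜₁) (expVector (cayley 𝒜₁)) ∧
    IsExpVector (cayley 𝒜₂) (expVector (cayley 𝒜₂)) ∧
    IsExpVector (cayley (blockComp 𝒜₂ 𝒜₁)) (expVector (cayley (blockComp 𝒜₂ 𝒜₁))) ∧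
    -- each of them corresponds to exactly one bounded operator between Fock spaces
    (∃! T, IsOperatorOf (expVector (cayley 𝒜₁)) T) ∧
    (∃! T, IsOperatorOf (expVector (cayley 𝒜₂)) T) ∧
    (∃! T, IsOperatorOf (expVector (cayley (blockComp 𝒜₂ 𝒜₁))) T) ∧
    -- the composition law
    fockOperator (expVector (cayley 𝒜₂)) ∘L fockOperator (expVector (cayley 𝒜₁)) =
      ((fredholmDet 𝒜₁ ^ (1 / 4 : ℝ) * fredholmDet 𝒜₂ ^ (1 / 4 : ℝ)) /
          (fredholmDet ((1 / 2 : ℝ) • gluing 𝒜₂ 𝒜₁) ^ (1 / 2 : ℝ) *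
            fredholmDet (blockComp 𝒜₂ 𝒜₁) ^ (1 / 4 : ℝ)) *
        ((‖expVector (cayley 𝒜₁)‖ * ‖expVector (cayley 𝒜₂)‖) /
          ‖expVector (cayley (blockComp 𝒜₂ 𝒜₁))‖)) •
        fockOperator (expVector (cayley (blockComp 𝒜₂ 𝒜₁))) := by
  have hn₁ : IsNuclear (𝒜₁ - 1) := isNuclear_iff_isTraceClass.2 htr₁
  have hn₂ : IsNuclear (𝒜₂ - 1) := isNuclear_iff_isTraceClass.2 htr₂
  have hp₁ := hpos₁.isPosDef hn₁
  have hp₂ := hpos₂.isPosDef hn₂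
  have hp₃ := hp₂.blockComp hp₁
  have hn₃ := isNuclear_blockComp_sub_one hn₁ hn₂
  have hpg := hp₂.gluing hp₁
  have hng := isNuclear_half_gluing_sub_one hn₁ hn₂
  refine ⟨hpg.isUnit, hp₃.isPositiveOperator, isNuclear_iff_isTraceClass.1 hn₃,
    hp₁.isUnit_one_add, hp₂.isUnit_one_add, hp₃.isUnit_one_add,
    hn₁.hasFredholmDet, hp₁.fredholmDet_pos hn₁, hn₂.hasFredholmDet, hp₂.fredholmDet_pos hn₂,
    hng.hasFredholmDet, (hpg.smul (by norm_num)).fredholmDet_pos hng,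
    hn₃.hasFredholmDet, hp₃.fredholmDet_pos hn₃,
    hp₁.isSymContraction_cayley.isExpVector (isNuclear_cayley hn₁),
    hp₂.isSymContraction_cayley.isExpVector (isNuclear_cayley hn₂),
    hp₃.isSymContraction_cayley.isExpVector (isNuclear_cayley hn₃),
    existsUnique_isOperatorOf _, existsUnique_isOperatorOf _, existsUnique_isOperatorOf _, ?_⟩
  rw [composition_constant hp₂ hp₁ hn₁ hn₂]
  exact fockOperator_comp_fockOperator hp₂ hp₁ hn₁ hn₂
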